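/- Let $\delta,\kappa,\rho,\sigma_1,\sigma_2>0$, $\lambda\ge 0$, and let $c:[0,\infty)\to[0,\infty)$ be strictly increasing, strictly convex and twice continuously differentiable with $c'(h)\to\infty$ as $h\to\infty$. Put $$a_1=\tfrac14\bigl(-\delta\rho+\sqrt{\delta^2\rho^2+4\kappa\rho}\bigr),\quad a_3=\frac{2a_1\rho}{\delta\rho+\lambda\rho+2a_1},\quad a_2=\frac{a_3(2\rho-a_3)}{2\rho(2\lambda+\delta)},\quad \bar a=a_3-a_2(2\lambda+\delta),$$ $$f(\gamma,h)=-(\sigma_1^{-2}+h)\gamma^2-2\lambda\gamma+\sigma_2^2,\qquad \gamma^0_\infty=-\lambda\sigma_1^2+\sqrt{\lambda^2\sigma_1^4+\sigma_1^2\sigma_2^2}.$$ Fix $\gamma_{\max}>\gamma^0_\infty$, let $h_{\max}=(c')^{-1}(\gamma_{\max}^2\bar a/\delta)$ (with $h_{\max}=0$ if $\gamma_{\max}^2\bar a/\delta<c'(0)$), and for $\gamma_0\in[0,\gamma_{\max}]$ let $$v(\gamma_0)=\inf_h\int_0^\infty e^{-\delta t}\bigl(\bar a\,\gamma^h_t+c(h_t)\bigr)\,dt,\qquad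 d\gamma^h_t=f(\gamma^h_t,h_t)\,dt,\quad \gamma^h_0=\gamma_0,$$ the infimum being over Borel measurable $h:[0,\infty)\to[0,h_{\max}]$. Let $\hat h(y)=\arg\max_{h\in[0,h_{\max}]}\{hy-c(h)\}$ and $H^*(\gamma)=\hat h(\gamma^2v'(\gamma))$, with one-sided derivatives at the end points of $[0,\gamma_{\max}]$. **Equilibrium.** There is exactly one $\gamma_{\rm eq}\in[0,\gamma_{\max}]$ with $f(\gamma_{\rm eq},H^*(\gamma_{\rm eq}))=0$. It satisfies $0<\gamma_{\rm eq}\le\gamma^0_\infty$, $v$ is differentiable at $\gamma_{\rm eq}$, and with $p_{\rm eq}=v'(\gamma_{\rm eq})$ the pair $(\gamma_{\rm eq},p_{\rm eq})$ is the unique solution in $[0,\infty)\times\mathbb R$ of the state–adjoint equilibrium system $$f\bigl(\gamma,\hat h(\gamma^2p)\bigr)=0,\qquad \bigl(2(\sigma_1^{-2}+\hat h(\gamma^2p))\gamma+2\lambda+\delta\bigr)p=\bar a.$$ Put $h_{\rm eq}=H^*(\gamma_{\rm eq})$ and $v_{\rm eq}=v(\gamma_{\rm eq})$. Let one of the parameters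 $\sigma_1,\sigma_2,\kappa$, or the scaling $\alpha$ of the cost function $\alpha c$, vary in $(0,\infty)$, all else being fixed, where at each parameter value $\gamma_{\max}>\gamma^0_\infty$ may be chosen arbitrarily. Call a parameter value *active* if $h_{\rm eq}>0$ and the second derivative of the cost function ($c$, respectively $\alpha c$) at $h_{\rm eq}$ is positive, and *inactive* if $\gamma_{\rm eq}^2p_{\rm eq}$ is smaller than the derivative of the cost function at $0$ (in which case $h_{\rm eq}=0$). 1. *In $\sigma_1$ and in $\sigma_2$:* $\gamma_{\rm eq}$ and $v_{\rm eq}$ are strictly increasing, $h_{\rm eq}$ is nondecreasing, and $h_{\rm eq}$ at a smaller parameter value is strictly below $h_{\rm eq}$ at a larger one whenever the latter is positive. At active values all three are differentiable with positive derivatives. At inactive values all three are differentiable, the derivatives of $\gamma_{\rm eq}$ and $v_{\rm eq}$ are positive, and that of $h_{\rm eq}$ is $0$. 2. *In $\kappa$:* $\gamma_{\rm eq}$ is nonincreasing and $h_{\rm eq}$ is nondecreasing; for $\kappa<\kappa'$ both change strictly if $h_{\rm eq}>0$ at $\kappa'$. At active values both are differentiable with $\frac{d\gamma_{\rm eq}}{d\kappa}<0<\frac{dh_{\rm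 eq}}{d\kappa}$. At inactive values both derivatives exist and are $0$. 3. *In $\alpha$:* $\gamma_{\rm eq}$ and $v_{\rm eq}$ are nondecreasing and $h_{\rm eq}$ is nonincreasing; for $\alpha<\alpha'$ all three change strictly if $h_{\rm eq}>0$ at $\alpha$; if $c(0)>0$, then $v_{\rm eq}$ is strictly increasing. At active values all three are differentiable with $\frac{d\gamma_{\rm eq}}{d\alpha}>0$, $\frac{dh_{\rm eq}}{d\alpha}<0$, $\frac{dv_{\rm eq}}{d\alpha}>0$. At inactive values all three are differentiable with $\frac{d\gamma_{\rm eq}}{d\alpha}=\frac{dh_{\rm eq}}{d\alpha}=0$ and $\frac{dv_{\rm eq}}{d\alpha}=c(0)/\delta$. -/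

import Mathlib

open Set Filter Topology MeasureTheory

noncomputable section

/-- Parameters of the reduced (deterministic) information acquisition problem: discount rate `delta`,
speed of mean reversion `lam`, state cost coefficient `kappa`, control cost coefficient `rho`,
volatilities `sigma1`, `sigma2`, and the information cost function `c` (only its values on `[0, ∞)`
matter). -/
structure Params where
  delta : ℝ
  lam : ℝ
  kappa : ℝ
  rho : ℝ
  sigma1 : ℝ
  sigma2 : ℝ
  c : ℝ → ℝ

/-- `c : [0, ∞) → [0, ∞)` is strictly increasing, strictly convex and `C²`, and its derivative is
unbounded (so that `(c')⁻¹` is defined at every level `≥ c'(0)`). -/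
structure IsInformationCost (c : ℝ → ℝ) : Prop where
  nonneg : ∀ h, 0 ≤ h → 0 ≤ c h
  strictMono : StrictMonoOn c (Ici 0)
  strictConvex : StrictConvexOn ℝ (Ici 0) c
  contDiff : ContDiffOn ℝ 2 c (Ici 0)
  marginal_tendsto : Tendsto (derivWithin c (Ici 0)) atTop atTop

namespace Params

structure Valid (P : Params) : Prop where
  delta_pos : 0 < P.delta
  lam_nonneg : 0 ≤ P.lam
  kappa_pos : 0 < P.kappa
  rho_pos : 0 < P.rho
  sigma1_pos : 0 < P.sigma1
  sigma2_pos : 0 < P.sigma2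
  cost : IsInformationCost P.c

/-- The marginal cost `c'` on `[0, ∞)`, one-sided at `0`. -/
def dc (P : Params) (h : ℝ) : ℝ := derivWithin P.c (Ici 0) h

/-- The second derivative `c''` on `[0, ∞)`, one-sided at `0`. -/
def ddc (P : Params) (h : ℝ) : ℝ := derivWithin P.dc (Ici 0) h

def a1 (P : Params) : ℝ :=
  -(P.delta * P.rho) / 4 + Real.sqrt (P.delta ^ 2 * P.rho ^ 2 + 4 * P.kappa * P.rho) / 4

def a3 (P : Params) : ℝ :=
  2 * P.a1 * P.rho / (P.delta * P.rho + P.lam * P.rho + 2 * P.a1)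

def a2 (P : Params) : ℝ :=
  P.a3 * (2 * P.rho - P.a3) / (2 * P.rho * (2 * P.lam + P.delta))

/-- The running cost coefficient `ā = a₃ - a₂ (2 λ + δ)` of the conditional variance. -/
def abar (P : Params) : ℝ := P.a3 - P.a2 * (2 * P.lam + P.delta)

/-- The drift `f(γ, h) = -(1/σ₁² + h) γ² - 2 λ γ + σ₂²` of the conditional variance. -/
def f (P : Params) (γ h : ℝ) : ℝ :=
  -((1 / P.sigma1) ^ 2 + h) * γ ^ 2 - 2 * P.lam * γ + P.sigma2 ^ 2

/-- The equilibrium of the uncontrolled conditional variance. -/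
def gammaInf (P : Params) : ℝ :=
  -(P.lam * P.sigma1 ^ 2) +
    Real.sqrt (P.lam ^ 2 * P.sigma1 ^ 4 + P.sigma1 ^ 2 * P.sigma2 ^ 2)

/-- `M₀ = γmax² ā / δ`. -/
def M0 (P : Params) (gmax : ℝ) : ℝ := gmax ^ 2 * (P.abar / P.delta)

/-- `hmax = (c')⁻¹(M₀)`; it is `0` if `M₀ < c'(0)`. -/
def hmax (P : Params) (gmax : ℝ) : ℝ := sSup {h | 0 ≤ h ∧ P.dc h ≤ P.M0 gmax}

/-- Borel measurable information acquisition rates with values in `[0, hmax]`; only the values at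
times `t ≥ 0` matter. -/
def IsControl (P : Params) (gmax : ℝ) (h : ℝ → ℝ) : Prop :=
  Measurable h ∧ ∀ t, h t ∈ Icc 0 (P.hmax gmax)

/-- `x` is the (absolutely continuous) solution on `[0, ∞)` of `dx = f(x, h) dt`, `x 0 = γ₀`,
in integrated form. The integrand is locally bounded and measurable for every control `h`. -/
def IsTrajectory (P : Params) (h : ℝ → ℝ) (γ₀ : ℝ) (x : ℝ → ℝ) : Prop :=
  ContinuousOn x (Ici 0) ∧ ∀ t, 0 ≤ t → x t = γ₀ + ∫ s in (0 : ℝ)..t, P.f (x s) (h s)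

/-- Discounted cost of a control `h` with state trajectory `x`. -/
def J (P : Params) (h x : ℝ → ℝ) : ℝ :=
  ∫ t in Ioi (0 : ℝ), Real.exp (-(P.delta * t)) * (P.abar * x t + P.c (h t))

/-- The value function of the reduced control problem on `[0, gmax]`. -/
def v (P : Params) (gmax γ₀ : ℝ) : ℝ :=
  sInf {r | ∃ h x : ℝ → ℝ, P.IsControl gmax h ∧ P.IsTrajectory h γ₀ x ∧ r = P.J h x}

/-- The derivative of the value function on `[0, gmax]`, one-sided at the end points. -/
def dv (P : Params) (gmax γ : ℝ) : ℝ := derivWithin (P.v gmax) (Icc 0 gmax) γ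

/-- `ĥ(y) = argmax {h y - c(h) : h ∈ [0, hmax]}`; the maximizer is unique by strict convexity. -/
def hhat (P : Params) (gmax y : ℝ) : ℝ :=
  sSup {h | h ∈ Icc 0 (P.hmax gmax) ∧
    IsMaxOn (fun k => k * y - P.c k) (Icc 0 (P.hmax gmax)) h}

/-- The optimal feedback map `H*(γ) = ĥ(γ² v'(γ))`. -/
def feedback (P : Params) (gmax γ : ℝ) : ℝ := P.hhat gmax (γ ^ 2 * P.dv gmax γ)

/-- The equilibrium `γ_eq`: the root in `[0, gmax]` of `γ ↦ f(γ, H*(γ))`. -/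
def gammaEq (P : Params) (gmax : ℝ) : ℝ :=
  sSup {γ | γ ∈ Icc 0 gmax ∧ P.f γ (P.feedback gmax γ) = 0}

/-- The optimal information acquisition rate `h_eq = H*(γ_eq)` at the equilibrium. -/
def hEq (P : Params) (gmax : ℝ) : ℝ := P.feedback gmax (P.gammaEq gmax)

/-- The value `v_eq = v(γ_eq)` at the equilibrium. -/
def vEq (P : Params) (gmax : ℝ) : ℝ := P.v gmax (P.gammaEq gmax)

/-- The adjoint state `p_eq = v'(γ_eq)` at the equilibrium. -/
def pEq (P : Params) (gmax : ℝ) : ℝ := P.dv gmax (P.gammaEq gmax)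

/-- The coefficients `Φ(γ, p)` of the state and the adjoint equation. -/
def Phi (P : Params) (gmax γ p : ℝ) : ℝ × ℝ :=
  (-((1 / P.sigma1) ^ 2 + P.hhat gmax (γ ^ 2 * p)) * γ ^ 2 - 2 * P.lam * γ + P.sigma2 ^ 2,
    (2 * ((1 / P.sigma1) ^ 2 + P.hhat gmax (γ ^ 2 * p)) * γ + 2 * P.lam + P.delta) * p - P.abar)

/-- Information is acquired at the equilibrium, and `c''(h_eq) > 0`, so that `ĥ` is differentiable
with positive derivative `1 / c''(h_eq)` at `γ_eq² p_eq`. -/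
def IsActive (P : Params) (gmax : ℝ) : Prop :=
  0 < P.hEq gmax ∧ 0 < P.ddc (P.hEq gmax)

/-- `γ_eq² p_eq < c'(0)`, so that `ĥ` vanishes near `γ_eq² p_eq`. -/
def IsInactive (P : Params) (gmax : ℝ) : Prop :=
  P.gammaEq gmax ^ 2 * P.pEq gmax < P.dc 0

def withSigma1 (P : Params) (s : ℝ) : Params := { P with sigma1 := s }

def withSigma2 (P : Params) (s : ℝ) : Params := { P with sigma2 := s }

def withKappa (P : Params) (k : ℝ) : Params := { P with kappa := k }

/-- The cost function `c` is replaced by `α c`. -/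
def scaleCost (P : Params) (α : ℝ) : Params := { P with c := fun h => α * P.c h }

/-- `Q θ` is a one-parameter family of parameters indexed by `θ > 0`, and `g θ` a choice of the bound
`γmax` on the conditional variance for each of them. All of `γ_eq`, `h_eq`, `v_eq` increase in `θ`;
`γ_eq`, `v_eq` strictly, and `h_eq` strictly wherever it is positive. The last two parts give the
signs of the derivatives. -/
structure IncreasingInVolatility (Q : ℝ → Params) (g : ℝ → ℝ) : Prop where
  gamma_strictMono : StrictMonoOn (fun θ => (Q θ).gammaEq (g θ)) (Ioi 0)
  h_mono : MonotoneOn (fun θ => (Q θ).hEq (g θ)) (Ioi 0)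
  h_strict : ∀ s t, 0 < s → s < t → 0 < (Q t).hEq (g t) → (Q s).hEq (g s) < (Q t).hEq (g t)
  v_strictMono : StrictMonoOn (fun θ => (Q θ).vEq (g θ)) (Ioi 0)
  deriv_active : ∀ s, 0 < s → (Q s).IsActive (g s) → ∃ dγ dh dw : ℝ,
    HasDerivAt (fun θ => (Q θ).gammaEq (g θ)) dγ s ∧
    HasDerivAt (fun θ => (Q θ).hEq (g θ)) dh s ∧
    HasDerivAt (fun θ => (Q θ).vEq (g θ)) dw s ∧ 0 < dγ ∧ 0 < dh ∧ 0 < dw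
  deriv_inactive : ∀ s, 0 < s → (Q s).IsInactive (g s) → ∃ dγ dw : ℝ,
    HasDerivAt (fun θ => (Q θ).gammaEq (g θ)) dγ s ∧
    HasDerivAt (fun θ => (Q θ).hEq (g θ)) 0 s ∧
    HasDerivAt (fun θ => (Q θ).vEq (g θ)) dw s ∧ 0 < dγ ∧ 0 < dw

end Params

end

/-! In the precision y = 1/γ the state equation reads dy/dt = σ₁⁻² + h + 2λy − σ₂²y², and the proof
plays the two coordinates against each other.

For a fixed control the state is concave in γ₀, so the infimum v is concave (`concaveOn_v`). The
drift of y is jointly concave in (y, h), c is convex and 1/y is convex and decreasing, so y ↦ v(1/y)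
is convex (`convexOn_v_inv`). Concavity puts a tangent line above v, convexity in y puts a smooth
curve below it, and v is differentiable on (0, ∞). Since the derivative of v(1/y) in y is −γ²v'(γ),
the function γ²v'(γ) is nondecreasing; so is H*, and γ ↦ f(γ, H*(γ)) is strictly decreasing. There
is at most one equilibrium.

The equilibrium is found without solving a Hamilton–Jacobi–Bellman equation. Let (γ, k) have zero
drift and satisfy the first-order condition for the stationary adjoint state p (`IsSteady`). The
function of γ₀ that is affine in 1/γ₀, with slope −γ²p and value (āγ + c(k))/δ at γ, is a lower
bound of the cost of every control (`IsSteady.le_J`): the running cost exceeds the required amount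
by a square plus the convexity gap of c. The constant control k attains the bound at γ. Hence v(γ)
and v'(γ) = p are explicit, H*(γ) = k, and γmax plays no role.

With B = σ₂² and S = σ₁⁻², a steady state is k = By² − 2λy − S ≥ 0 together with c'(k)N ≥ ā, with
equality if k > 0, where N = y²(2By + δ − 2λ) (`PrecisionSteady`). Along the admissible range both k
and N increase in y, which gives existence by the intermediate value theorem and all monotonicity
statements by `PrecisionSteady.compare`. The parameter κ enters only through ā, which increases in
κ, and scaling the cost by α amounts to replacing ā by ā/α. At active values the equality is
differentiated implicitly; at inactive values the equilibrium is locally the uncontrolled one. The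
value increases in α because, to first order, the gain from a higher precision outweighs the cost of
acquiring it, by a margin proportional to δ. -/

/-! ### Differentiability from one-sided bounds -/

/-- A function squeezed between two differentiable functions that agree at a point is
differentiable there. -/
lemma hasDerivAt_of_squeeze {f g u : ℝ → ℝ} {x f' g' : ℝ} (hf : HasDerivAt f f' x)
    (hg : HasDerivAt g g' x) (hfu : ∀ᶠ z in 𝓝 x, f z ≤ u z) (hug : ∀ᶠ z in 𝓝 x, u z ≤ g z)
    (hfx : f x = u x) (hgx : g x = u x) : HasDerivAt u f' x := by
  have hmin : IsLocalMin (fun z => g z - f z) x := by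
    filter_upwards [hfu, hug] with z h1 h2
    linarith
  have hfg : g' - f' = 0 := hmin.hasDerivAt_eq_zero (hg.sub hf)
  obtain rfl : g' = f' := by linarith
  rw [hasDerivAt_iff_isLittleO] at hf hg ⊢
  rw [Asymptotics.isLittleO_iff] at hf hg ⊢
  intro c hc
  filter_upwards [hf hc, hg hc, hfu, hug] with z h1 h2 h3 h4
  rw [Real.norm_eq_abs, abs_le] at h1 h2 ⊢
  constructor <;> simp only [smul_eq_mul] at h1 h2 ⊢ <;> linarith [h1.1, h2.2]

/-- A function on `(0, ∞)` that is concave, and convex in the reciprocal of its argument, is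
differentiable. -/
lemma differentiableAt_of_concaveOn_of_convexOn_inv {u : ℝ → ℝ} (hu : ConcaveOn ℝ (Ioi 0) u)
    (hw : ConvexOn ℝ (Ioi 0) fun y => u y⁻¹) {x : ℝ} (hx : 0 < x) : DifferentiableAt ℝ u x := by
  have hsub : ∀ {g : ℝ → ℝ}, ConvexOn ℝ (Ioi 0) g → ∀ {y : ℝ}, 0 < y →
      ∃ b, ∀ z, 0 < z → g y + b * (z - y) ≤ g z := by
    intro g hg y hy
    have hy' : y ∈ interior (Ioi (0 : ℝ)) := by simpa using hy
    -- The right derivative serves as a subgradient: it lies between the slopes on the two sides.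
    refine ⟨derivWithin g (Ioi y) y, fun z hz => ?_⟩
    rcases lt_trichotomy y z with h | h | h
    · have := hg.rightDeriv_le_slope_of_mem_interior hy' hz h
      rw [slope_def_field, le_div_iff₀ (by linarith)] at this
      linarith
    · simp [h]
    · have h1 := hg.slope_le_leftDeriv_of_mem_interior hz hy' h
      have h2 := h1.trans (hg.leftDeriv_le_rightDeriv_of_mem_interior hy')
      rw [slope_def_field, div_le_iff₀ (by linarith)] at h2
      linarith
  obtain ⟨a, ha⟩ := hsub hu.neg hx
  obtain ⟨b, hb⟩ := hsub hw (inv_pos.2 hx)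
  -- The minorant is the supporting line in the variable 1/z; the majorant below is the tangent line
  -- of the concave function.
  have hd1 : HasDerivAt (fun z => u x + b * (z⁻¹ - x⁻¹)) (b * (-(x ^ 2)⁻¹)) x :=
    (((hasDerivAt_inv hx.ne').sub_const _).const_mul b).const_add _
  have hd2 : HasDerivAt (fun z => u x - a * (z - x)) (-(a * 1)) x :=
    (((hasDerivAt_id x).sub_const x).const_mul a).const_sub _
  refine (hasDerivAt_of_squeeze (u := u) hd1 hd2 ?_ ?_ (by simp) (by simp)).differentiableAt
  · filter_upwards [eventually_gt_nhds hx] with z hz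
    simpa using hb z⁻¹ (inv_pos.2 hz)
  · filter_upwards [eventually_gt_nhds hx] with z hz
    have := ha z hz
    simp only [Pi.neg_apply] at this
    linarith

/-! ### Functions in integral form: comparison, reciprocals, discounting, existence -/

/-- Comparison principle for functions in integral form. -/
lemma nonpos_of_integral_form {e φ : ℝ → ℝ} {K η : ℝ} (hη : 0 < η) (hK : 0 ≤ K)
    (he : ContinuousOn e (Ici 0)) (h0 : e 0 ≤ 0)
    (hφ : ∀ T, 0 ≤ T → IntervalIntegrable φ volume 0 T)
    (hint : ∀ t, 0 ≤ t → e t = e 0 + ∫ s in (0 : ℝ)..t, φ s)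
    (hle : ∀ s, 0 ≤ s → 0 < e s → e s < η → φ s ≤ K * e s) {t : ℝ} (ht : 0 ≤ t) : e t ≤ 0 := by
  by_contra! hpos
  -- The argument starts at the last time `t0` before `t` at which `e` is nonpositive.
  have hSc : IsCompact {r ∈ Icc 0 t | e r ∈ Iic 0} := by
    refine isCompact_Icc.of_isClosed_subset ?_ (fun r hr => hr.1)
    exact (he.mono Icc_subset_Ici_self).preimage_isClosed_of_isClosed isClosed_Icc isClosed_Iic
  obtain ⟨t0, ht0, hmax⟩ := hSc.exists_isGreatest ⟨0, ⟨le_rfl, ht⟩, h0⟩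
  have ht0t : t0 < t := by
    rcases ht0.1.2.lt_or_eq with h | h
    · exact h
    · exact absurd (h ▸ ht0.2 : e t ≤ 0) (not_le.2 hpos)
  have ht00 : 0 ≤ t0 := ht0.1.1
  have he0 : e t0 ≤ 0 := ht0.2
  have hgt : ∀ r, t0 < r → r ≤ t → 0 < e r := by
    intro r h1 h2
    by_contra! h3
    exact absurd (hmax ⟨⟨by linarith, h2⟩, h3⟩) (not_le.2 h1)
  have hlt : ∀ᶠ r in 𝓝[Ici 0] t0, e r < η := (he t0 ht00).eventually_lt_const (by linarith)
  obtain ⟨ε, hε, hball⟩ := Metric.mem_nhdsWithin_iff.1 hlt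
  -- The interval is short enough that e < η on it and that its length times K is below 1/2. At a
  -- maximum point q this yields e q ≤ (q − t0) K e q < e q.
  set τ := min t (min (t0 + ε / 2) (t0 + 1 / (2 * (K + 1)))) with hτ
  have hd : 0 < 1 / (2 * (K + 1)) := by positivity
  have hτ0 : t0 < τ := by
    refine lt_min ht0t (lt_min (by linarith) (by linarith))
  have hτt : τ ≤ t := min_le_left _ _
  have hτ1 : τ ≤ t0 + ε / 2 := (min_le_right _ _).trans (min_le_left _ _)
  have hτ2 : τ ≤ t0 + 1 / (2 * (K + 1)) := (min_le_right _ _).trans (min_le_right _ _)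
  obtain ⟨q, hq, hqmax⟩ := isCompact_Icc.exists_isMaxOn (nonempty_Icc.2 hτ0.le)
    (he.mono fun r hr => le_trans ht00 hr.1)
  have hM : 0 < e q := (hgt τ hτ0 hτt).trans_le (hqmax ⟨hτ0.le, le_rfl⟩)
  have hq0 : t0 ≤ q := hq.1
  have hdiff : e q - e t0 = ∫ s in t0..q, φ s := by
    rw [hint q (by linarith), hint t0 ht00, add_sub_add_left_eq_sub]
    exact intervalIntegral.integral_interval_sub_left (hφ q (by linarith)) (hφ t0 ht00)
  have hbound : ∫ s in t0..q, φ s ≤ ∫ _ in t0..q, K * e q := by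
    refine intervalIntegral.integral_mono_on_of_le_Ioo hq0
      ((hφ t0 ht00).symm.trans (hφ q (by linarith))) (by simp) fun s hs => ?_
    have hs1 : s ≤ τ := hs.2.le.trans hq.2
    have hsη : e s < η := hball ⟨by
      rw [Metric.mem_ball, Real.dist_eq, abs_lt]; constructor <;> linarith [hs.1], by
      simp only [mem_Ici]; linarith [hs.1]⟩
    refine (hle s (by linarith [hs.1]) (hgt s hs.1 (hs1.trans hτt)) hsη).trans ?_
    exact mul_le_mul_of_nonneg_left (hqmax ⟨hs.1.le, hs1⟩) hK
  rw [intervalIntegral.integral_const, smul_eq_mul] at hbound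
  have hqd : q - t0 ≤ 1 / (2 * (K + 1)) := by linarith [hq.2]
  have h1 : (q - t0) * (K * e q) ≤ 1 / (2 * (K + 1)) * (K * e q) :=
    mul_le_mul_of_nonneg_right hqd (by positivity)
  have h2 : 1 / (2 * (K + 1)) * (K * e q) < e q := by
    rw [div_mul_eq_mul_div, one_mul, div_lt_iff₀ (by positivity)]
    nlinarith
  linarith

/-- The reciprocal of a function in integral form. -/
lemma inv_eq_of_integral_form {x φ : ℝ → ℝ} {C m : ℝ} (hm : 0 < m)
    (hφ : ∀ T, 0 ≤ T → IntervalIntegrable φ volume 0 T)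
    (hC : ∀ s, 0 ≤ s → |φ s| ≤ C)
    (hint : ∀ t, 0 ≤ t → x t = x 0 + ∫ s in (0 : ℝ)..t, φ s)
    (hx : ∀ s, 0 ≤ s → m ≤ x s) {T : ℝ} (hT : 0 ≤ T) :
    (x T)⁻¹ = (x 0)⁻¹ + ∫ s in (0 : ℝ)..T, -φ s / x s ^ 2 := by
  have hC0 : 0 ≤ C := (abs_nonneg _).trans (hC 0 le_rfl)
  have hu : uIcc 0 T = Icc 0 T := uIcc_of_le hT
  have hlip : ∀ a ∈ Icc 0 T, ∀ b ∈ Icc 0 T, |x a - x b| ≤ C * |a - b| := by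
    intro a ha b hb
    rw [hint a ha.1, hint b hb.1, add_sub_add_left_eq_sub,
      intervalIntegral.integral_interval_sub_left (hφ a ha.1) (hφ b hb.1)]
    rw [← Real.norm_eq_abs]
    refine intervalIntegral.norm_integral_le_of_norm_le_const fun s hs => ?_
    refine hC s ?_
    rcases le_total a b with h | h
    · rw [uIoc_of_ge h] at hs; linarith [hs.1, ha.1]
    · rw [uIoc_of_le h] at hs; linarith [hs.1, hb.1]
  have hAC : AbsolutelyContinuousOnInterval (fun t => (x t)⁻¹) 0 T := by
    refine LipschitzOnWith.absolutelyContinuousOnInterval (K := Real.toNNReal (C / m ^ 2)) ?_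
    refine LipschitzOnWith.of_dist_le_mul fun a ha b hb => ?_
    rw [hu] at ha hb
    have ha' := hx a ha.1
    have hb' := hx b hb.1
    rw [Real.coe_toNNReal _ (by positivity), Real.dist_eq, Real.dist_eq,
      inv_sub_inv (by linarith) (by linarith), abs_div, abs_of_pos (by nlinarith : 0 < x a * x b),
      abs_sub_comm (x b), div_mul_eq_mul_div]
    refine div_le_div₀ (by positivity) (hlip a ha b hb) (by positivity) ?_
    nlinarith
  have hFTC := hAC.integral_deriv_eq_sub
  -- By Lebesgue differentiation `x` has derivative `φ` almost everywhere, so the integrand is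
  -- almost everywhere the derivative of the absolutely continuous function 1/x.
  have hae : ∫ s in (0 : ℝ)..T, -φ s / x s ^ 2 = ∫ s in (0 : ℝ)..T, deriv (fun t => (x t)⁻¹) s := by
    refine intervalIntegral.integral_congr_ae ?_
    have h0 : ∀ᵐ s : ℝ, s ≠ T := by simp [ae_iff, measure_singleton]
    filter_upwards [(hφ T hT).ae_hasDerivAt_integral, h0] with s hs hsT hsI
    rw [uIoc_of_le hT] at hsI
    have hd := hs (by rw [hu]; exact ⟨hsI.1.le, hsI.2⟩) 0 (by simp)
    have hx' : HasDerivAt x (φ s) s := by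
      refine (hd.const_add (x 0)).congr_of_eventuallyEq ?_
      filter_upwards [eventually_gt_nhds hsI.1] with r hr using hint r hr.le
    exact ((hx'.fun_inv (by linarith [hx s hsI.1.le])).deriv).symm
  rw [hae, hFTC]
  ring

/-- The discounted version of a function in integral form. -/
lemma exp_mul_eq_of_integral_form {Y ψ : ℝ → ℝ} (δ : ℝ)
    (hψ : ∀ T, 0 ≤ T → IntervalIntegrable ψ volume 0 T)
    (hint : ∀ t, 0 ≤ t → Y t = Y 0 + ∫ s in (0 : ℝ)..t, ψ s) {T : ℝ} (hT : 0 ≤ T) :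
    Real.exp (-(δ * T)) * Y T - Y 0 =
      ∫ s in (0 : ℝ)..T, Real.exp (-(δ * s)) * (ψ s - δ * Y s) := by
  have hu : uIcc 0 T = Icc 0 T := uIcc_of_le hT
  have h1 : AbsolutelyContinuousOnInterval (fun t => Real.exp (-(δ * t))) 0 T :=
    ContDiffOn.absolutelyContinuousOnInterval (by fun_prop)
  have h2 : AbsolutelyContinuousOnInterval (fun t => Y 0 + ∫ s in (0 : ℝ)..t, ψ s) 0 T :=
    AbsolutelyContinuousOnInterval.add
      (f := fun _ => Y 0) (ContDiffOn.absolutelyContinuousOnInterval contDiffOn_const)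
      ((hψ T hT).absolutelyContinuousOnInterval_intervalIntegral (by simp))
  have h3 := (h1.mul h2).integral_deriv_eq_sub
  have hae : ∫ s in (0 : ℝ)..T, Real.exp (-(δ * s)) * (ψ s - δ * Y s) = ∫ s in (0 : ℝ)..T,
      deriv ((fun t => Real.exp (-(δ * t))) * fun t => Y 0 + ∫ s in (0 : ℝ)..t, ψ s) s := by
    refine intervalIntegral.integral_congr_ae ?_
    filter_upwards [(hψ T hT).ae_hasDerivAt_integral] with s hs hsI
    rw [uIoc_of_le hT] at hsI
    have hd := hs (by rw [hu]; exact ⟨hsI.1.le, hsI.2⟩) 0 (by simp)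
    have he : HasDerivAt (fun t => Real.exp (-(δ * t))) (Real.exp (-(δ * s)) * -(δ * 1)) s :=
      (((hasDerivAt_id s).const_mul δ).neg).exp
    rw [(he.mul (hd.const_add (Y 0))).deriv, ← hint s hsI.1.le]
    ring
  rw [hae, h3, hint T hT]
  simp

/-- Carathéodory existence: an ODE whose right-hand side is bounded, measurable in time and
Lipschitz in the state has a global solution in integral form. -/
lemma exists_integral_solution {F : ℝ → ℝ → ℝ} {C K : ℝ} (hK : 0 < K)
    (hmeas : ∀ u : ℝ → ℝ, Continuous u → Measurable fun s => F s (u s))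
    (hC : ∀ s x, |F s x| ≤ C) (hlip : ∀ s x y, |F s x - F s y| ≤ K * |x - y|) (x₀ : ℝ) :
    ∃ x : ℝ → ℝ, Continuous x ∧ ∀ t, 0 ≤ t → x t = x₀ + ∫ s in (0 : ℝ)..t, F s (x s) := by
  have hC0 : 0 ≤ C := (abs_nonneg _).trans (hC 0 0)
  have hint : ∀ u : ℝ → ℝ, Continuous u → ∀ a b,
      IntervalIntegrable (fun s => F s (u s)) volume a b := fun u hu a b =>
    (intervalIntegrable_const (c := C)).mono_fun (hmeas u hu).aestronglyMeasurable
      (ae_of_all _ fun s => (hC s _).trans (le_abs_self C))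
  -- The Picard map acts on bounded functions weighted by exp(−Lt); the choice L = 2K makes its
  -- Lipschitz constant K/L = 1/2 on the whole half-line at once.
  set L : ℝ := 2 * K with hL
  have hL0 : 0 < L := by positivity
  let S : BoundedContinuousFunction ℝ ℝ → ℝ → ℝ := fun u s => Real.exp (L * s) * u s
  have hS : ∀ u, Continuous (S u) := fun u => by
    have := u.continuous
    fun_prop
  -- Replacing t by max t 0 freezes the Picard map at negative times, which lets it act on functions
  -- on all of ℝ.
  let I : BoundedContinuousFunction ℝ ℝ → ℝ → ℝ := fun u t =>
    x₀ + ∫ s in (0 : ℝ)..max t 0, F s (S u s)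
  have hI : ∀ u, Continuous (I u) := fun u =>
    continuous_const.add ((intervalIntegral.continuous_primitive (hint _ (hS u)) 0).comp
      (continuous_id.max continuous_const))
  let T : BoundedContinuousFunction ℝ ℝ → BoundedContinuousFunction ℝ ℝ := fun u =>
    BoundedContinuousFunction.ofNormedAddCommGroup
      (fun t => Real.exp (-(L * max t 0)) * I u t)
      (by have := hI u; fun_prop) (|x₀| + C / L) (by
        intro t
        set r := max t 0 with hr
        have hr0 : 0 ≤ r := le_max_right _ _
        have h1 : |∫ s in (0 : ℝ)..r, F s (S u s)| ≤ C * r := by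
          have := intervalIntegral.norm_integral_le_of_norm_le_const (a := 0) (b := r)
            (f := fun s => F s (S u s)) (C := C) fun s _ => hC s _
          rwa [sub_zero, abs_of_nonneg hr0, Real.norm_eq_abs] at this
        have h2 : |I u t| ≤ |x₀| + C * r := (abs_add_le _ _).trans (by linarith)
        have h3 : Real.exp (-(L * r)) ≤ 1 := Real.exp_le_one_iff.2 (by nlinarith)
        -- The linear growth of the integral is absorbed by the weight.
        have h4 : Real.exp (-(L * r)) * (L * r) ≤ 1 := by
          rw [Real.exp_neg, inv_mul_le_iff₀ (Real.exp_pos _)]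
          linarith [Real.add_one_le_exp (L * r)]
        rw [Real.norm_eq_abs, abs_mul, abs_of_pos (Real.exp_pos _)]
        calc Real.exp (-(L * r)) * |I u t| ≤ Real.exp (-(L * r)) * (|x₀| + C * r) := by gcongr
          _ = Real.exp (-(L * r)) * |x₀| + C / L * (Real.exp (-(L * r)) * (L * r)) := by
            field_simp
          _ ≤ 1 * |x₀| + C / L * 1 := by gcongr
          _ = _ := by ring)
  have hT : ContractingWith (1 / 2) T := by
    refine ⟨by norm_num [← NNReal.coe_lt_coe], LipschitzWith.of_dist_le_mul fun u w => ?_⟩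
    rw [BoundedContinuousFunction.dist_le (by positivity)]
    intro t
    set r := max t 0 with hr
    have hr0 : 0 ≤ r := le_max_right _ _
    have hTe : T u t - T w t
        = Real.exp (-(L * r)) * ∫ s in (0 : ℝ)..r, (F s (S u s) - F s (S w s)) := by
      rw [intervalIntegral.integral_sub (hint _ (hS u) _ _) (hint _ (hS w) _ _)]
      change Real.exp (-(L * r)) * (x₀ + _) - Real.exp (-(L * r)) * (x₀ + _) = _
      ring
    have hb : |∫ s in (0 : ℝ)..r, (F s (S u s) - F s (S w s))|
        ≤ ∫ s in (0 : ℝ)..r, K * dist u w * Real.exp (L * s) := by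
      rw [← Real.norm_eq_abs]
      refine intervalIntegral.norm_integral_le_of_norm_le hr0 (ae_of_all _ fun s _ => ?_)
        (Continuous.intervalIntegrable (by fun_prop) _ _)
      rw [Real.norm_eq_abs]
      refine (hlip s _ _).trans ?_
      change K * |Real.exp (L * s) * u s - Real.exp (L * s) * w s| ≤ _
      have := BoundedContinuousFunction.dist_coe_le_dist (f := u) (g := w) s
      rw [Real.dist_eq] at this
      rw [← mul_sub, abs_mul, abs_of_pos (Real.exp_pos _)]
      calc K * (Real.exp (L * s) * |u s - w s|) ≤ K * (Real.exp (L * s) * dist u w) := by gcongr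
        _ = _ := by ring
    have he : ∫ s in (0 : ℝ)..r, K * dist u w * Real.exp (L * s)
        = K * dist u w * ((Real.exp (L * r) - 1) / L) := by
      rw [intervalIntegral.integral_const_mul, intervalIntegral.integral_comp_mul_left _ hL0.ne',
        integral_exp, mul_zero, Real.exp_zero, smul_eq_mul, div_eq_inv_mul]
    rw [Real.dist_eq, hTe, abs_mul, abs_of_pos (Real.exp_pos _)]
    calc _ ≤ Real.exp (-(L * r)) * (K * dist u w * ((Real.exp (L * r) - 1) / L)) := by
          rw [← he]; gcongr
      _ = 1 / 2 * dist u w * (1 - Real.exp (-(L * r))) := by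
          rw [hL, Real.exp_neg]
          field_simp
      _ ≤ 1 / 2 * dist u w * 1 := by
          gcongr
          linarith [Real.exp_pos (-(L * r))]
      _ = _ := by simp
  obtain ⟨u, hu⟩ : ∃ u, T u = u := ⟨_, hT.fixedPoint_isFixedPt⟩
  refine ⟨S u, hS u, fun t ht => ?_⟩
  have h1 : u t = Real.exp (-(L * max t 0)) * I u t :=
    (congrArg (fun w : BoundedContinuousFunction ℝ ℝ => w t) hu).symm
  change Real.exp (L * t) * u t = _
  rw [h1, max_eq_left ht, ← mul_assoc, ← Real.exp_add, add_neg_cancel, Real.exp_zero, one_mul]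
  change x₀ + _ = _
  rw [max_eq_left ht]

/-! ### The information cost and the pointwise maximizer -/

noncomputable section

namespace IsInformationCost

variable {c : ℝ → ℝ} (hc : IsInformationCost c)
include hc

lemma differentiableOn : DifferentiableOn ℝ c (Ici 0) :=
  hc.contDiff.differentiableOn (by norm_num)

lemma continuousOn : ContinuousOn c (Ici 0) := hc.contDiff.continuousOn

lemma strictMonoOn_marginal : StrictMonoOn (derivWithin c (Ici 0)) (Ici 0) :=
  hc.strictConvex.strictMonoOn_derivWithin hc.differentiableOn

lemma continuousOn_marginal : ContinuousOn (derivWithin c (Ici 0)) (Ici 0) :=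
  hc.contDiff.continuousOn_derivWithin (uniqueDiffOn_Ici 0) (by norm_num)

lemma add_marginal_mul_lt {h k : ℝ} (hh : 0 ≤ h) (hk : 0 ≤ k) (hkh : k ≠ h) :
    c h + derivWithin c (Ici 0) h * (k - h) < c k := by
  have hd := (hc.differentiableOn h hh).hasDerivWithinAt
  rcases hkh.lt_or_gt with h1 | h1
  · have := hc.strictConvex.slope_lt_of_hasDerivWithinAt hk hh h1 hd
    rw [slope_def_field, div_lt_iff₀ (by linarith)] at this
    linarith
  · have := hc.strictConvex.lt_slope_of_hasDerivWithinAt hh hk h1 hd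
    rw [slope_def_field, lt_div_iff₀ (by linarith)] at this
    linarith

lemma add_marginal_mul_le {h k : ℝ} (hh : 0 ≤ h) (hk : 0 ≤ k) :
    c h + derivWithin c (Ici 0) h * (k - h) ≤ c k := by
  rcases eq_or_ne k h with rfl | hkh
  · simp
  · exact (hc.add_marginal_mul_lt hh hk hkh).le

/-- Every level of the marginal benefit is matched by a rate satisfying the first-order
conditions. -/
lemma exists_marginal_eq (y : ℝ) : ∃ h, 0 ≤ h ∧ y ≤ derivWithin c (Ici 0) h ∧
    (0 < h → derivWithin c (Ici 0) h = y) := by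
  rcases le_total y (derivWithin c (Ici 0) 0) with h0 | h0
  · exact ⟨0, le_rfl, h0, fun h => absurd h (lt_irrefl _)⟩
  · obtain ⟨b, hb, hb0⟩ :=
      ((hc.marginal_tendsto.eventually_ge_atTop y).and (eventually_ge_atTop 0)).exists
    obtain ⟨h, hh, hhy⟩ := intermediate_value_Icc hb0
      (hc.continuousOn_marginal.mono Icc_subset_Ici_self) ⟨h0, hb⟩
    exact ⟨h, hh.1, hhy.ge, fun _ => hhy⟩

lemma scale {α : ℝ} (hα : 0 < α) : IsInformationCost fun h => α * c h where
  nonneg h hh := mul_nonneg hα.le (hc.nonneg h hh)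
  strictMono _ ha _ hb hab := mul_lt_mul_of_pos_left (hc.strictMono ha hb hab) hα
  strictConvex := by
    refine ⟨hc.strictConvex.1, fun x hx y hy hxy a b ha hb hab => ?_⟩
    have := mul_lt_mul_of_pos_left (hc.strictConvex.2 hx hy hxy ha hb hab) hα
    simp only [smul_eq_mul] at this ⊢
    linarith
  contDiff := contDiffOn_const.mul hc.contDiff
  marginal_tendsto := by
    refine (hc.marginal_tendsto.const_mul_atTop hα).congr' ?_
    filter_upwards [eventually_ge_atTop 0] with h hh
    exact (derivWithin_const_mul _ (hc.differentiableOn h hh)).symm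

end IsInformationCost

namespace Params

variable {P : Params} {g : ℝ}

lemma Valid.a1_pos (hP : P.Valid) : 0 < P.a1 := by
  have h1 := hP.delta_pos
  have h2 := hP.rho_pos
  have h3 := hP.kappa_pos
  have : P.delta * P.rho < Real.sqrt (P.delta ^ 2 * P.rho ^ 2 + 4 * P.kappa * P.rho) := by
    apply Real.lt_sqrt_of_sq_lt
    have : 0 < 4 * P.kappa * P.rho := by positivity
    nlinarith
  unfold a1
  linarith

lemma Valid.a3_pos (hP : P.Valid) : 0 < P.a3 := by
  have h0 := hP.a1_pos
  have h1 := hP.delta_pos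
  have h2 := hP.rho_pos
  have h3 := hP.lam_nonneg
  unfold a3
  positivity

/-- The factor 2λ + δ cancels, leaving a₃ − a₃(2ρ − a₃)/(2ρ). In this form positivity and
monotonicity in κ can be read off. -/
lemma Valid.abar_eq (hP : P.Valid) : P.abar = P.a3 ^ 2 / (2 * P.rho) := by
  have h1 := hP.delta_pos
  have h2 := hP.rho_pos
  have h3 := hP.lam_nonneg
  have h4 : 2 * P.lam + P.delta ≠ 0 := by positivity
  unfold abar a2
  field_simp
  ring

lemma Valid.abar_pos (hP : P.Valid) : 0 < P.abar := by
  have h0 := hP.a3_pos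
  have h2 := hP.rho_pos
  rw [hP.abar_eq]
  positivity

lemma hmax_nonneg : 0 ≤ P.hmax g := Real.sSup_nonneg fun _ h => h.1

lemma Valid.le_hmax (hP : P.Valid) {h : ℝ} (hh : 0 ≤ h) (hM : P.dc h ≤ P.M0 g) :
    h ≤ P.hmax g := by
  refine le_csSup ?_ ⟨hh, hM⟩
  -- The supremum is meaningful only because the unbounded marginal cost makes the set bounded
  -- above.
  obtain ⟨b, hb, hb0⟩ := ((hP.cost.marginal_tendsto.eventually_gt_atTop (P.M0 g)).and
    (eventually_ge_atTop 0)).exists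
  refine ⟨b, fun k hk => ?_⟩
  by_contra! hbk
  exact absurd (hP.cost.strictMonoOn_marginal hb0 hk.1 hbk) (not_lt.2 (hk.2.trans hb.le))

/-- By strict convexity, the midpoint of two distinct maximizers would do strictly better. So the
set whose supremum is taken is a singleton. -/
lemma Valid.hhat_eq_of_isMaxOn (hP : P.Valid) {y h : ℝ} (hh : h ∈ Icc 0 (P.hmax g))
    (hmax : IsMaxOn (fun k => k * y - P.c k) (Icc 0 (P.hmax g)) h) : P.hhat g y = h := by
  have : {h | h ∈ Icc 0 (P.hmax g) ∧
      IsMaxOn (fun k => k * y - P.c k) (Icc 0 (P.hmax g)) h} = {h} := by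
    refine eq_singleton_iff_unique_mem.2 ⟨⟨hh, hmax⟩, fun k hk => ?_⟩
    by_contra hne
    have hmid := hP.cost.strictConvex.2 (mem_Ici.2 hk.1.1) (mem_Ici.2 hh.1) hne
      (show (0 : ℝ) < 1 / 2 by norm_num) (show (0 : ℝ) < 1 / 2 by norm_num) (by norm_num)
    have h1 := hmax hk.1
    have h2 : ((1 / 2 : ℝ) • k + (1 / 2 : ℝ) • h) * y - P.c ((1 / 2 : ℝ) • k + (1 / 2 : ℝ) • h)
        ≤ k * y - P.c k := hk.2 ((convex_Icc _ _) hk.1 hh (by norm_num) (by norm_num) (by norm_num))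
    have h3 : ((1 / 2 : ℝ) • k + (1 / 2 : ℝ) • h) * y - P.c ((1 / 2 : ℝ) • k + (1 / 2 : ℝ) • h)
        ≤ h * y - P.c h :=
      hmax ((convex_Icc _ _) hk.1 hh (by norm_num) (by norm_num) (by norm_num))
    simp only [smul_eq_mul] at hmid h2 h3
    linarith
  rw [hhat, this, csSup_singleton]

lemma Valid.hhat_spec (hP : P.Valid) (y : ℝ) : P.hhat g y ∈ Icc 0 (P.hmax g) ∧
    IsMaxOn (fun k => k * y - P.c k) (Icc 0 (P.hmax g)) (P.hhat g y) := by
  have hcont : ContinuousOn (fun k => k * y - P.c k) (Icc 0 (P.hmax g)) :=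
    ContinuousOn.sub (by fun_prop) (hP.cost.continuousOn.mono Icc_subset_Ici_self)
  obtain ⟨h, hh, hmax⟩ := isCompact_Icc.exists_isMaxOn (nonempty_Icc.2 P.hmax_nonneg) hcont
  rw [hP.hhat_eq_of_isMaxOn hh hmax]
  exact ⟨hh, hmax⟩

/-- Adding the optimality inequalities at y and z gives (ĥ(z) − ĥ(y))(z − y) ≥ 0. -/
lemma Valid.hhat_mono (hP : P.Valid) : Monotone (P.hhat g) := by
  intro y z hyz
  rcases hyz.eq_or_lt with rfl | hlt
  · rfl
  obtain ⟨h1, h2⟩ := hP.hhat_spec (g := g) y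
  obtain ⟨h3, h4⟩ := hP.hhat_spec (g := g) z
  have h5 := h2 h3
  have h6 := h4 h1
  simp only [mem_ofPred_eq] at h5 h6
  nlinarith

/-- For y ≤ M₀ the cap `hmax` does not bind, so the first-order conditions on all of [0, ∞) identify
the capped maximizer. -/
lemma Valid.hhat_eq (hP : P.Valid) {y h : ℝ} (hy : y ≤ P.M0 g) (hh : 0 ≤ h) (hle : y ≤ P.dc h)
    (heq : 0 < h → P.dc h = y) : P.hhat g y = h := by
  have hH : h ≤ P.hmax g := by
    rcases hh.eq_or_lt with rfl | hpos
    · exact P.hmax_nonneg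
    · exact hP.le_hmax hh ((heq hpos).le.trans hy)
  refine hP.hhat_eq_of_isMaxOn ⟨hh, hH⟩ fun k hk => ?_
  have hgrad := hP.cost.add_marginal_mul_le hh hk.1
  change P.c h + P.dc h * (k - h) ≤ P.c k at hgrad
  change k * y - P.c k ≤ h * y - P.c h
  rcases hh.eq_or_lt with rfl | hpos
  · nlinarith [hk.1]
  · rw [heq hpos] at hgrad
    linarith

end Params
end

/-! ### Trajectories: bounds, existence, concave dependence on the data -/

noncomputable section
namespace Params

variable {P : Params} {g γ₀ : ℝ} {h x : ℝ → ℝ}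

lemma IsControl.intervalIntegrable (hh : P.IsControl g h) (a b : ℝ) :
    IntervalIntegrable h volume a b :=
  (intervalIntegrable_const (c := P.hmax g)).mono_fun hh.1.aestronglyMeasurable
    (ae_of_all _ fun t => by
      have := hh.2 t
      change |h t| ≤ |P.hmax g|
      rw [abs_of_nonneg this.1]
      exact this.2.trans (le_abs_self _))

lemma IsTrajectory.apply_zero (hx : P.IsTrajectory h γ₀ x) : x 0 = γ₀ := by
  simpa using hx.2 0 le_rfl

lemma IsTrajectory.intervalIntegrable (hx : P.IsTrajectory h γ₀ x) (hh : P.IsControl g h)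
    {T : ℝ} (hT : 0 ≤ T) : IntervalIntegrable (fun s => P.f (x s) (h s)) volume 0 T := by
  have hxc : ContinuousOn x (uIcc 0 T) := by
    rw [uIcc_of_le hT]; exact hx.1.mono Icc_subset_Ici_self
  have h1 := (((intervalIntegrable_const (c := (1 / P.sigma1) ^ 2)).add
    (hh.intervalIntegrable 0 T)).neg).mul_continuousOn (hxc.pow 2)
  have h2 : IntervalIntegrable (fun s => -(2 * P.lam * x s) + P.sigma2 ^ 2) volume 0 T :=
    ContinuousOn.intervalIntegrable (by fun_prop)
  refine (h1.add h2).congr fun s _ => ?_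
  simp [f]
  ring

lemma IsTrajectory.integral_form (hx : P.IsTrajectory h γ₀ x) {t : ℝ} (ht : 0 ≤ t) :
    x t = x 0 + ∫ s in (0 : ℝ)..t, P.f (x s) (h s) := by
  rw [hx.apply_zero, ← hx.2 t ht]

/-- Trajectories started at a positive level stay above a positive level. -/
lemma IsTrajectory.exists_lower_bound (hx : P.IsTrajectory h γ₀ x) (hP : P.Valid)
    (hh : P.IsControl g h) (h0 : 0 < γ₀) : ∃ m, 0 < m ∧ ∀ t, 0 ≤ t → m ≤ x t := by
  have hH : 0 ≤ P.hmax g := P.hmax_nonneg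
  have hl := hP.lam_nonneg
  have hs := hP.sigma2_pos
  set S := (1 / P.sigma1) ^ 2 with hS
  have hS0 : 0 ≤ S := sq_nonneg _
  set q := P.sigma2 ^ 2 / (S + P.hmax g + 2 * P.lam + 1) with hq
  have hq0 : 0 < q := by positivity
  have hqe : (S + P.hmax g + 2 * P.lam + 1) * q = P.sigma2 ^ 2 := by rw [hq]; field_simp
  set m := min γ₀ (min 1 q) with hm
  have hm0 : 0 < m := lt_min h0 (lt_min one_pos hq0)
  have hm1 : m ≤ 1 := (min_le_right _ _).trans (min_le_left _ _)
  have hmq : m ≤ q := (min_le_right _ _).trans (min_le_right _ _)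
  refine ⟨m, hm0, fun t ht => ?_⟩
  have := nonpos_of_integral_form (e := fun t => m - x t) (φ := fun s => -P.f (x s) (h s))
    (K := 0) hm0 le_rfl (continuousOn_const.sub hx.1)
    (by simp only [hx.apply_zero]; linarith [min_le_left γ₀ (min 1 q)])
    (fun T hT => (hx.intervalIntegrable hh hT).neg)
    (fun t ht => by
      rw [intervalIntegral.integral_neg, hx.integral_form ht]; ring)
    (fun s _ h1 h2 => by
      have h3 : 0 < x s := by linarith
      have h4 : x s < m := by linarith
      have h5 := (hh.2 s).1
      have h6 := (hh.2 s).2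
      have h7 : (S + h s) * x s ^ 2 ≤ (S + P.hmax g) * q := by
        have : x s ^ 2 ≤ q := by nlinarith
        exact mul_le_mul (by linarith) this (by positivity) (by positivity)
      have h8 : 2 * P.lam * x s ≤ 2 * P.lam * q := by gcongr; linarith
      rw [zero_mul, f, ← hS]
      nlinarith) ht
  linarith

/-- The level σ₁σ₂ is the zero of the drift for λ = 0 and k = 0; mean reversion and information only
lower the drift. -/
lemma f_nonpos_of_le (hP : P.Valid) {γ k : ℝ} (hγ : P.sigma1 * P.sigma2 ≤ γ) (hk : 0 ≤ k) :
    P.f γ k ≤ 0 := by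
  have h1 := hP.sigma1_pos
  have h2 := hP.sigma2_pos
  have h3 := hP.lam_nonneg
  have h4 : 0 < P.sigma1 * P.sigma2 := by positivity
  have h5 : (1 / P.sigma1) ^ 2 * (P.sigma1 * P.sigma2) ^ 2 = P.sigma2 ^ 2 := by field_simp
  have h6 : (1 / P.sigma1) ^ 2 * (P.sigma1 * P.sigma2) ^ 2 ≤ (1 / P.sigma1) ^ 2 * γ ^ 2 := by
    gcongr
  have h7 : 0 ≤ k * γ ^ 2 := by positivity
  have h8 : 0 ≤ P.lam * γ := mul_nonneg h3 (by linarith)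
  unfold f
  linarith

lemma IsTrajectory.le_upper_bound (hx : P.IsTrajectory h γ₀ x) (hP : P.Valid)
    (hh : P.IsControl g h) (h0 : 0 < γ₀) {t : ℝ} (ht : 0 ≤ t) :
    x t ≤ γ₀ + P.sigma1 * P.sigma2 := by
  have h1 := hP.sigma1_pos
  have h2 := hP.sigma2_pos
  have h4 : 0 < P.sigma1 * P.sigma2 := by positivity
  have := nonpos_of_integral_form (e := fun t => x t - (γ₀ + P.sigma1 * P.sigma2))
    (φ := fun s => P.f (x s) (h s))
    (K := 0) one_pos le_rfl (hx.1.sub continuousOn_const)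
    (by simp only [hx.apply_zero]; linarith)
    (fun T hT => hx.intervalIntegrable hh hT)
    (fun t ht => by rw [hx.integral_form ht]; ring)
    (fun s _ h5 _ => by
      rw [zero_mul]
      exact f_nonpos_of_le hP (by linarith) (hh.2 s).1) ht
  linarith

lemma exists_isTrajectory (hP : P.Valid) (hh : P.IsControl g h) (h0 : 0 < γ₀) :
    ∃ x, P.IsTrajectory h γ₀ x := by
  have h1 := hP.sigma1_pos
  have h2 := hP.sigma2_pos
  have hl := hP.lam_nonneg
  have hH : 0 ≤ P.hmax g := P.hmax_nonneg
  set b := γ₀ + P.sigma1 * P.sigma2 with hb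
  have hσ : 0 < P.sigma1 * P.sigma2 := by positivity
  have hb0 : 0 < b := by positivity
  set S := (1 / P.sigma1) ^ 2 with hS
  have hS0 : 0 < S := by positivity
  -- Clipping the state to [0, b] makes the quadratic drift bounded and globally Lipschitz. The
  -- solution of the clipped equation stays in [0, b], so it solves the original one.
  let p : ℝ → ℝ := fun x => max 0 (min x b)
  have hp0 : ∀ x, 0 ≤ p x := fun x => le_max_left _ _
  have hpb : ∀ x, p x ≤ b := fun x => max_le hb0.le (min_le_right _ _)
  have hpl : ∀ x y, |p x - p y| ≤ |x - y| := fun x y =>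
    (abs_max_sub_max_le_max _ _ _ _).trans (by
      rw [sub_self, abs_zero]
      refine max_le (abs_nonneg _) ((abs_min_sub_min_le_max _ _ _ _).trans ?_)
      simp)
  have hfb : ∀ s x, |P.f (p x) (h s)| ≤ (S + P.hmax g) * b ^ 2 + 2 * P.lam * b + P.sigma2 ^ 2 := by
    intro s x
    obtain ⟨h3, h4⟩ := hh.2 s
    have h5 : p x ^ 2 ≤ b ^ 2 := pow_le_pow_left₀ (hp0 x) (hpb x) 2
    have h6 : (S + h s) * p x ^ 2 ≤ (S + P.hmax g) * b ^ 2 := by gcongr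
    have h7 : 0 ≤ (S + h s) * p x ^ 2 := by positivity
    have h8 : 2 * P.lam * p x ≤ 2 * P.lam * b := by gcongr; exact hpb x
    have h9 : 0 ≤ 2 * P.lam * p x := mul_nonneg (by positivity) (hp0 x)
    have h10 := sq_nonneg P.sigma2
    rw [f, ← hS, abs_le]
    constructor <;> linarith
  have hfl : ∀ s x y, |P.f (p x) (h s) - P.f (p y) (h s)|
      ≤ ((S + P.hmax g) * (2 * b) + 2 * P.lam) * |x - y| := by
    intro s x y
    obtain ⟨h3, h4⟩ := hh.2 s
    have h5 : P.f (p x) (h s) - P.f (p y) (h s)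
        = -((S + h s) * (p x + p y) + 2 * P.lam) * (p x - p y) := by rw [f, f, ← hS]; ring
    have h6 : 0 ≤ p x + p y := add_nonneg (hp0 x) (hp0 y)
    have h7 : 0 ≤ (S + h s) * (p x + p y) + 2 * P.lam := by positivity
    rw [h5, abs_mul, abs_neg, abs_of_nonneg h7]
    have h8 : p x + p y ≤ 2 * b := by linarith [hpb x, hpb y]
    exact mul_le_mul (by gcongr) (hpl x y) (abs_nonneg _) (by positivity)
  obtain ⟨x, hxc, hx⟩ := exists_integral_solution (F := fun s x => P.f (p x) (h s)) (x₀ := γ₀)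
    (by positivity) (fun u hu => by
      have := hh.1
      have := hu.measurable
      simp only [f, p]
      fun_prop) hfb hfl
  have hx0 : x 0 = γ₀ := by simpa using hx 0 le_rfl
  have hii : ∀ T, IntervalIntegrable (fun s => P.f (p (x s)) (h s)) volume 0 T := fun T => by
    have hpc : Continuous fun s => p (x s) := by fun_prop
    have h1 := (((intervalIntegrable_const (c := (1 / P.sigma1) ^ 2)).add
      (hh.intervalIntegrable 0 T)).neg).mul_continuousOn (hpc.pow 2).continuousOn
    have h2 : IntervalIntegrable (fun s => -(2 * P.lam * p (x s)) + P.sigma2 ^ 2) volume 0 T :=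
      Continuous.intervalIntegrable (by fun_prop) _ _
    refine (h1.add h2).congr fun s _ => ?_
    simp [f]
    ring
  have hlow : ∀ t, 0 ≤ t → 0 ≤ x t := fun t ht => by
    have := nonpos_of_integral_form (e := fun t => -x t) (φ := fun s => -P.f (p (x s)) (h s))
      (K := 0) one_pos le_rfl hxc.neg.continuousOn (by simp [hx0, h0.le])
      (fun T _ => (hii T).neg)
      (fun t ht => by rw [intervalIntegral.integral_neg, hx t ht, hx0]; ring)
      (fun s _ h3 _ => by
        have : p (x s) = 0 := max_eq_left ((min_le_left _ _).trans (by linarith))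
        rw [zero_mul, this, f]
        nlinarith) ht
    linarith
  have hup : ∀ t, 0 ≤ t → x t ≤ b := fun t ht => by
    have := nonpos_of_integral_form (e := fun t => x t - b) (φ := fun s => P.f (p (x s)) (h s))
      (K := 0) one_pos le_rfl (hxc.sub continuous_const).continuousOn
      (by simp only [hx0]; linarith)
      (fun T _ => hii T) (fun t ht => by rw [hx t ht, hx0]; ring)
      (fun s _ h3 _ => by
        have : p (x s) = b := by
          simp only [p]
          rw [min_eq_right (by linarith), max_eq_right hb0.le]
        rw [zero_mul, this]
        exact f_nonpos_of_le hP (by linarith) (hh.2 s).1) ht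
    linarith
  refine ⟨x, hxc.continuousOn, fun t ht => ?_⟩
  rw [hx t ht]
  congr 1
  refine intervalIntegral.integral_congr fun s hs => ?_
  rw [uIcc_of_le ht] at hs
  have : p (x s) = x s := by
    simp only [p]
    rw [min_eq_left (hup s hs.1), max_eq_right (hlow s hs.1)]
  simp only [this]

/-- For a given control, the state depends on the initial state in a concave way. -/
lemma IsTrajectory.concave (hP : P.Valid) (hh : P.IsControl g h) {γ₁ γ₂ a b : ℝ}
    {x₁ x₂ : ℝ → ℝ} (h1 : 0 < γ₁) (h2 : 0 < γ₂) (ha : 0 ≤ a) (hb : 0 ≤ b) (hab : a + b = 1)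
    (hx₁ : P.IsTrajectory h γ₁ x₁) (hx₂ : P.IsTrajectory h γ₂ x₂)
    (hx : P.IsTrajectory h (a * γ₁ + b * γ₂) x) {t : ℝ} (ht : 0 ≤ t) :
    a * x₁ t + b * x₂ t ≤ x t := by
  have h0 : 0 < a * γ₁ + b * γ₂ := by
    rcases ha.eq_or_lt with rfl | ha'
    · obtain rfl : b = 1 := by linarith
      linarith
    · have := mul_pos ha' h1
      nlinarith
  obtain ⟨m, hm, hmx⟩ := hx.exists_lower_bound hP hh h0
  have hl := hP.lam_nonneg
  -- Convexity of γ² bounds the drift of the difference by −2λ times the difference wherever the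
  -- latter is positive, so the comparison constant is 0.
  have := nonpos_of_integral_form (e := fun t => a * x₁ t + b * x₂ t - x t)
    (φ := fun s => a * P.f (x₁ s) (h s) + b * P.f (x₂ s) (h s) - P.f (x s) (h s))
    (K := 0) one_pos le_rfl
    (((continuousOn_const.mul hx₁.1).add (continuousOn_const.mul hx₂.1)).sub hx.1)
    (by simp [hx₁.apply_zero, hx₂.apply_zero, hx.apply_zero])
    (fun T hT => (((hx₁.intervalIntegrable hh hT).const_mul a).add
      ((hx₂.intervalIntegrable hh hT).const_mul b)).sub (hx.intervalIntegrable hh hT))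
    (fun t ht => by
      have i1 := (hx₁.intervalIntegrable hh ht).const_mul a
      have i2 := (hx₂.intervalIntegrable hh ht).const_mul b
      rw [intervalIntegral.integral_sub (i1.add i2) (hx.intervalIntegrable hh ht),
        intervalIntegral.integral_add i1 i2, intervalIntegral.integral_const_mul,
        intervalIntegral.integral_const_mul, hx₁.integral_form ht, hx₂.integral_form ht,
        hx.integral_form ht]
      ring)
    (fun s hs h3 _ => by
      have h4 := (hh.2 s).1
      have h5 := hmx s hs
      have h6 : 0 ≤ (1 / P.sigma1) ^ 2 + h s := by positivity
      obtain rfl : b = 1 - a := by linarith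
      have h7 : x s ^ 2 ≤ a * x₁ s ^ 2 + (1 - a) * x₂ s ^ 2 := by
        have h8 : (a * x₁ s + (1 - a) * x₂ s) ^ 2 ≤ a * x₁ s ^ 2 + (1 - a) * x₂ s ^ 2 := by
          nlinarith [mul_nonneg (mul_nonneg ha hb) (sq_nonneg (x₁ s - x₂ s))]
        nlinarith
      have h8 := mul_le_mul_of_nonneg_left h7 h6
      have h9 := mul_nonneg hl h3.le
      unfold f
      linarith) ht
  linarith

/-- The integral form of the equation for the reciprocal of the state. -/
lemma IsTrajectory.inv_integral_form (hx : P.IsTrajectory h γ₀ x) (hP : P.Valid)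
    (hh : P.IsControl g h) (h0 : 0 < γ₀) :
    ContinuousOn (fun t => (x t)⁻¹) (Ici 0) ∧
    (∀ T, 0 ≤ T → IntervalIntegrable (fun s => (1 / P.sigma1) ^ 2 + h s + 2 * P.lam * (x s)⁻¹
      - P.sigma2 ^ 2 * (x s)⁻¹ ^ 2) volume 0 T) ∧
    ∀ T, 0 ≤ T → (x T)⁻¹ = (x 0)⁻¹ + ∫ s in (0 : ℝ)..T, ((1 / P.sigma1) ^ 2 + h s
      + 2 * P.lam * (x s)⁻¹ - P.sigma2 ^ 2 * (x s)⁻¹ ^ 2) := by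
  obtain ⟨m, hm, hmx⟩ := hx.exists_lower_bound hP hh h0
  have hc : ContinuousOn (fun t => (x t)⁻¹) (Ici 0) :=
    hx.1.inv₀ fun t ht => (hm.trans_le (hmx t ht)).ne'
  refine ⟨hc, fun T hT => ?_, fun T hT => ?_⟩
  · have hc' : ContinuousOn (fun t => (x t)⁻¹) (uIcc 0 T) := by
      rw [uIcc_of_le hT]; exact hc.mono Icc_subset_Ici_self
    have h2 : IntervalIntegrable (fun s => (1 / P.sigma1) ^ 2 + 2 * P.lam * (x s)⁻¹
      - P.sigma2 ^ 2 * (x s)⁻¹ ^ 2) volume 0 T := ContinuousOn.intervalIntegrable (by fun_prop)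
    refine ((hh.intervalIntegrable 0 T).add h2).congr fun s _ => ?_
    ring
  · set S := (1 / P.sigma1) ^ 2 with hS
    have hS0 : 0 ≤ S := sq_nonneg _
    have hl := hP.lam_nonneg
    have hH : 0 ≤ P.hmax g := P.hmax_nonneg
    set β := γ₀ + P.sigma1 * P.sigma2 with hβ
    rw [inv_eq_of_integral_form (C := (S + P.hmax g) * β ^ 2 + 2 * P.lam * β + P.sigma2 ^ 2) hm
      (fun T hT => hx.intervalIntegrable hh hT) (fun s hs => ?_) (fun t ht => hx.integral_form ht)
      hmx hT]
    · congr 1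
      refine intervalIntegral.integral_congr fun s hs => ?_
      rw [uIcc_of_le hT] at hs
      have h3 := hm.trans_le (hmx s hs.1)
      simp only [f]
      rw [← hS]
      field_simp
      ring
    · have h3 := hm.trans_le (hmx s hs)
      have h4 := hx.le_upper_bound hP hh h0 hs
      obtain ⟨h5, h6⟩ := hh.2 s
      have h7 : x s ^ 2 ≤ β ^ 2 := pow_le_pow_left₀ h3.le h4 2
      have h8 : (S + h s) * x s ^ 2 ≤ (S + P.hmax g) * β ^ 2 := by gcongr
      have h9 : 0 ≤ (S + h s) * x s ^ 2 := by positivity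
      have h10 : 2 * P.lam * x s ≤ 2 * P.lam * β := by gcongr
      have h11 : 0 ≤ 2 * P.lam * x s := by positivity
      have h12 := sq_nonneg P.sigma2
      rw [f, ← hS, abs_le]
      constructor <;> linarith

lemma IsControl.convex {h₁ h₂ : ℝ → ℝ} {a b : ℝ} (hh₁ : P.IsControl g h₁)
    (hh₂ : P.IsControl g h₂) (ha : 0 ≤ a) (hb : 0 ≤ b) (hab : a + b = 1) :
    P.IsControl g fun t => a * h₁ t + b * h₂ t := by
  have h1 := hh₁.1
  have h2 := hh₂.1
  exact ⟨by fun_prop, fun t => by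
    simpa using (convex_Icc _ _) (hh₁.2 t) (hh₂.2 t) ha hb hab⟩

/-- The reciprocal of the state depends on its initial value and the control in a concave way. -/
lemma IsTrajectory.inv_concave (hP : P.Valid) {h₁ h₂ : ℝ → ℝ} (hh₁ : P.IsControl g h₁)
    (hh₂ : P.IsControl g h₂) {y₁ y₂ a b : ℝ} {x₁ x₂ : ℝ → ℝ} (h1 : 0 < y₁) (h2 : 0 < y₂)
    (ha : 0 ≤ a) (hb : 0 ≤ b) (hab : a + b = 1)
    (hx₁ : P.IsTrajectory h₁ y₁⁻¹ x₁) (hx₂ : P.IsTrajectory h₂ y₂⁻¹ x₂)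
    (hx : P.IsTrajectory (fun t => a * h₁ t + b * h₂ t) (a * y₁ + b * y₂)⁻¹ x)
    {t : ℝ} (ht : 0 ≤ t) : a * (x₁ t)⁻¹ + b * (x₂ t)⁻¹ ≤ (x t)⁻¹ := by
  have h0 : 0 < a * y₁ + b * y₂ := by
    rcases ha.eq_or_lt with rfl | ha'
    · obtain rfl : b = 1 := by linarith
      linarith
    · have := mul_pos ha' h1
      nlinarith
  have hh := hh₁.convex hh₂ ha hb hab
  have hl := hP.lam_nonneg
  obtain ⟨m, hm, hmx⟩ := hx.exists_lower_bound hP hh (inv_pos.2 h0)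
  obtain ⟨c1, i1, f1⟩ := hx₁.inv_integral_form hP hh₁ (inv_pos.2 h1)
  obtain ⟨c2, i2, f2⟩ := hx₂.inv_integral_form hP hh₂ (inv_pos.2 h2)
  obtain ⟨c3, i3, f3⟩ := hx.inv_integral_form hP hh (inv_pos.2 h0)
  -- In the precision the linear term has the opposite sign, hence the comparison constant 2λ. The
  -- control enters linearly and cancels.
  have := nonpos_of_integral_form (e := fun t => a * (x₁ t)⁻¹ + b * (x₂ t)⁻¹ - (x t)⁻¹)
    (K := 2 * P.lam) one_pos (by positivity)
    (((continuousOn_const.mul c1).add (continuousOn_const.mul c2)).sub c3)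
    (by simp [hx₁.apply_zero, hx₂.apply_zero, hx.apply_zero])
    (fun T hT => (((i1 T hT).const_mul a).add ((i2 T hT).const_mul b)).sub (i3 T hT))
    (fun t ht => by
      have j1 := (i1 t ht).const_mul a
      have j2 := (i2 t ht).const_mul b
      rw [intervalIntegral.integral_sub (j1.add j2) (i3 t ht),
        intervalIntegral.integral_add j1 j2, intervalIntegral.integral_const_mul,
        intervalIntegral.integral_const_mul, f1 t ht, f2 t ht, f3 t ht]
      ring)
    (fun s hs h3 _ => by
      have h5 : 0 < (x s)⁻¹ := inv_pos.2 (hm.trans_le (hmx s hs))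
      obtain rfl : b = 1 - a := by linarith
      have h7 : (x s)⁻¹ ^ 2 ≤ a * (x₁ s)⁻¹ ^ 2 + (1 - a) * (x₂ s)⁻¹ ^ 2 := by
        have h8 : (a * (x₁ s)⁻¹ + (1 - a) * (x₂ s)⁻¹) ^ 2
            ≤ a * (x₁ s)⁻¹ ^ 2 + (1 - a) * (x₂ s)⁻¹ ^ 2 := by
          nlinarith [mul_nonneg (mul_nonneg ha hb) (sq_nonneg ((x₁ s)⁻¹ - (x₂ s)⁻¹))]
        nlinarith
      have h8 := mul_le_mul_of_nonneg_left h7 (sq_nonneg P.sigma2)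
      linarith) ht
  linarith

end Params
end

/-! ### The value function: concavity, convexity in the precision, differentiability -/

noncomputable section
namespace Params

variable {P : Params} {g γ₀ : ℝ} {h x : ℝ → ℝ}

lemma integrableOn_exp_neg (hP : P.Valid) :
    IntegrableOn (fun t => Real.exp (-(P.delta * t))) (Ioi 0) := by
  simpa using exp_neg_integrableOn_Ioi 0 hP.delta_pos

lemma integral_exp_neg (hP : P.Valid) :
    ∫ t in Ioi (0 : ℝ), Real.exp (-(P.delta * t)) = 1 / P.delta := by
  have := integral_exp_mul_Ioi (a := -P.delta) (by linarith [hP.delta_pos]) 0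
  simpa using this

lemma integrableOn_cost (hP : P.Valid) (hh : P.IsControl g h) (h0 : 0 < γ₀)
    (hx : P.IsTrajectory h γ₀ x) :
    IntegrableOn (fun t => Real.exp (-(P.delta * t)) * (P.abar * x t + P.c (h t))) (Ioi 0) := by
  obtain ⟨m, hm, hmx⟩ := hx.exists_lower_bound hP hh h0
  have hA := hP.abar_pos
  have hcm : Measurable fun t => P.c (h t) := by
    -- Nothing is assumed about c on negative arguments, so measurability is obtained from a
    -- continuous extension.
    have h1 : Continuous fun k => P.c (max k 0) :=
      hP.cost.continuousOn.comp_continuous (by fun_prop) fun k =>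
        mem_Ici.2 (le_max_right _ _)
    have h2 : (fun t => P.c (h t)) = (fun k => P.c (max k 0)) ∘ h := by
      funext t
      simp [max_eq_left (hh.2 t).1]
    rw [h2]
    exact h1.measurable.comp hh.1
  have hxm : AEStronglyMeasurable x (volume.restrict (Ioi 0)) :=
    (hx.1.mono Ioi_subset_Ici_self).aestronglyMeasurable measurableSet_Ioi
  have hmeas : AEStronglyMeasurable (fun t => P.abar * x t + P.c (h t))
      (volume.restrict (Ioi 0)) := (hxm.const_mul _).add hcm.aestronglyMeasurable
  have := (integrableOn_exp_neg hP).integrable.bdd_mul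
    (c := P.abar * (γ₀ + P.sigma1 * P.sigma2) + P.c (P.hmax g)) hmeas ?_
  · exact this.congr (ae_of_all _ fun t => mul_comm _ _)
  · filter_upwards [ae_restrict_mem measurableSet_Ioi] with t ht
    have ht' : 0 ≤ t := le_of_lt ht
    have h1 := hx.le_upper_bound hP hh h0 ht'
    have h2 := hm.trans_le (hmx t ht')
    obtain ⟨h3, h4⟩ := hh.2 t
    have h5 := hP.cost.nonneg _ h3
    have h6 := hP.cost.strictMono.monotoneOn h3 (h3.trans h4) h4
    rw [Real.norm_eq_abs, abs_of_nonneg (by positivity)]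
    gcongr

lemma J_nonneg (hP : P.Valid) (hh : P.IsControl g h) (h0 : 0 < γ₀)
    (hx : P.IsTrajectory h γ₀ x) : 0 ≤ P.J h x := by
  obtain ⟨m, hm, hmx⟩ := hx.exists_lower_bound hP hh h0
  have hA := hP.abar_pos
  refine setIntegral_nonneg measurableSet_Ioi fun t ht => ?_
  have h2 := hm.trans_le (hmx t (le_of_lt ht))
  have h5 := hP.cost.nonneg _ (hh.2 t).1
  positivity

lemma v_le (hP : P.Valid) (hh : P.IsControl g h) (h0 : 0 < γ₀) (hx : P.IsTrajectory h γ₀ x) :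
    P.v g γ₀ ≤ P.J h x := by
  refine csInf_le ⟨0, ?_⟩ ⟨h, x, hh, hx, rfl⟩
  rintro _ ⟨h, x, hh, hx, rfl⟩
  exact J_nonneg hP hh h0 hx

lemma nonempty_costs (hP : P.Valid) (h0 : 0 < γ₀) :
    {r | ∃ h x : ℝ → ℝ, P.IsControl g h ∧ P.IsTrajectory h γ₀ x ∧ r = P.J h x}.Nonempty := by
  have hh : P.IsControl g fun _ => 0 := ⟨measurable_const, fun _ => ⟨le_rfl, P.hmax_nonneg⟩⟩
  obtain ⟨x, hx⟩ := exists_isTrajectory hP hh h0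
  exact ⟨_, _, x, hh, hx, rfl⟩

lemma le_v (hP : P.Valid) (h0 : 0 < γ₀) {r : ℝ}
    (H : ∀ h x, P.IsControl g h → P.IsTrajectory h γ₀ x → r ≤ P.J h x) : r ≤ P.v g γ₀ := by
  refine le_csInf (nonempty_costs hP h0) ?_
  rintro _ ⟨h, x, hh, hx, rfl⟩
  exact H h x hh hx

lemma exists_J_lt (hP : P.Valid) (h0 : 0 < γ₀) {ε : ℝ} (hε : 0 < ε) :
    ∃ h x, P.IsControl g h ∧ P.IsTrajectory h γ₀ x ∧ P.J h x < P.v g γ₀ + ε := by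
  obtain ⟨_, ⟨h, x, hh, hx, rfl⟩, hlt⟩ := Real.lt_sInf_add_pos (nonempty_costs (g := g) hP h0) hε
  exact ⟨h, x, hh, hx, hlt⟩

/-- For each control the cost is concave in the initial state, because the state is and ā > 0. An
infimum of such functions is concave. -/
lemma concaveOn_v (hP : P.Valid) : ConcaveOn ℝ (Ioi 0) (P.v g) := by
  refine ⟨convex_Ioi _, fun γ₁ h1 γ₂ h2 a b ha hb hab => ?_⟩
  have h3 : 0 < a • γ₁ + b • γ₂ := convex_Ioi _ h1 h2 ha hb hab
  have h1' : 0 < γ₁ := h1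
  have h2' : 0 < γ₂ := h2
  refine le_v hP h3 fun h x hh hx => ?_
  obtain ⟨x₁, hx₁⟩ := exists_isTrajectory hP hh h1'
  obtain ⟨x₂, hx₂⟩ := exists_isTrajectory hP hh h2'
  have i1 := (integrableOn_cost hP hh h1' hx₁).const_mul a
  have i2 := (integrableOn_cost hP hh h2' hx₂).const_mul b
  simp only [smul_eq_mul] at h3 hx ⊢
  calc a * P.v g γ₁ + b * P.v g γ₂ ≤ a * P.J h x₁ + b * P.J h x₂ := by
        gcongr
        · exact v_le hP hh h1' hx₁
        · exact v_le hP hh h2' hx₂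
    _ = ∫ t in Ioi (0 : ℝ), (a * (Real.exp (-(P.delta * t)) * (P.abar * x₁ t + P.c (h t))) +
          b * (Real.exp (-(P.delta * t)) * (P.abar * x₂ t + P.c (h t)))) := by
        rw [integral_add i1 i2, integral_const_mul, integral_const_mul, J, J]
    _ ≤ P.J h x := by
        refine setIntegral_mono_on (i1.add i2) (integrableOn_cost hP hh h3 hx) measurableSet_Ioi
          fun t ht => ?_
        have h4 := IsTrajectory.concave hP hh h1' h2' ha hb hab hx₁ hx₂ hx (le_of_lt ht)
        have h5 := mul_le_mul_of_nonneg_left h4 hP.abar_pos.le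
        obtain rfl : b = 1 - a := by linarith
        have h6 : P.abar * (a * x₁ t + (1 - a) * x₂ t) + P.c (h t) ≤ P.abar * x t + P.c (h t) := by
          linarith
        refine le_trans (le_of_eq ?_) (mul_le_mul_of_nonneg_left h6 (Real.exp_pos _).le)
        ring

/-- The value function is convex in the precision, the reciprocal of the conditional variance. -/
lemma convexOn_v_inv (hP : P.Valid) : ConvexOn ℝ (Ioi 0) fun y => P.v g y⁻¹ := by
  refine ⟨convex_Ioi _, fun y₁ h1 y₂ h2 a b ha hb hab => ?_⟩
  have h3 : 0 < a • y₁ + b • y₂ := convex_Ioi _ h1 h2 ha hb hab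
  have h1' : 0 < y₁ := h1
  have h2' : 0 < y₂ := h2
  simp only [smul_eq_mul] at h3 ⊢
  -- Nearly optimal controls suffice; no optimal control needs to exist.
  refine le_of_forall_pos_le_add fun ε hε => ?_
  obtain ⟨h₁, x₁, hh₁, hx₁, hJ₁⟩ := exists_J_lt (g := g) hP (inv_pos.2 h1') hε
  obtain ⟨h₂, x₂, hh₂, hx₂, hJ₂⟩ := exists_J_lt (g := g) hP (inv_pos.2 h2') hε
  have hh := hh₁.convex hh₂ ha hb hab
  obtain ⟨x, hx⟩ := exists_isTrajectory hP hh (inv_pos.2 h3)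
  have i1 := (integrableOn_cost hP hh₁ (inv_pos.2 h1') hx₁).const_mul a
  have i2 := (integrableOn_cost hP hh₂ (inv_pos.2 h2') hx₂).const_mul b
  obtain ⟨m₁, hm₁, hmx₁⟩ := hx₁.exists_lower_bound hP hh₁ (inv_pos.2 h1')
  obtain ⟨m₂, hm₂, hmx₂⟩ := hx₂.exists_lower_bound hP hh₂ (inv_pos.2 h2')
  obtain ⟨m, hm, hmx⟩ := hx.exists_lower_bound hP hh (inv_pos.2 h3)
  have hJ : P.J (fun t => a * h₁ t + b * h₂ t) x ≤ a * P.J h₁ x₁ + b * P.J h₂ x₂ := by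
    calc P.J (fun t => a * h₁ t + b * h₂ t) x ≤ ∫ t in Ioi (0 : ℝ),
          (a * (Real.exp (-(P.delta * t)) * (P.abar * x₁ t + P.c (h₁ t))) +
            b * (Real.exp (-(P.delta * t)) * (P.abar * x₂ t + P.c (h₂ t)))) := by
          refine setIntegral_mono_on (integrableOn_cost hP hh (inv_pos.2 h3) hx) (i1.add i2)
            measurableSet_Ioi fun t ht => ?_
          have ht' : 0 ≤ t := le_of_lt ht
          have h4 := IsTrajectory.inv_concave hP hh₁ hh₂ h1' h2' ha hb hab hx₁ hx₂ hx ht'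
          have p1 := hm₁.trans_le (hmx₁ t ht')
          have p2 := hm₂.trans_le (hmx₂ t ht')
          have p := hm.trans_le (hmx t ht')
          -- Concavity of the precision and convexity of the reciprocal combine to convexity of the
          -- state in the pair of initial precision and control.
          have h5 : x t ≤ a * x₁ t + b * x₂ t := by
            have hq : (a * x₁ t + b * x₂ t)⁻¹ ≤ a * (x₁ t)⁻¹ + b * (x₂ t)⁻¹ := by
              have := (convexOn_zpow (𝕜 := ℝ) (-1)).2 (mem_Ioi.2 p1) (mem_Ioi.2 p2) ha hb hab
              simpa [smul_eq_mul] using this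
            have hp : 0 < a * x₁ t + b * x₂ t :=
              (convex_Ioi (0 : ℝ)) (mem_Ioi.2 p1) (mem_Ioi.2 p2) ha hb hab
            exact (inv_le_inv₀ hp p).1 (hq.trans h4)
          have h6 : P.c (a * h₁ t + b * h₂ t) ≤ a * P.c (h₁ t) + b * P.c (h₂ t) :=
            hP.cost.strictConvex.convexOn.2 (hh₁.2 t).1 (hh₂.2 t).1 ha hb hab
          have h7 := mul_le_mul_of_nonneg_left h5 hP.abar_pos.le
          have h8 : P.abar * x t + P.c (a * h₁ t + b * h₂ t)
              ≤ a * (P.abar * x₁ t + P.c (h₁ t)) + b * (P.abar * x₂ t + P.c (h₂ t)) := by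
            linarith
          refine (mul_le_mul_of_nonneg_left h8 (Real.exp_pos _).le).trans (le_of_eq ?_)
          ring
      _ = _ := by rw [integral_add i1 i2, integral_const_mul, integral_const_mul, J, J]
  calc P.v g (a * y₁ + b * y₂)⁻¹ ≤ _ := v_le hP hh (inv_pos.2 h3) hx
    _ ≤ _ := hJ
    _ ≤ a * (P.v g y₁⁻¹ + ε) + b * (P.v g y₂⁻¹ + ε) := by gcongr
    _ = _ := by obtain rfl : b = 1 - a := by linarith
                ring

lemma differentiableAt_v (hP : P.Valid) {γ : ℝ} (hγ : 0 < γ) : DifferentiableAt ℝ (P.v g) γ :=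
  differentiableAt_of_concaveOn_of_convexOn_inv (concaveOn_v hP) (convexOn_v_inv hP) hγ

/-- By the chain rule −γ²v'(γ) is the derivative of y ↦ v(1/y) at y = 1/γ. This derivative is
nondecreasing in y by convexity, and γ ↦ 1/γ reverses the order. -/
lemma sq_mul_deriv_v_mono (hP : P.Valid) {γ₁ γ₂ : ℝ} (h1 : 0 < γ₁) (h12 : γ₁ ≤ γ₂) :
    γ₁ ^ 2 * deriv (P.v g) γ₁ ≤ γ₂ ^ 2 * deriv (P.v g) γ₂ := by
  have hd : ∀ {γ}, 0 < γ → HasDerivAt (fun y => P.v g y⁻¹) (-(γ ^ 2 * deriv (P.v g) γ)) γ⁻¹ := by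
    intro γ hγ
    have h3 := (differentiableAt_v (g := g) hP hγ).hasDerivAt
    have h4 : HasDerivAt (P.v g) (deriv (P.v g) γ) (γ⁻¹)⁻¹ := by rwa [inv_inv]
    have h5 := h4.comp γ⁻¹ (hasDerivAt_inv (inv_pos.2 hγ).ne')
    have h6 : deriv (P.v g) γ * -((γ⁻¹) ^ 2)⁻¹ = -(γ ^ 2 * deriv (P.v g) γ) := by
      rw [inv_pow, inv_inv]
      ring
    rwa [h6] at h5
  have h2 : 0 < γ₂ := h1.trans_le h12
  have := (convexOn_v_inv (g := g) hP).monotoneOn_deriv (fun y hy => by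
    have := (hd (inv_pos.2 hy)).differentiableAt
    rwa [inv_inv] at this) (mem_Ioi.2 (inv_pos.2 h2)) (mem_Ioi.2 (inv_pos.2 h1))
    (inv_anti₀ h1 h12)
  rw [(hd h1).deriv, (hd h2).deriv] at this
  linarith

/-! ### Steady states and verification -/

/-- The stationary solution of the adjoint equation, given the state and the control. -/
def adjoint (P : Params) (γ k : ℝ) : ℝ :=
  P.abar / (2 * ((1 / P.sigma1) ^ 2 + k) * γ + 2 * P.lam + P.delta)

/-- `(γ, k)` is a steady state at which the first-order conditions hold for the control `k` and
the stationary adjoint state. -/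
structure IsSteady (P : Params) (γ k : ℝ) : Prop where
  pos : 0 < γ
  nonneg : 0 ≤ k
  drift : P.f γ k = 0
  le_marginal : γ ^ 2 * P.adjoint γ k ≤ P.dc k
  marginal_eq : 0 < k → P.dc k = γ ^ 2 * P.adjoint γ k

namespace IsSteady

variable {γ k : ℝ}

lemma denom_pos (hP : P.Valid) (hγ : 0 ≤ γ) (hk : 0 ≤ k) :
    0 < 2 * ((1 / P.sigma1) ^ 2 + k) * γ + 2 * P.lam + P.delta := by
  have h1 := hP.delta_pos
  have h2 := hP.lam_nonneg
  positivity

lemma adjoint_pos (hs : P.IsSteady γ k) (hP : P.Valid) : 0 < P.adjoint γ k :=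
  div_pos hP.abar_pos (denom_pos hP hs.pos.le hs.nonneg)

/-- Verification: the stationary adjoint state yields a lower bound of the cost of all controls. -/
lemma le_J (hs : P.IsSteady γ k) (hP : P.Valid) (hh : P.IsControl g h) (h0 : 0 < γ₀)
    (hx : P.IsTrajectory h γ₀ x) :
    (P.abar * γ + P.c k) / P.delta - γ ^ 2 * P.adjoint γ k * (γ₀⁻¹ - γ⁻¹) ≤ P.J h x := by
  obtain ⟨m, hm, hmx⟩ := hx.exists_lower_bound hP hh h0
  obtain ⟨cy, iy, fy⟩ := hx.inv_integral_form hP hh h0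
  have hδ := hP.delta_pos
  have hγ := hs.pos
  set S := (1 / P.sigma1) ^ 2 with hS
  set z := γ ^ 2 * P.adjoint γ k with hz
  have hz0 : 0 < z := mul_pos (by positivity) (hs.adjoint_pos hP)
  set q := (P.abar * γ + P.c k) with hq
  set ψ : ℝ → ℝ := fun s => S + h s + 2 * P.lam * (x s)⁻¹ - P.sigma2 ^ 2 * (x s)⁻¹ ^ 2 with hψ
  have hzγ : z * (2 * (S + k) * γ + 2 * P.lam + P.delta) = P.abar * γ ^ 2 := by
    rw [hz, adjoint, ← hS]
    have := denom_pos hP hγ.le hs.nonneg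
    rw [← hS] at this
    rw [mul_assoc, div_mul_cancel₀ _ this.ne']
    ring
  have hdrift : P.sigma2 ^ 2 = (S + k) * γ ^ 2 + 2 * P.lam * γ := by
    have := hs.drift
    rw [f, ← hS] at this
    linarith
  -- The first-order conditions say that z = γ²p is a subgradient of c at k on [0, ∞), also at the
  -- corner k = 0.
  have hcost : ∀ l, 0 ≤ l → P.c k + z * (l - k) ≤ P.c l := by
    intro l hl
    have h1 : P.c k + P.dc k * (l - k) ≤ P.c l := hP.cost.add_marginal_mul_le hs.nonneg hl
    rcases hs.nonneg.eq_or_lt with h2 | h2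
    · have h3 := mul_le_mul_of_nonneg_right hs.le_marginal (by linarith : 0 ≤ l - k)
      linarith
    · rw [hs.marginal_eq h2] at h1
      exact h1
  have hpt : ∀ s, 0 ≤ s → q + z * (ψ s - P.delta * ((x s)⁻¹ - γ⁻¹))
      ≤ P.abar * x s + P.c (h s) := by
    intro s hs0
    have hxs := hm.trans_le (hmx s hs0)
    have h1 := hcost (h s) (hh.2 s).1
    set X := x s with hX
    have hA := hP.abar_pos
    -- With the adjoint equation substituted for ā and the drift equation for σ₂², the gap is a
    -- complete square in the precision.
    have h2 : P.abar * X - P.abar * γ - z * (S + k + 2 * P.lam * X⁻¹ - P.sigma2 ^ 2 * X⁻¹ ^ 2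
        - P.delta * (X⁻¹ - γ⁻¹))
        = (P.abar * X * γ ^ 2 + z * P.sigma2 ^ 2) * (X⁻¹ - γ⁻¹) ^ 2 := by
      have hab : P.abar = z * (2 * (S + k) * γ + 2 * P.lam + P.delta) / γ ^ 2 := by
        rw [hzγ]; field_simp
      rw [hab, hdrift]
      field_simp
      ring
    have h3 : 0 ≤ (P.abar * X * γ ^ 2 + z * P.sigma2 ^ 2) * (X⁻¹ - γ⁻¹) ^ 2 := by positivity
    have h4 : q + z * (ψ s - P.delta * (X⁻¹ - γ⁻¹)) = P.abar * γ + (P.c k + z * (h s - k))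
        + z * (S + k + 2 * P.lam * X⁻¹ - P.sigma2 ^ 2 * X⁻¹ ^ 2 - P.delta * (X⁻¹ - γ⁻¹)) := by
      simp only [hψ, hq]
      ring
    linarith
  have hexp := fun (T : ℝ) (hT : 0 ≤ T) =>
    exp_mul_eq_of_integral_form (Y := fun t => (x t)⁻¹ - γ⁻¹) (ψ := ψ) P.delta iy
      (fun t ht => by rw [fy t ht]; ring) hT
  have hexpI : ∀ T, 0 ≤ T → IntervalIntegrable
      (fun s => Real.exp (-(P.delta * s)) * (ψ s - P.delta * ((x s)⁻¹ - γ⁻¹))) volume 0 T := by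
    intro T hT
    have hc' : ContinuousOn (fun t => (x t)⁻¹) (uIcc 0 T) := by
      rw [uIcc_of_le hT]; exact cy.mono Icc_subset_Ici_self
    refine IntervalIntegrable.continuousOn_mul ((iy T hT).sub ?_) (by fun_prop)
    exact ContinuousOn.intervalIntegrable (by fun_prop)
  have hJ := intervalIntegral_tendsto_integral_Ioi 0 (integrableOn_cost hP hh h0 hx) tendsto_id
  have hE := intervalIntegral_tendsto_integral_Ioi 0 (integrableOn_exp_neg hP) tendsto_id
  rw [integral_exp_neg hP] at hE
  have hdec : Tendsto (fun T => Real.exp (-(P.delta * T))) atTop (𝓝 0) :=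
    Real.tendsto_exp_neg_atTop_nhds_zero.comp (tendsto_id.const_mul_atTop hδ)
  have hbd : Tendsto (fun T => Real.exp (-(P.delta * T)) * ((x T)⁻¹ - γ⁻¹)) atTop (𝓝 0) := by
    refine hdec.zero_mul_isBoundedUnder_le ⟨m⁻¹ + γ⁻¹, ?_⟩
    rw [eventually_map]
    filter_upwards [eventually_ge_atTop 0] with T hT
    have h1 := hmx T hT
    have h2 : (x T)⁻¹ ≤ m⁻¹ := inv_anti₀ hm h1
    have h3 : 0 < (x T)⁻¹ := inv_pos.2 (hm.trans_le h1)
    have h4 : 0 < γ⁻¹ := inv_pos.2 hγ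
    simp only [Function.comp, Real.norm_eq_abs, abs_le]
    constructor <;> linarith
  -- As T → ∞ the discounted precision vanishes, since the state stays above m, and only the initial
  -- term remains.
  have hlim : Tendsto (fun T => q * (∫ t in (0 : ℝ)..T, Real.exp (-(P.delta * t))) + z *
      (Real.exp (-(P.delta * T)) * ((x T)⁻¹ - γ⁻¹) - ((x 0)⁻¹ - γ⁻¹))) atTop
      (𝓝 (q * (1 / P.delta) + z * (0 - ((x 0)⁻¹ - γ⁻¹)))) :=
    (hE.const_mul q).add ((hbd.sub_const _).const_mul z)
  rw [hx.apply_zero] at hlim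
  have hfin := le_of_tendsto_of_tendsto hlim hJ ?_
  · refine le_trans (le_of_eq ?_) hfin
    ring
  · filter_upwards [eventually_ge_atTop 0] with T hT
    have hT2 := hexp T hT
    simp only [hx.apply_zero] at hT2
    have iE : IntervalIntegrable (fun t => Real.exp (-(P.delta * t))) volume 0 T :=
      Continuous.intervalIntegrable (by fun_prop) _ _
    rw [hT2, ← intervalIntegral.integral_const_mul, ← intervalIntegral.integral_const_mul,
      ← intervalIntegral.integral_add (iE.const_mul _) ((hexpI T hT).const_mul _)]
    refine intervalIntegral.integral_mono_on hT ((iE.const_mul _).add ((hexpI T hT).const_mul _))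
      ?_ fun s hs' => ?_
    · exact (intervalIntegrable_iff_integrableOn_Ioc_of_le hT).2
        ((integrableOn_cost hP hh h0 hx).mono_set Ioc_subset_Ioi_self)
    · have := mul_le_mul_of_nonneg_left (hpt s hs'.1) (Real.exp_pos (-(P.delta * s))).le
      refine le_trans (le_of_eq ?_) this
      ring

end IsSteady
end Params
end

/-! ### Steady states are the equilibria -/

noncomputable section
namespace Params

variable {P : Params} {g γ k : ℝ}

lemma f_lt_f (hP : P.Valid) {γ₁ γ₂ k₁ k₂ : ℝ} (h1 : 0 ≤ γ₁) (h12 : γ₁ < γ₂) (hk : 0 ≤ k₁)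
    (hk12 : k₁ ≤ k₂) : P.f γ₂ k₂ < P.f γ₁ k₁ := by
  have hl := hP.lam_nonneg
  have hs : 0 < 1 / P.sigma1 := one_div_pos.2 hP.sigma1_pos
  have h0 : 0 < (1 / P.sigma1) ^ 2 + k₁ := by positivity
  have h2 : ((1 / P.sigma1) ^ 2 + k₁) * γ₁ ^ 2 < ((1 / P.sigma1) ^ 2 + k₁) * γ₂ ^ 2 := by
    gcongr
  have h4 : ((1 / P.sigma1) ^ 2 + k₁) * γ₂ ^ 2 ≤ ((1 / P.sigma1) ^ 2 + k₂) * γ₂ ^ 2 := by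
    gcongr
  have h3 : 2 * P.lam * γ₁ ≤ 2 * P.lam * γ₂ := by gcongr
  unfold f
  linarith

lemma f_zero_left_pos (hP : P.Valid) (k : ℝ) : 0 < P.f 0 k := by
  have := hP.sigma2_pos
  simp only [f]
  ring_nf
  positivity

lemma gammaInf_pos (hP : P.Valid) : 0 < P.gammaInf := by
  have h1 := hP.sigma1_pos
  have h2 := hP.sigma2_pos
  have h3 := hP.lam_nonneg
  have : P.lam * P.sigma1 ^ 2
      < Real.sqrt (P.lam ^ 2 * P.sigma1 ^ 4 + P.sigma1 ^ 2 * P.sigma2 ^ 2) := by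
    apply Real.lt_sqrt_of_sq_lt
    have : 0 < P.sigma1 ^ 2 * P.sigma2 ^ 2 := by positivity
    nlinarith
  unfold gammaInf
  linarith

lemma f_gammaInf (hP : P.Valid) : P.f P.gammaInf 0 = 0 := by
  have h1 := hP.sigma1_pos
  have h2 : 0 ≤ P.lam ^ 2 * P.sigma1 ^ 4 + P.sigma1 ^ 2 * P.sigma2 ^ 2 := by positivity
  have h3 := Real.sq_sqrt h2
  rw [f, gammaInf]
  set r := Real.sqrt (P.lam ^ 2 * P.sigma1 ^ 4 + P.sigma1 ^ 2 * P.sigma2 ^ 2)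
  field_simp
  linear_combination -h3

lemma le_gammaInf (hP : P.Valid) (hk : 0 ≤ k) (hf : P.f γ k = 0) :
    γ ≤ P.gammaInf := by
  by_contra! hlt
  have := f_lt_f hP (gammaInf_pos hP).le hlt le_rfl hk
  rw [f_gammaInf hP, hf] at this
  exact lt_irrefl _ this

namespace IsSteady

/-- The denominator of the adjoint state is at least δ. This is the bound behind the choice of
`hmax`: at a steady state the cap on the control is harmless. -/
lemma sq_mul_adjoint_le_M0 (hP : P.Valid) (hγ : 0 ≤ γ) (hk : 0 ≤ k) (hγg : γ ≤ g) :
    γ ^ 2 * P.adjoint γ k ≤ P.M0 g := by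
  have hA := hP.abar_pos
  have hδ := hP.delta_pos
  have hl := hP.lam_nonneg
  unfold M0 adjoint
  have : P.delta ≤ 2 * ((1 / P.sigma1) ^ 2 + k) * γ + 2 * P.lam + P.delta := by
    have : 0 ≤ 2 * ((1 / P.sigma1) ^ 2 + k) * γ + 2 * P.lam := by positivity
    linarith
  gcongr

lemma le_gammaInf (hs : P.IsSteady γ k) (hP : P.Valid) : γ ≤ P.gammaInf :=
  Params.le_gammaInf hP hs.nonneg hs.drift

lemma hhat_eq (hs : P.IsSteady γ k) (hP : P.Valid) (hg : P.gammaInf < g) :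
    P.hhat g (γ ^ 2 * P.adjoint γ k) = k :=
  hP.hhat_eq (sq_mul_adjoint_le_M0 hP hs.pos.le hs.nonneg ((hs.le_gammaInf hP).trans hg.le))
    hs.nonneg hs.le_marginal hs.marginal_eq

/-- The constant control k keeps the state at γ and attains the lower bound of the verification
argument. -/
lemma v_eq (hs : P.IsSteady γ k) (hP : P.Valid) (hg : P.gammaInf < g) :
    P.v g γ = (P.abar * γ + P.c k) / P.delta := by
  have hk : k ∈ Icc 0 (P.hmax g) := hs.hhat_eq hP hg ▸ (hP.hhat_spec _).1
  have hh : P.IsControl g fun _ => k := ⟨measurable_const, fun _ => hk⟩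
  have hx : P.IsTrajectory (fun _ => k) γ fun _ => γ :=
    ⟨continuousOn_const, fun t _ => by simp [hs.drift]⟩
  refine le_antisymm ((v_le hP hh hs.pos hx).trans (le_of_eq ?_)) (le_v hP hs.pos ?_)
  · rw [J, integral_mul_const, integral_exp_neg hP]
    ring
  · intro h x hh hx
    simpa using hs.le_J hP hh hs.pos hx

/-- The verification bound touches v from below at γ, and v is already known to be differentiable,
so the two derivatives agree. -/
lemma deriv_v (hs : P.IsSteady γ k) (hP : P.Valid) (hg : P.gammaInf < g) :
    deriv (P.v g) γ = P.adjoint γ k := by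
  have hγ := hs.pos
  have hmin : IsLocalMin (fun r => P.v g r + γ ^ 2 * P.adjoint γ k * (r⁻¹ - γ⁻¹)) γ := by
    filter_upwards [eventually_gt_nhds hγ] with r hr
    rw [hs.v_eq hP hg]
    have : (P.abar * γ + P.c k) / P.delta - γ ^ 2 * P.adjoint γ k * (r⁻¹ - γ⁻¹) ≤ P.v g r :=
      le_v hP hr fun h x hh hx => hs.le_J hP hh hr hx
    linarith
  have hd := ((differentiableAt_v (g := g) hP hγ).hasDerivAt).add
    (((hasDerivAt_inv hγ.ne').sub_const γ⁻¹).const_mul (γ ^ 2 * P.adjoint γ k))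
  have := hmin.hasDerivAt_eq_zero hd
  have h2 : γ ^ 2 * P.adjoint γ k * -(γ ^ 2)⁻¹ = -P.adjoint γ k := by field_simp
  linarith

lemma _root_.Params.dv_eq_deriv (h0 : 0 < γ) (hg : γ < g) : P.dv g γ = deriv (P.v g) γ :=
  derivWithin_of_mem_nhds (Icc_mem_nhds h0 hg)

lemma dv_eq (hs : P.IsSteady γ k) (hP : P.Valid) (hg : P.gammaInf < g) :
    P.dv g γ = P.adjoint γ k := by
  rw [dv_eq_deriv hs.pos ((hs.le_gammaInf hP).trans_lt hg), hs.deriv_v hP hg]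

lemma feedback_eq (hs : P.IsSteady γ k) (hP : P.Valid) (hg : P.gammaInf < g) :
    P.feedback g γ = k := by
  rw [feedback, hs.dv_eq hP hg, hs.hhat_eq hP hg]

/-- Monotonicity of γ²v' makes the feedback nondecreasing, so the controlled drift is strictly
decreasing. A root is positive and at most γ⁰∞ < g, so only two-sided derivatives of v matter. -/
lemma root_iff (hs : P.IsSteady γ k) (hP : P.Valid) (hg : P.gammaInf < g) {r : ℝ}
    (hr : r ∈ Icc 0 g) : P.f r (P.feedback g r) = 0 ↔ r = γ := by
  constructor
  · intro h
    have hnn : ∀ r, 0 ≤ P.feedback g r := fun r => (hP.hhat_spec _).1.1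
    have hr0 : 0 < r := by
      refine lt_of_le_of_ne hr.1 ?_
      rintro rfl
      exact absurd h (f_zero_left_pos hP _).ne'
    have hrg : r < g := (Params.le_gammaInf hP (hnn _) h).trans_lt hg
    have hfb := hs.feedback_eq hP hg
    have hγg := (hs.le_gammaInf hP).trans_lt hg
    rcases lt_trichotomy r γ with hlt | heq | hlt
    · have h1 : P.feedback g r ≤ P.feedback g γ := by
        refine hP.hhat_mono ?_
        rw [dv_eq_deriv hr0 hrg, dv_eq_deriv hs.pos hγg]
        exact sq_mul_deriv_v_mono hP hr0 hlt.le
      have := f_lt_f hP hr0.le hlt (hnn _) h1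
      rw [h, hfb, hs.drift] at this
      exact absurd this (lt_irrefl _)
    · exact heq
    · have h1 : P.feedback g γ ≤ P.feedback g r := by
        refine hP.hhat_mono ?_
        rw [dv_eq_deriv hr0 hrg, dv_eq_deriv hs.pos hγg]
        exact sq_mul_deriv_v_mono hP hs.pos hlt.le
      have := f_lt_f hP hs.pos.le hlt (hnn _) h1
      rw [h, hfb, hs.drift] at this
      exact absurd this (lt_irrefl _)
  · rintro rfl
    rw [hs.feedback_eq hP hg, hs.drift]

lemma gammaEq_eq (hs : P.IsSteady γ k) (hP : P.Valid) (hg : P.gammaInf < g) :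
    P.gammaEq g = γ := by
  have hγ : γ ∈ Icc 0 g := ⟨hs.pos.le, ((hs.le_gammaInf hP).trans_lt hg).le⟩
  have : {r | r ∈ Icc 0 g ∧ P.f r (P.feedback g r) = 0} = {γ} := by
    ext r
    simp only [mem_ofPred_eq, mem_singleton_iff]
    constructor
    · rintro ⟨h1, h2⟩
      exact (hs.root_iff hP hg h1).1 h2
    · rintro rfl
      exact ⟨hγ, (hs.root_iff hP hg hγ).2 rfl⟩
  rw [gammaEq, this, csSup_singleton]

lemma hEq_eq (hs : P.IsSteady γ k) (hP : P.Valid) (hg : P.gammaInf < g) : P.hEq g = k := by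
  rw [hEq, hs.gammaEq_eq hP hg, hs.feedback_eq hP hg]

lemma vEq_eq (hs : P.IsSteady γ k) (hP : P.Valid) (hg : P.gammaInf < g) :
    P.vEq g = (P.abar * γ + P.c k) / P.delta := by
  rw [vEq, hs.gammaEq_eq hP hg, hs.v_eq hP hg]

lemma pEq_eq (hs : P.IsSteady γ k) (hP : P.Valid) (hg : P.gammaInf < g) :
    P.pEq g = P.adjoint γ k := by
  rw [pEq, hs.gammaEq_eq hP hg, hs.dv_eq hP hg]

/-- Solutions of the state-adjoint equilibrium system are steady states. -/
lemma _root_.Params.isSteady_of_Phi_eq_zero (hP : P.Valid) (hg : P.gammaInf < g) {p : ℝ}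
    (hγ : 0 ≤ γ) (h : P.Phi g γ p = 0) :
    P.IsSteady γ (P.hhat g (γ ^ 2 * p)) ∧ p = P.adjoint γ (P.hhat g (γ ^ 2 * p)) := by
  have hk := (hP.hhat_spec (g := g) (γ ^ 2 * p)).1.1
  have h1 : P.f γ (P.hhat g (γ ^ 2 * p)) = 0 := congrArg Prod.fst h
  have h2 : (2 * ((1 / P.sigma1) ^ 2 + P.hhat g (γ ^ 2 * p)) * γ + 2 * P.lam + P.delta) * p
      - P.abar = 0 := congrArg Prod.snd h
  have hp : p = P.adjoint γ (P.hhat g (γ ^ 2 * p)) := by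
    rw [adjoint, eq_div_iff (denom_pos hP hγ hk).ne']
    linarith
  have hγ0 : 0 < γ := by
    refine lt_of_le_of_ne hγ ?_
    rintro rfl
    exact absurd h1 (f_zero_left_pos hP _).ne'
  have hM : γ ^ 2 * p ≤ P.M0 g := by
    have := sq_mul_adjoint_le_M0 hP hγ hk ((Params.le_gammaInf hP hk h1).trans hg.le)
    rwa [← hp] at this
  obtain ⟨k, hk0, hle, heq⟩ := hP.cost.exists_marginal_eq (γ ^ 2 * p)
  have hkk := hP.hhat_eq hM hk0 hle heq
  rw [hkk] at hp h1 ⊢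
  refine ⟨⟨hγ0, hk0, h1, ?_, ?_⟩, hp⟩
  · rw [← hp]
    exact hle
  · rw [← hp]
    exact heq

end IsSteady
end Params
end

/-! ### Steady states in the precision: comparison and existence -/

noncomputable section

/-- The first-order conditions of a steady state in terms of the precision `y`: `μ` is the marginal
cost, `l` the speed of mean reversion, `d` the discount rate, `s` and `B` are the drift
coefficients of the precision, and `A` is the state cost. -/
structure PrecisionSteady (μ : ℝ → ℝ) (l d s B A y k : ℝ) : Prop where
  pos : 0 < y
  nonneg : 0 ≤ k
  drift : B * y ^ 2 - 2 * l * y - s = k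
  le : A ≤ μ k * (y ^ 2 * (2 * B * y + d - 2 * l))
  eq : 0 < k → μ k * (y ^ 2 * (2 * B * y + d - 2 * l)) = A

namespace PrecisionSteady

variable {μ : ℝ → ℝ} {l d s B A y k s' B' A' y' k' : ℝ}

/-- From y(By − 2l) ≥ s > 0. On this range the required rate and the weight are both increasing in
y. -/
lemma two_mul_lt (hs : 0 < s) (hy : 0 < y) (hk : 0 ≤ B * y ^ 2 - 2 * l * y - s) :
    2 * l < B * y := by
  have : 0 < (B * y - 2 * l) * y := by nlinarith
  have := pos_of_mul_pos_left this hy.le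
  linarith

lemma weight_pos (hl : 0 ≤ l) (hd : 0 < d) (hs : 0 < s) (hy : 0 < y)
    (hk : 0 ≤ B * y ^ 2 - 2 * l * y - s) : 0 < y ^ 2 * (2 * B * y + d - 2 * l) := by
  have := two_mul_lt hs hy hk
  have : 0 < 2 * B * y + d - 2 * l := by linarith
  positivity

lemma drift_mono (hl : 0 ≤ l) (hs : 0 < s) (hy : 0 < y) (hk : 0 ≤ B * y ^ 2 - 2 * l * y - s)
    (hyy : y ≤ y') (hB : B ≤ B') (hss : s' ≤ s) :
    B * y ^ 2 - 2 * l * y - s ≤ B' * y' ^ 2 - 2 * l * y' - s' := by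
  have h1 := two_mul_lt hs hy hk
  have hB0 : 0 < B := pos_of_mul_pos_left (by linarith : 0 < B * y) hy.le
  have h2 : B * y ≤ B' * y' := mul_le_mul hB hyy hy.le (hB0.le.trans hB)
  nlinarith [mul_le_mul (by linarith : B * y - 2 * l ≤ B' * y' - 2 * l) hyy hy.le (by linarith)]

lemma drift_strictMono (hl : 0 ≤ l) (hs : 0 < s) (hy : 0 < y)
    (hk : 0 ≤ B * y ^ 2 - 2 * l * y - s) (hyy : y < y') :
    B * y ^ 2 - 2 * l * y - s < B * y' ^ 2 - 2 * l * y' - s := by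
  have h1 := two_mul_lt hs hy hk
  have hB0 : 0 < B := pos_of_mul_pos_left (by linarith : 0 < B * y) hy.le
  have h2 : B * y < B * y' := by gcongr
  nlinarith [mul_lt_mul'' h2 hyy (by linarith) hy.le]

lemma weight_mono (hl : 0 ≤ l) (hd : 0 < d) (hs : 0 < s) (hy : 0 < y)
    (hk : 0 ≤ B * y ^ 2 - 2 * l * y - s) (hyy : y ≤ y') (hB : B ≤ B') :
    y ^ 2 * (2 * B * y + d - 2 * l) ≤ y' ^ 2 * (2 * B' * y' + d - 2 * l) := by
  have h1 := two_mul_lt hs hy hk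
  have hB0 : 0 < B := pos_of_mul_pos_left (by linarith : 0 < B * y) hy.le
  have h2 : B * y ≤ B' * y' := mul_le_mul hB hyy hy.le (hB0.le.trans hB)
  have h3 : y ^ 2 ≤ y' ^ 2 := pow_le_pow_left₀ hy.le hyy 2
  exact mul_le_mul h3 (by linarith) (by linarith) (by positivity)

lemma weight_pos' (h : PrecisionSteady μ l d s B A y k) (hl : 0 ≤ l) (hd : 0 < d) (hs : 0 < s) :
    0 < y ^ 2 * (2 * B * y + d - 2 * l) :=
  weight_pos hl hd hs h.pos (h.drift ▸ h.nonneg)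

lemma marginal_pos (h : PrecisionSteady μ l d s B A y k) (hl : 0 ≤ l) (hd : 0 < d) (hs : 0 < s)
    (hA : 0 < A) : 0 < μ k :=
  pos_of_mul_pos_left (hA.trans_le h.le) (h.weight_pos' hl hd hs).le

/-- The drift equation eliminates B, so weights can be compared through k and y alone. -/
lemma weight_eq (h : PrecisionSteady μ l d s B A y k) :
    y ^ 2 * (2 * B * y + d - 2 * l) = 2 * (s + k) * y + (2 * l + d) * y ^ 2 := by
  rw [← h.drift]
  ring

/-- The comparison argument behind all monotonicity statements. -/
lemma compare (h : PrecisionSteady μ l d s B A y k) (h' : PrecisionSteady μ l d s' B' A' y' k')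
    (hμ : StrictMonoOn μ (Ici 0)) (hl : 0 ≤ l) (hd : 0 < d) (hs : 0 < s) (hA : 0 < A)
    (hk : k ≤ k') (hk' : 0 < k')
    (hN : y ^ 2 * (2 * B * y + d - 2 * l) ≤ y' ^ 2 * (2 * B' * y' + d - 2 * l)) (hAA : A' ≤ A) :
    k = k' ∧ y' ^ 2 * (2 * B' * y' + d - 2 * l) = y ^ 2 * (2 * B * y + d - 2 * l) := by
  have hN0 := h.weight_pos' hl hd hs
  have hμ0 := h.marginal_pos hl hd hs hA
  have h1 := h.le
  have h2 := h'.eq hk'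
  -- Both factors grow from the first state to the second, while the products satisfy the reverse
  -- inequality. So neither factor can grow strictly.
  have h3 : μ k ≤ μ k' := hμ.monotoneOn h.nonneg hk'.le hk
  have h4 : μ k * (y' ^ 2 * (2 * B' * y' + d - 2 * l))
      ≤ μ k' * (y' ^ 2 * (2 * B' * y' + d - 2 * l)) :=
    mul_le_mul_of_nonneg_right h3 (hN0.le.trans hN)
  have h5 := mul_le_mul_of_nonneg_left hN hμ0.le
  constructor
  · refine hk.antisymm ?_
    by_contra! hlt
    have := mul_lt_mul_of_pos_right (hμ h.nonneg hk'.le hlt) (hN0.trans_le hN)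
    linarith
  · refine le_antisymm ?_ hN
    refine le_of_mul_le_mul_left ?_ hμ0
    linarith

/-- If the precision did not fall, the larger drift coefficients would raise both the required rate
and the weight, overshooting the first-order condition. If the precision falls while a positive rate
fails to rise, the weight falls strictly and the condition is missed from the other side. -/
lemma mono_volatility (h : PrecisionSteady μ l d s B A y k)
    (h' : PrecisionSteady μ l d s' B' A y' k')
    (hμ : StrictMonoOn μ (Ici 0)) (hl : 0 ≤ l) (hd : 0 < d) (hs : 0 < s) (hs' : 0 < s')
    (hA : 0 < A) (hB : B ≤ B') (hss : s' ≤ s) (hne : B < B' ∨ s' < s) :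
    y' < y ∧ (k = 0 ∨ k < k') := by
  have hk0 : 0 ≤ B * y ^ 2 - 2 * l * y - s := h.drift ▸ h.nonneg
  have hy : y' < y := by
    by_contra! hyy
    have h1 : k < k' := by
      rw [← h.drift, ← h'.drift]
      rcases hne with h2 | h2
      · refine (drift_mono hl hs h.pos hk0 hyy le_rfl hss).trans_lt ?_
        have := mul_lt_mul_of_pos_right h2 (pow_pos h'.pos 2)
        linarith
      · refine (drift_mono hl hs h.pos hk0 hyy hB le_rfl).trans_lt ?_
        linarith
    exact h1.ne (compare h h' hμ hl hd hs hA h1.le (h.nonneg.trans_lt h1)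
      (weight_mono hl hd hs h.pos hk0 hyy hB) le_rfl).1
  refine ⟨hy, ?_⟩
  by_contra! hcon
  have hkpos : 0 < k := lt_of_le_of_ne h.nonneg (Ne.symm hcon.1)
  have hN : y' ^ 2 * (2 * B' * y' + d - 2 * l) < y ^ 2 * (2 * B * y + d - 2 * l) := by
    rw [h.weight_eq, h'.weight_eq]
    have h1 : 2 * (s' + k') * y' ≤ 2 * (s + k) * y := by
      have := h'.nonneg
      have := h'.pos
      have := hcon.2
      gcongr
    have h2 : (2 * l + d) * y' ^ 2 < (2 * l + d) * y ^ 2 := by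
      have := h'.pos
      gcongr
    linarith
  exact hN.ne' (compare h' h hμ hl hd hs' hA hcon.2 hkpos hN.le le_rfl).2

/-- A lower precision means a lower rate and a lower weight, so it cannot support a higher state
cost. -/
lemma mono_stateCost (h : PrecisionSteady μ l d s B A y k)
    (h' : PrecisionSteady μ l d s B A' y' k')
    (hμ : StrictMonoOn μ (Ici 0)) (hl : 0 ≤ l) (hd : 0 < d) (hs : 0 < s)
    (hA : 0 < A) (hAA : A ≤ A') :
    y ≤ y' ∧ k ≤ k' ∧ (A < A' → 0 < k' → y < y' ∧ k < k') := by
  have hk0 : 0 ≤ B * y ^ 2 - 2 * l * y - s := h.drift ▸ h.nonneg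
  have hk0' : 0 ≤ B * y' ^ 2 - 2 * l * y' - s := h'.drift ▸ h'.nonneg
  have hy : y ≤ y' := by
    by_contra! hyy
    have h1 : k' < k := by
      rw [← h.drift, ← h'.drift]
      exact drift_strictMono hl hs h'.pos hk0' hyy
    exact h1.ne (compare h' h hμ hl hd hs (hA.trans_le hAA) h1.le (h'.nonneg.trans_lt h1)
      (weight_mono hl hd hs h'.pos hk0' hyy.le le_rfl) hAA).1
  have hk : k ≤ k' := by
    rw [← h.drift, ← h'.drift]
    exact drift_mono hl hs h.pos hk0 hy le_rfl le_rfl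
  refine ⟨hy, hk, fun hlt hpos => ?_⟩
  have hne : y < y' := by
    refine lt_of_le_of_ne hy ?_
    rintro rfl
    have hkk : k = k' := by rw [← h.drift, ← h'.drift]
    subst hkk
    have h1 := h.eq hpos
    have h2 := h'.eq hpos
    linarith
  refine ⟨hne, ?_⟩
  rw [← h.drift, ← h'.drift]
  exact drift_strictMono hl hs h.pos hk0 hne

lemma unique (h : PrecisionSteady μ l d s B A y k) (h' : PrecisionSteady μ l d s B A y' k')
    (hμ : StrictMonoOn μ (Ici 0)) (hl : 0 ≤ l) (hd : 0 < d) (hs : 0 < s) (hA : 0 < A) :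
    y = y' ∧ k = k' := by
  have h1 := mono_stateCost h h' hμ hl hd hs hA le_rfl
  have h2 := mono_stateCost h' h hμ hl hd hs hA le_rfl
  exact ⟨h1.1.antisymm h2.1, h1.2.1.antisymm h2.2.1⟩

/-- Here `y₀` is the uncontrolled precision. Either the rate 0 is already optimal there, or the
marginal cost times the weight is below A at `y₀` and passes A further up. -/
lemma exists_steady (hc : ContinuousOn μ (Ici 0)) (ht : Tendsto μ atTop atTop) (hl : 0 ≤ l)
    (hd : 0 < d) (hs : 0 < s) (hA : 0 < A) {y₀ : ℝ} (hy₀ : 0 < y₀)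
    (h₀ : B * y₀ ^ 2 - 2 * l * y₀ - s = 0) : ∃ y k, PrecisionSteady μ l d s B A y k := by
  rcases le_or_gt A (μ 0 * (y₀ ^ 2 * (2 * B * y₀ + d - 2 * l))) with hA0 | hA0
  · exact ⟨y₀, 0, hy₀, le_rfl, h₀, hA0, fun h => absurd h (lt_irrefl _)⟩
  have hw := two_mul_lt hs hy₀ h₀.ge
  have hB0 : 0 < B := pos_of_mul_pos_left (by linarith : 0 < B * y₀) hy₀.le
  have hnn : ∀ y, y₀ ≤ y → 0 ≤ B * y ^ 2 - 2 * l * y - s := fun y hy =>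
    h₀.ge.trans (drift_mono hl hs hy₀ h₀.ge hy le_rfl le_rfl)
  have hκ : Tendsto (fun y => B * y ^ 2 - 2 * l * y - s) atTop atTop := by
    have h1 : Tendsto (fun y => (B * y₀ - 2 * l) * y + -s) atTop atTop :=
      tendsto_atTop_add_const_right _ _ (tendsto_id.const_mul_atTop (by linarith))
    refine tendsto_atTop_mono' _ ?_ h1
    filter_upwards [eventually_ge_atTop y₀] with y hy
    nlinarith [mul_nonneg hB0.le (mul_nonneg (sub_nonneg.2 hy) (hy₀.le.trans hy))]
  -- The conditions b ≥ 1 and b ≥ 1/d make the weight at b at least 1, so that a marginal cost of at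
  -- least A suffices.
  obtain ⟨b, hb, hb0, hb1, hbd⟩ := ((ht.comp hκ).eventually_ge_atTop A |>.and
    ((eventually_ge_atTop y₀).and ((eventually_ge_atTop 1).and
      (eventually_ge_atTop (1 / d))))).exists
  have hcont : ContinuousOn (fun y => μ (B * y ^ 2 - 2 * l * y - s) *
      (y ^ 2 * (2 * B * y + d - 2 * l))) (Icc y₀ b) :=
    (hc.comp (by fun_prop) fun y hy => hnn y hy.1).mul (by fun_prop)
  have hbig : A ≤ μ (B * b ^ 2 - 2 * l * b - s) * (b ^ 2 * (2 * B * b + d - 2 * l)) := by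
    have h1 := two_mul_lt hs (hy₀.trans_le hb0) (hnn b hb0)
    have h2 : 1 ≤ b * d := by rwa [div_le_iff₀ hd] at hbd
    have h3 : 1 ≤ b ^ 2 * (2 * B * b + d - 2 * l) := by
      have h4 : b * d ≤ b ^ 2 * d := by nlinarith
      have h5 : b ^ 2 * d ≤ b ^ 2 * (2 * B * b + d - 2 * l) := by gcongr; linarith
      linarith
    have h4 : A ≤ μ (B * b ^ 2 - 2 * l * b - s) := hb
    nlinarith
  obtain ⟨y, hy, hyA⟩ := intermediate_value_Icc hb0 hcont ⟨by rw [h₀]; exact hA0.le, hbig⟩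
  exact ⟨y, _, hy₀.trans_le hy.1, hnn y hy.1, rfl, hyA.ge, fun _ => hyA⟩

end PrecisionSteady

/-! ### Differentiation of steady states in a parameter -/

/-- Derivative of an implicitly defined function of one variable. -/
lemma hasDerivAt_of_implicit {G : ℝ × ℝ → ℝ} {G' : ℝ × ℝ →L[ℝ] ℝ} {Y : ℝ → ℝ} {θ : ℝ}
    (hG : HasFDerivAt G G' (Y θ, θ)) (ha : G' (1, 0) ≠ 0) (hY : ContinuousAt Y θ)
    (h0 : ∀ᶠ t in 𝓝 θ, G (Y t, t) = 0) :
    HasDerivAt Y (-(G' (0, 1) / G' (1, 0))) θ := by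
  set a := G' (1, 0) with ha'
  set b := G' (0, 1) with hb'
  have hlin : ∀ u t : ℝ, G' (u, t) = a * u + b * t := by
    intro u t
    have : ((u, t) : ℝ × ℝ) = u • ((1, 0) : ℝ × ℝ) + t • ((0, 1) : ℝ × ℝ) := by simp
    rw [this, map_add, map_smul, map_smul, smul_eq_mul, smul_eq_mul, ← ha', ← hb']
    ring
  have hpair : Tendsto (fun t => (Y t, t)) (𝓝 θ) (𝓝 (Y θ, θ)) :=
    (hY.prodMk continuousAt_id)
  have ho := hG.isLittleO.comp_tendsto hpair
  rw [Asymptotics.isLittleO_iff] at ho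
  rw [hasDerivAt_iff_isLittleO, Asymptotics.isLittleO_iff]
  intro c hc
  have ha0 : 0 < |a| := abs_pos.2 ha
  -- For the deviation r from the linear prediction, |u| + |τ| ≤ |r| + M|τ|. The first bound on ε
  -- absorbs the |r| term, the second leaves at most c|τ|.
  set M := |b / a| + 1 with hM
  have hM0 : 0 < M := by positivity
  set ε := min (|a| / 2) (c * |a| / (2 * M)) with hε
  have hε0 : 0 < ε := lt_min (by positivity) (by positivity)
  have hε1 : ε ≤ |a| / 2 := min_le_left _ _
  have hε2 : ε * (2 * M) ≤ c * |a| := by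
    rw [← le_div_iff₀ (by positivity)]
    exact min_le_right _ _
  filter_upwards [ho hε0, h0] with t ht ht0
  have h00 := h0.self_of_nhds
  simp only [Function.comp, ht0, h00, sub_self, zero_sub, norm_neg, Prod.mk_sub_mk] at ht
  rw [hlin, Real.norm_eq_abs] at ht
  set u := Y t - Y θ with hu
  set τ := t - θ with hτ
  have hn : ‖(u, τ)‖ ≤ |u| + |τ| := by
    rw [Prod.norm_mk]
    exact max_le (by simp [Real.norm_eq_abs]) (by simp [Real.norm_eq_abs])
  set r := u + b / a * τ with hr
  have har : a * u + b * τ = a * r := by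
    rw [hr]
    field_simp
  have hur : |u| ≤ |r| + |b / a| * |τ| := by
    have : u = r + -(b / a * τ) := by rw [hr]; ring
    rw [this, ← abs_mul]
    exact (abs_add_le _ _).trans (by rw [abs_neg])
  have h1 : |a| * |r| ≤ ε * (|r| + M * |τ|) := by
    rw [← abs_mul, ← har]
    refine ht.trans ?_
    gcongr
    refine hn.trans ?_
    rw [hM]
    linarith
  have h2 : |a| * |r| ≤ c * |a| * |τ| := by
    have h3 : ε * |r| ≤ |a| / 2 * |r| := by gcongr
    have h4 : ε * (2 * M) * |τ| ≤ c * |a| * |τ| := by gcongr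
    nlinarith
  have h3 : |r| ≤ c * |τ| := by
    refine le_of_mul_le_mul_left ?_ ha0
    linarith
  rw [Real.norm_eq_abs, Real.norm_eq_abs, smul_eq_mul]
  have : u - τ * -(b / a) = r := by rw [hr]; ring
  rwa [this]

/-- Only the partial derivative along the line t = θ is computed. Once differentiability is known,
the value of the derivative follows by differentiating the defining identity. -/
lemma exists_hasDerivAt_of_implicit {G : ℝ × ℝ → ℝ} {Y : ℝ → ℝ} {θ a : ℝ}
    (hG : DifferentiableAt ℝ G (Y θ, θ)) (hline : HasDerivAt (fun y => G (y, θ)) a (Y θ))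
    (ha : a ≠ 0) (hY : ContinuousAt Y θ) (h0 : ∀ᶠ t in 𝓝 θ, G (Y t, t) = 0) :
    ∃ y₁, HasDerivAt Y y₁ θ := by
  have h1 : HasDerivAt (fun y => G (y, θ)) (fderiv ℝ G (Y θ, θ) (1, 0)) (Y θ) :=
    HasFDerivAt.comp_hasDerivAt (f := fun y => (y, θ)) (Y θ) hG.hasFDerivAt
      ((hasDerivAt_id' (Y θ)).prodMk (hasDerivAt_const (Y θ) θ))
  exact ⟨_, hasDerivAt_of_implicit hG.hasFDerivAt (by rwa [h1.unique hline]) hY h0⟩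

namespace PrecisionSteady

variable {μ : ℝ → ℝ} {l d : ℝ} {S B A Y K : ℝ → ℝ} {θ : ℝ}

lemma continuousAt_curve (hst : ∀ᶠ t in 𝓝 θ, PrecisionSteady μ l d (S t) (B t) (A t) (Y t) (K t))
    (hμ : StrictMonoOn μ (Ici 0)) (hμc : ContinuousOn μ (Ici 0)) (hl : 0 ≤ l) (hd : 0 < d)
    (hS : ContinuousAt S θ) (hB : ContinuousAt B θ) (hA : ContinuousAt A θ)
    (hS0 : 0 < S θ) (hA0 : 0 < A θ) (hK : 0 < K θ) : ContinuousAt Y θ := by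
  have h := hst.self_of_nhds
  have hκ : ∀ y, ContinuousAt (fun t => B t * y ^ 2 - 2 * l * y - S t) θ := fun y => by fun_prop
  have hN : ∀ y, ContinuousAt (fun t => y ^ 2 * (2 * B t * y + d - 2 * l)) θ := fun y => by
    fun_prop
  have hF : ∀ y, 0 < B θ * y ^ 2 - 2 * l * y - S θ → ContinuousAt (fun t =>
      μ (B t * y ^ 2 - 2 * l * y - S t) * (y ^ 2 * (2 * B t * y + d - 2 * l)) - A t) θ := by
    intro y hy
    have h1 : ContinuousAt μ (B θ * y ^ 2 - 2 * l * y - S θ) :=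
      hμc.continuousAt (Ici_mem_nhds hy)
    exact ((ContinuousAt.comp (g := μ) (f := fun t => B t * y ^ 2 - 2 * l * y - S t) h1 (hκ y)).mul (hN y)).sub hA
  have hk0 : 0 ≤ B θ * Y θ ^ 2 - 2 * l * Y θ - S θ := h.drift ▸ h.nonneg
  -- Y is trapped between fixed test points: the sign of the first-order condition at a test point
  -- persists for nearby parameters, and monotonicity in y puts Y t on the right side of it.
  refine tendsto_order.2 ⟨fun a ha => ?_, fun a ha => ?_⟩
  · have hev : ∀ᶠ y in 𝓝 (Y θ), 0 < B θ * y ^ 2 - 2 * l * y - S θ := by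
      have : ContinuousAt (fun y => B θ * y ^ 2 - 2 * l * y - S θ) (Y θ) := by fun_prop
      exact this.eventually_const_lt (by simpa only [h.drift] using hK)
    -- The lower test point must be close to Y θ, so that the rate there is still positive and μ is
    -- continuous at it. This is where K θ > 0 is needed.
    obtain ⟨y, ⟨⟨hyκ, hya⟩, hy0⟩, hyY⟩ := (((hev.and (eventually_gt_nhds ha)).and
      (eventually_gt_nhds h.pos)).filter_mono nhdsWithin_le_nhds |>.and
        (self_mem_nhdsWithin : Iio (Y θ) ∈ 𝓝[<] (Y θ))).exists
    have hyY' : y < Y θ := hyY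
    have hneg : μ (B θ * y ^ 2 - 2 * l * y - S θ) * (y ^ 2 * (2 * B θ * y + d - 2 * l)) - A θ
        < 0 := by
      rw [← h.eq hK]
      have h1 := drift_strictMono hl hS0 hy0 hyκ.le hyY'
      rw [h.drift] at h1
      have h2 := hμ hyκ.le h.nonneg h1
      have h3 := weight_mono hl hd hS0 hy0 hyκ.le hyY'.le le_rfl
      have h4 := weight_pos hl hd hS0 hy0 hyκ.le
      have h5 := h.marginal_pos hl hd hS0 hA0
      nlinarith
    filter_upwards [hst, (hκ y).eventually_const_lt hyκ, (hF y hyκ).eventually_lt_const hneg,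
      hS.eventually_const_lt hS0, hA.eventually_const_lt hA0] with t h1 h2 h3 h4 h5
    refine hya.trans ?_
    by_contra! hle
    have h6 := drift_mono hl h4 h1.pos (h1.drift ▸ h1.nonneg) hle le_rfl le_rfl
    rw [h1.drift] at h6
    have h7 := hμ.monotoneOn h1.nonneg h2.le h6
    have h8 := weight_mono hl hd h4 h1.pos (h1.drift ▸ h1.nonneg) hle (le_refl (B t))
    have h9 := h1.weight_pos' hl hd h4
    have h10 := h1.le
    have h11 := h1.marginal_pos hl hd h4 h5
    have := mul_le_mul h7 h8 h9.le (h11.le.trans h7)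
    linarith
  · have hyκ : 0 < B θ * a ^ 2 - 2 * l * a - S θ :=
      hk0.trans_lt (drift_strictMono hl hS0 h.pos hk0 ha)
    have ha0 : 0 < a := h.pos.trans ha
    have hpos : 0 < μ (B θ * a ^ 2 - 2 * l * a - S θ) * (a ^ 2 * (2 * B θ * a + d - 2 * l))
        - A θ := by
      rw [← h.eq hK]
      have h1 := drift_strictMono hl hS0 h.pos hk0 ha
      rw [h.drift] at h1
      have h2 := hμ h.nonneg hyκ.le h1
      have h3 := weight_mono hl hd hS0 h.pos hk0 ha.le (le_refl (B θ))
      have h4 := h.weight_pos' hl hd hS0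
      have h5 := h.marginal_pos hl hd hS0 hA0
      nlinarith
    filter_upwards [hst, (hκ a).eventually_const_lt hyκ, (hF a hyκ).eventually_const_lt hpos,
      hS.eventually_const_lt hS0, hA.eventually_const_lt hA0] with t h1 h2 h3 h4 h5
    by_contra! hle
    have h6 := drift_mono hl h4 ha0 h2.le hle le_rfl le_rfl
    rw [h1.drift] at h6
    have h7 := hμ.monotoneOn h2.le h1.nonneg h6
    have h8 := weight_mono hl hd h4 ha0 h2.le hle (le_refl (B t))
    have h9 := weight_pos hl hd h4 ha0 h2.le
    have h10 := h1.eq (h2.trans_le h6)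
    have h11 := h1.marginal_pos hl hd h4 h5
    have := mul_le_mul h7 h8 h9.le h11.le
    linarith

lemma hasDerivAt_drift (b l s y : ℝ) :
    HasDerivAt (fun y => b * y ^ 2 - 2 * l * y - s) (2 * (b * y) - 2 * l) y := by
  have := (((hasDerivAt_pow 2 y).const_mul b).sub ((hasDerivAt_id' y).const_mul (2 * l))).sub_const s
  refine this.congr_deriv ?_
  push_cast
  ring

lemma differentiableAt_drift {y : ℝ} (hS : DifferentiableAt ℝ S θ) (hB : DifferentiableAt ℝ B θ) :
    DifferentiableAt ℝ (fun p : ℝ × ℝ => B p.2 * p.1 ^ 2 - 2 * l * p.1 - S p.2) (y, θ) := by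
  have hBd : DifferentiableAt ℝ (fun p : ℝ × ℝ => B p.2) (y, θ) :=
    DifferentiableAt.comp (y, θ) (g := B) hB differentiableAt_snd
  have hSd : DifferentiableAt ℝ (fun p : ℝ × ℝ => S p.2) (y, θ) :=
    DifferentiableAt.comp (y, θ) (g := S) hS differentiableAt_snd
  fun_prop

lemma exists_hasDerivAt_of_drift_eq_zero {s₁ b₁ : ℝ} (hl : 0 ≤ l)
    (hY : ContinuousAt Y θ) (hY0 : 0 < Y θ)
    (hst : ∀ᶠ t in 𝓝 θ, B t * Y t ^ 2 - 2 * l * Y t - S t = 0)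
    (hS : HasDerivAt S s₁ θ) (hB : HasDerivAt B b₁ θ) (hS0 : 0 < S θ) :
    ∃ y₁, HasDerivAt Y y₁ θ ∧ Y θ ^ 2 * b₁ - s₁ + (2 * (B θ * Y θ) - 2 * l) * y₁ = 0 := by
  have h := hst.self_of_nhds
  have hW := two_mul_lt hS0 hY0 h.ge
  obtain ⟨y₁, hd⟩ := exists_hasDerivAt_of_implicit
    (differentiableAt_drift (l := l) hS.differentiableAt hB.differentiableAt)
    (hasDerivAt_drift (B θ) l (S θ) (Y θ)) (by linarith) hY hst
  refine ⟨y₁, hd, ?_⟩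
  have h1 := (((hB.mul (hd.pow 2)).sub (hd.const_mul (2 * l))).sub hS)
  have h2 := (h1.congr_of_eventuallyEq (f₁ := fun _ => 0)
    (by filter_upwards [hst] with t ht; simpa using ht.symm)).unique (hasDerivAt_const θ (0 : ℝ))
  simp only [Pi.pow_apply] at h2
  push_cast at h2
  linear_combination h2

/-- A positive rate stays positive nearby, so the first-order condition holds with equality and can
be differentiated. Its partial derivative in y is a sum of positive terms. The last two equations
are the linearized drift and first-order conditions, from which signs are read off. -/
lemma exists_hasDerivAt_of_pos {s₁ b₁ a₁ m₁ : ℝ}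
    (hst : ∀ᶠ t in 𝓝 θ, PrecisionSteady μ l d (S t) (B t) (A t) (Y t) (K t))
    (hμ : StrictMonoOn μ (Ici 0)) (hμc : ContinuousOn μ (Ici 0)) (hl : 0 ≤ l) (hd : 0 < d)
    (hS : HasDerivAt S s₁ θ) (hB : HasDerivAt B b₁ θ) (hA : HasDerivAt A a₁ θ)
    (hS0 : 0 < S θ) (hA0 : 0 < A θ) (hK : 0 < K θ) (hm : HasDerivAt μ m₁ (K θ)) (hm₁ : 0 < m₁) :
    ∃ y₁ k₁, HasDerivAt Y y₁ θ ∧ HasDerivAt K k₁ θ ∧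
      k₁ = Y θ ^ 2 * b₁ - s₁ + (2 * (B θ * Y θ) - 2 * l) * y₁ ∧
      m₁ * k₁ * (Y θ ^ 2 * (2 * B θ * Y θ + d - 2 * l)) + μ (K θ) *
        (2 * Y θ ^ 3 * b₁ + (6 * B θ * Y θ ^ 2 + 2 * (d - 2 * l) * Y θ) * y₁) = a₁ := by
  have h := hst.self_of_nhds
  have hY0 := h.pos
  have hW := two_mul_lt hS0 hY0 (h.drift ▸ h.nonneg)
  have hN0 := h.weight_pos' hl hd hS0
  have hμ0 := h.marginal_pos hl hd hS0 hA0
  have hY := continuousAt_curve hst hμ hμc hl hd hS.continuousAt hB.continuousAt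
    hA.continuousAt hS0 hA0 hK
  have hKe : K =ᶠ[𝓝 θ] fun t => B t * Y t ^ 2 - 2 * l * Y t - S t := by
    filter_upwards [hst] with t ht using ht.drift.symm
  have hKpos : ∀ᶠ t in 𝓝 θ, 0 < K t := by
    have hBc := hB.continuousAt
    have hSc := hS.continuousAt
    have hc : ContinuousAt (fun t => B t * Y t ^ 2 - 2 * l * Y t - S t) θ := by fun_prop
    filter_upwards [hKe, hc.eventually_const_lt (h.drift ▸ hK)] with t h1 h2
    rw [h1]
    exact h2
  have hκ0 : B θ * Y θ ^ 2 - 2 * l * Y θ - S θ = K θ := h.drift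
  have hBd : DifferentiableAt ℝ (fun p : ℝ × ℝ => B p.2) (Y θ, θ) :=
    DifferentiableAt.comp (Y θ, θ) (g := B) hB.differentiableAt differentiableAt_snd
  have hAd : DifferentiableAt ℝ (fun p : ℝ × ℝ => A p.2) (Y θ, θ) :=
    DifferentiableAt.comp (Y θ, θ) (g := A) hA.differentiableAt differentiableAt_snd
  have hμd : DifferentiableAt ℝ
      (fun p : ℝ × ℝ => μ (B p.2 * p.1 ^ 2 - 2 * l * p.1 - S p.2)) (Y θ, θ) :=
    DifferentiableAt.comp (Y θ, θ) (g := μ) (by simpa only [hκ0] using hm.differentiableAt)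
      (differentiableAt_drift hS.differentiableAt hB.differentiableAt)
  have hG : DifferentiableAt ℝ (fun p : ℝ × ℝ => μ (B p.2 * p.1 ^ 2 - 2 * l * p.1 - S p.2) *
      (p.1 ^ 2 * (2 * B p.2 * p.1 + d - 2 * l)) - A p.2) (Y θ, θ) :=
    (hμd.mul ((differentiableAt_fst.pow 2).mul
      ((((hBd.const_mul 2).mul differentiableAt_fst).add_const d).sub_const (2 * l)))).sub hAd
  have hμline : HasDerivAt (fun y => μ (B θ * y ^ 2 - 2 * l * y - S θ))
      (m₁ * (2 * (B θ * Y θ) - 2 * l)) (Y θ) :=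
    HasDerivAt.comp (h₂ := μ) (Y θ) (by rw [hκ0]; exact hm) (hasDerivAt_drift _ _ _ _)
  have hNline : HasDerivAt (fun y => y ^ 2 * (2 * B θ * y + d - 2 * l))
      (6 * B θ * Y θ ^ 2 + 2 * (d - 2 * l) * Y θ) (Y θ) := by
    have := (hasDerivAt_pow 2 (Y θ)).mul
      ((((hasDerivAt_id (Y θ)).const_mul (2 * B θ)).add_const d).sub_const (2 * l))
    refine this.congr_deriv ?_
    simp
    ring
  have hline := (hμline.mul hNline).sub_const (A θ)
  obtain ⟨y₁, hd1⟩ := exists_hasDerivAt_of_implicit hG hline (by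
    have h1 : 0 < 2 * (B θ * Y θ) - 2 * l := by linarith
    have h2 : 0 < 6 * B θ * Y θ ^ 2 + 2 * (d - 2 * l) * Y θ := by
      have : 6 * B θ * Y θ ^ 2 + 2 * (d - 2 * l) * Y θ
        = (2 * (B θ * Y θ - 2 * l) + 4 * (B θ * Y θ) + 2 * d) * Y θ := by ring
      rw [this]
      have : 0 < 2 * (B θ * Y θ - 2 * l) + 4 * (B θ * Y θ) + 2 * d := by linarith
      positivity
    rw [hκ0]
    positivity) hY (by
    filter_upwards [hst, hKpos] with t h1 h2
    rw [h1.drift, h1.eq h2, sub_self])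
  have hdK := (((hB.mul (hd1.pow 2)).sub (hd1.const_mul (2 * l))).sub hS).congr_of_eventuallyEq hKe
  refine ⟨_, _, hd1, hdK, ?_, ?_⟩
  · simp only [Pi.pow_apply]
    push_cast
    ring
  · have h1 := (hm.comp θ hdK).mul ((hd1.pow 2).mul
      ((((hB.const_mul 2).mul hd1).add_const d).sub_const (2 * l)))
    have h2 := (h1.congr_of_eventuallyEq (f₁ := A)
      (by filter_upwards [hst, hKpos] with t h1 h2; simpa using (h1.eq h2).symm)).unique hA
    simp only [Pi.pow_apply, Pi.mul_apply, Function.comp] at h2 ⊢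
    rw [← h2]
    push_cast
    ring

/-- The difference of the two sides is 2y(by + d). -/
lemma weight_deriv_pos {b y s : ℝ} (hl : 0 ≤ l) (hd : 0 < d) (hs : 0 < s) (hy : 0 < y)
    (hk : 0 ≤ b * y ^ 2 - 2 * l * y - s) :
    2 * y * (2 * (b * y) - 2 * l) < 6 * b * y ^ 2 + 2 * (d - 2 * l) * y := by
  have := two_mul_lt hs hy hk
  have h1 : 0 < (b * y + d) * y := mul_pos (by linarith) hy
  nlinarith

/-- Signs of the derivatives when the drift of the precision falls with the parameter. -/
lemma exists_hasDerivAt_volatility {s₁ b₁ m₁ a : ℝ}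
    (hst : ∀ᶠ t in 𝓝 θ, PrecisionSteady μ l d (S t) (B t) a (Y t) (K t))
    (hμ : StrictMonoOn μ (Ici 0)) (hμc : ContinuousOn μ (Ici 0)) (hl : 0 ≤ l) (hd : 0 < d)
    (hS : HasDerivAt S s₁ θ) (hB : HasDerivAt B b₁ θ) (hs₁ : s₁ ≤ 0) (hb₁ : 0 ≤ b₁)
    (hne : 0 < b₁ ∨ s₁ < 0)
    (hS0 : 0 < S θ) (hA0 : 0 < a) (hK : 0 < K θ) (hm : HasDerivAt μ m₁ (K θ)) (hm₁ : 0 < m₁) :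
    ∃ y₁ k₁, HasDerivAt Y y₁ θ ∧ HasDerivAt K k₁ θ ∧ y₁ < 0 ∧ 0 < k₁ := by
  obtain ⟨y₁, k₁, h1, h2, h3, h4⟩ := exists_hasDerivAt_of_pos hst hμ hμc hl hd hS hB
    (hasDerivAt_const θ a) hS0 hA0 hK hm hm₁
  refine ⟨y₁, k₁, h1, h2, ?_⟩
  have h := hst.self_of_nhds
  have hY := h.pos
  have hk := (h.drift ▸ h.nonneg : 0 ≤ B θ * Y θ ^ 2 - 2 * l * Y θ - S θ)
  have hW := two_mul_lt hS0 hY hk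
  have hM := weight_deriv_pos hl hd hS0 hY hk
  have hN := h.weight_pos' hl hd hS0
  have hμ0 := h.marginal_pos hl hd hS0 hA0
  set W := 2 * (B θ * Y θ) - 2 * l with hWdef
  set M := 6 * B θ * Y θ ^ 2 + 2 * (d - 2 * l) * Y θ
  set N := Y θ ^ 2 * (2 * B θ * Y θ + d - 2 * l)
  have hW0 : 0 < W := by linarith
  have hM0 : 0 < M := lt_trans (by positivity) hM
  have hb : 0 < Y θ ^ 2 * b₁ - s₁ := by
    rcases hne with h5 | h5
    · have : 0 < Y θ ^ 2 * b₁ := by positivity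
      linarith
    · have : 0 ≤ Y θ ^ 2 * b₁ := by positivity
      linarith
  have hk₁ : 0 < k₁ := by
    -- If the rate did not rise, the drift equation would force y₁ < 0 so strongly that the weight
    -- falls as well; then the linearized first-order condition could not vanish.
    by_contra! hneg
    have h5 : W * y₁ ≤ -(Y θ ^ 2 * b₁ - s₁) := by linarith
    have hy₁ : y₁ < 0 := by
      by_contra! h6
      have := mul_nonneg hW0.le h6
      linarith
    have h6 : 2 * Y θ ^ 3 * b₁ + M * y₁ < 0 := by
      have h7 : M * y₁ < 2 * Y θ * W * y₁ := mul_lt_mul_of_neg_right hM hy₁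
      have h8 := mul_le_mul_of_nonneg_left h5 (by positivity : 0 ≤ 2 * Y θ)
      have h9 : 0 ≤ Y θ * -s₁ := mul_nonneg hY.le (by linarith)
      nlinarith
    have h7 := mul_neg_of_pos_of_neg hμ0 h6
    have h8 : m₁ * k₁ * N ≤ 0 :=
      mul_nonpos_of_nonpos_of_nonneg (mul_nonpos_of_nonneg_of_nonpos hm₁.le hneg) hN.le
    linarith
  refine ⟨?_, hk₁⟩
  by_contra! hy₁
  have h5 : 0 < m₁ * k₁ * N := by positivity
  have h6 : 0 ≤ μ (K θ) * (2 * Y θ ^ 3 * b₁ + M * y₁) := by positivity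
  linarith

/-- Signs of the derivatives when the state cost varies with the parameter. -/
lemma exists_hasDerivAt_stateCost {s b a₁ m₁ : ℝ}
    (hst : ∀ᶠ t in 𝓝 θ, PrecisionSteady μ l d s b (A t) (Y t) (K t))
    (hμ : StrictMonoOn μ (Ici 0)) (hμc : ContinuousOn μ (Ici 0)) (hl : 0 ≤ l) (hd : 0 < d)
    (hA : HasDerivAt A a₁ θ)
    (hS0 : 0 < s) (hA0 : 0 < A θ) (hK : 0 < K θ) (hm : HasDerivAt μ m₁ (K θ)) (hm₁ : 0 < m₁) :
    ∃ y₁ r, HasDerivAt Y y₁ θ ∧ HasDerivAt K ((2 * (b * Y θ) - 2 * l) * y₁) θ ∧ 0 < r ∧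
      r * y₁ = a₁ := by
  obtain ⟨y₁, k₁, h1, h2, h3, h4⟩ := exists_hasDerivAt_of_pos hst hμ hμc hl hd
    (hasDerivAt_const θ s) (hasDerivAt_const θ b) hA hS0 hA0 hK hm hm₁
  have h := hst.self_of_nhds
  have hY := h.pos
  have hk := (h.drift ▸ h.nonneg : 0 ≤ b * Y θ ^ 2 - 2 * l * Y θ - s)
  have hW := two_mul_lt hS0 hY hk
  have hM := weight_deriv_pos hl hd hS0 hY hk
  have hN := h.weight_pos' hl hd hS0
  have hμ0 := h.marginal_pos hl hd hS0 hA0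
  have hW0 : 0 < 2 * (b * Y θ) - 2 * l := by linarith
  have hM0 : 0 < 6 * b * Y θ ^ 2 + 2 * (d - 2 * l) * Y θ := lt_trans (by positivity) hM
  have h3' : k₁ = (2 * (b * Y θ) - 2 * l) * y₁ := by rw [h3]; ring
  refine ⟨y₁, m₁ * (2 * (b * Y θ) - 2 * l) * (Y θ ^ 2 * (2 * b * Y θ + d - 2 * l)) +
    μ (K θ) * (6 * b * Y θ ^ 2 + 2 * (d - 2 * l) * Y θ), h1, h3' ▸ h2, by positivity, ?_⟩
  rw [← h4, h3']
  ring

/-- Without information acquisition, the steady state is locally that of the uncontrolled state. -/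
lemma eventually_of_lt (hY : ContinuousAt Y θ) (hY0 : ∀ᶠ t in 𝓝 θ, 0 < Y t)
    (hB : ContinuousAt B θ) (hA : ContinuousAt A θ)
    (hst : ∀ᶠ t in 𝓝 θ, B t * Y t ^ 2 - 2 * l * Y t - S t = 0)
    (hlt : A θ < μ 0 * (Y θ ^ 2 * (2 * B θ * Y θ + d - 2 * l))) :
    ∀ᶠ t in 𝓝 θ, PrecisionSteady μ l d (S t) (B t) (A t) (Y t) 0 := by
  have hc : ContinuousAt (fun t => μ 0 * (Y t ^ 2 * (2 * B t * Y t + d - 2 * l))) θ := by fun_prop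
  filter_upwards [hY0, hst, hA.eventually_lt hc hlt] with t h1 h2 h3
  exact ⟨h1, le_rfl, h2, h3.le, fun h => absurd h (lt_irrefl _)⟩

end PrecisionSteady
end

/-! ### Back to the original parameters; dependence on the volatilities -/

noncomputable section
namespace Params

variable {P : Params} {g : ℝ} {y k : ℝ}

/-- Steady states in terms of the precision, with the data of the parameters `P`. -/
abbrev IsPrecisionSteady (P : Params) (y k : ℝ) : Prop :=
  PrecisionSteady P.dc P.lam P.delta ((1 / P.sigma1) ^ 2) (P.sigma2 ^ 2) P.abar y k

lemma Valid.sigma1_inv_sq_pos (hP : P.Valid) : 0 < (1 / P.sigma1) ^ 2 :=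
  pow_pos (one_div_pos.2 hP.sigma1_pos) 2

lemma f_inv (hy : 0 < y) (k : ℝ) : P.f y⁻¹ k =
    (P.sigma2 ^ 2 * y ^ 2 - 2 * P.lam * y - (1 / P.sigma1) ^ 2 - k) / y ^ 2 := by
  simp only [f]
  generalize (1 / P.sigma1) ^ 2 = S
  field_simp
  ring

/-- At zero drift (σ₁⁻² + k)/y = σ₂²y − 2λ, which removes k from the denominator. The first-order
condition becomes a product condition in y. -/
lemma inv_sq_mul_adjoint (hP : P.Valid) (hy : 0 < y) (hk : 0 ≤ k)
    (hf : P.sigma2 ^ 2 * y ^ 2 - 2 * P.lam * y - (1 / P.sigma1) ^ 2 = k) :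
    y⁻¹ ^ 2 * P.adjoint y⁻¹ k
      = P.abar / (y ^ 2 * (2 * P.sigma2 ^ 2 * y + P.delta - 2 * P.lam)) := by
  have hD := IsSteady.denom_pos hP (inv_pos.2 hy).le hk
  unfold adjoint
  have h1 : 2 * ((1 / P.sigma1) ^ 2 + k) * y⁻¹ + 2 * P.lam + P.delta
      = 2 * P.sigma2 ^ 2 * y + P.delta - 2 * P.lam := by
    rw [← hf]
    field_simp
    ring
  rw [h1] at hD ⊢
  rw [inv_pow]
  field_simp

lemma IsPrecisionSteady.isSteady (h : P.IsPrecisionSteady y k) (hP : P.Valid) :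
    P.IsSteady y⁻¹ k := by
  have hN := h.weight_pos' hP.lam_nonneg hP.delta_pos hP.sigma1_inv_sq_pos
  have hz := inv_sq_mul_adjoint hP h.pos h.nonneg h.drift
  refine ⟨inv_pos.2 h.pos, h.nonneg, ?_, ?_, fun hk => ?_⟩
  · rw [f_inv h.pos, h.drift, sub_self, zero_div]
  · rw [hz, div_le_iff₀ hN]
    exact h.le
  · rw [hz, eq_div_iff hN.ne']
    exact h.eq hk

lemma drift_gammaInf_inv (hP : P.Valid) :
    P.sigma2 ^ 2 * P.gammaInf⁻¹ ^ 2 - 2 * P.lam * P.gammaInf⁻¹ - (1 / P.sigma1) ^ 2 = 0 := by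
  have h := f_gammaInf hP
  have h0 := inv_pos.2 (gammaInf_pos hP)
  rw [← inv_inv P.gammaInf, f_inv h0, div_eq_zero_iff] at h
  rcases h with h | h
  · linarith
  · exact absurd h (pow_pos h0 2).ne'

lemma exists_isPrecisionSteady (hP : P.Valid) : ∃ y k, P.IsPrecisionSteady y k :=
  PrecisionSteady.exists_steady hP.cost.continuousOn_marginal hP.cost.marginal_tendsto
    hP.lam_nonneg hP.delta_pos hP.sigma1_inv_sq_pos hP.abar_pos (inv_pos.2 (gammaInf_pos hP))
    (drift_gammaInf_inv hP)

lemma IsPrecisionSteady.gammaEq_eq (h : P.IsPrecisionSteady y k) (hP : P.Valid)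
    (hg : P.gammaInf < g) : P.gammaEq g = y⁻¹ ∧ P.hEq g = k :=
  ⟨(h.isSteady hP).gammaEq_eq hP hg, (h.isSteady hP).hEq_eq hP hg⟩

lemma isPrecisionSteady_gammaEq (hP : P.Valid) (hg : P.gammaInf < g) :
    P.IsPrecisionSteady (P.gammaEq g)⁻¹ (P.hEq g) := by
  obtain ⟨y, k, h⟩ := exists_isPrecisionSteady hP
  obtain ⟨h1, h2⟩ := h.gammaEq_eq hP hg
  rwa [h1, h2, inv_inv]

lemma isSteady_gammaEq (hP : P.Valid) (hg : P.gammaInf < g) :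
    P.IsSteady (P.gammaEq g) (P.hEq g) := by
  simpa using (isPrecisionSteady_gammaEq hP hg).isSteady hP

/-- The equilibrium exists, is unique, and solves the state-adjoint equilibrium system. -/
theorem equilibrium (hP : P.Valid) (hg : P.gammaInf < g) :
    P.gammaEq g ∈ Ioc 0 P.gammaInf ∧
    (∀ γ ∈ Icc 0 g, P.f γ (P.feedback g γ) = 0 ↔ γ = P.gammaEq g) ∧
    DifferentiableAt ℝ (P.v g) (P.gammaEq g) ∧
    (∀ γ p : ℝ, 0 ≤ γ → (P.Phi g γ p = 0 ↔ γ = P.gammaEq g ∧ p = P.pEq g)) := by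
  have hs := isSteady_gammaEq hP hg
  refine ⟨⟨hs.pos, hs.le_gammaInf hP⟩, fun γ hγ => hs.root_iff hP hg hγ,
    differentiableAt_v hP hs.pos, fun γ p hγ => ⟨fun h => ?_, ?_⟩⟩
  · obtain ⟨h1, h2⟩ := isSteady_of_Phi_eq_zero hP hg hγ h
    exact ⟨(h1.gammaEq_eq hP hg).symm, by rw [h1.pEq_eq hP hg, ← h2]⟩
  · rintro ⟨rfl, rfl⟩
    have hk : P.hhat g (P.gammaEq g ^ 2 * P.pEq g) = P.hEq g := by
      rw [hs.pEq_eq hP hg, hs.hhat_eq hP hg]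
    refine Prod.ext ?_ ?_
    · change P.f (P.gammaEq g) (P.hhat g (P.gammaEq g ^ 2 * P.pEq g)) = 0
      rw [hk, hs.drift]
    · change (2 * ((1 / P.sigma1) ^ 2 + P.hhat g (P.gammaEq g ^ 2 * P.pEq g)) * P.gammaEq g
        + 2 * P.lam + P.delta) * P.pEq g - P.abar = 0
      rw [hk, hs.pEq_eq hP hg, adjoint, mul_div_cancel₀, sub_self]
      exact (IsSteady.denom_pos hP hs.pos.le hs.nonneg).ne'

/-- A positive rate would have marginal cost γ²p < c'(0), against monotonicity of c'. With rate 0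
the drift has the single positive zero γ⁰∞. The strict inequality is kept because it persists for
nearby parameters. -/
lemma IsInactive.spec (hi : P.IsInactive g) (hP : P.Valid) (hg : P.gammaInf < g) :
    P.hEq g = 0 ∧ P.gammaEq g = P.gammaInf ∧
    P.abar < P.dc 0 * (P.gammaInf⁻¹ ^ 2 *
      (2 * P.sigma2 ^ 2 * P.gammaInf⁻¹ + P.delta - 2 * P.lam)) := by
  have hs := isSteady_gammaEq hP hg
  have h0 : P.hEq g = 0 := by
    by_contra hne
    have hpos : 0 < P.hEq g := lt_of_le_of_ne hs.nonneg (Ne.symm hne)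
    have h1 := hs.marginal_eq hpos
    rw [IsInactive, hs.pEq_eq hP hg, ← h1] at hi
    exact absurd (hP.cost.strictMonoOn_marginal self_mem_Ici hs.nonneg hpos) (not_lt.2 hi.le)
  have hγ : P.gammaEq g = P.gammaInf := by
    refine (hs.le_gammaInf hP).antisymm ?_
    by_contra! hlt
    have h1 := f_lt_f hP hs.pos.le hlt le_rfl le_rfl
    have h2 := hs.drift
    rw [h0] at h2
    rw [h2, f_gammaInf hP] at h1
    exact lt_irrefl _ h1
  refine ⟨h0, hγ, ?_⟩
  have hy := inv_pos.2 (gammaInf_pos hP)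
  have hN := PrecisionSteady.weight_pos hP.lam_nonneg hP.delta_pos hP.sigma1_inv_sq_pos hy
    (drift_gammaInf_inv hP).ge
  rw [IsInactive, hs.pEq_eq hP hg, h0, hγ] at hi
  have := inv_sq_mul_adjoint hP hy le_rfl (drift_gammaInf_inv hP)
  rw [inv_inv] at this
  rwa [this, div_lt_iff₀ hN] at hi

lemma hasDerivAt_dc (hk : 0 < k) (hd : 0 < P.ddc k) : HasDerivAt P.dc (P.ddc k) k :=
  (differentiableWithinAt_of_derivWithin_ne_zero hd.ne').hasDerivWithinAt.hasDerivAt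
    (Ici_mem_nhds hk)

lemma hasDerivAt_c (hP : P.Valid) (hk : 0 < k) : HasDerivAt P.c (P.dc k) k :=
  (hP.cost.differentiableOn k hk.le).hasDerivWithinAt.hasDerivAt (Ici_mem_nhds hk)

lemma vEq_eq (hP : P.Valid) (hg : P.gammaInf < g) :
    P.vEq g = (P.abar * P.gammaEq g + P.c (P.hEq g)) / P.delta :=
  (isSteady_gammaEq hP hg).vEq_eq hP hg

/-- Comparative statics for a family of parameters along which the drift coefficients of the
precision vary. -/
theorem increasingInVolatility {Q : ℝ → Params} {G S B : ℝ → ℝ}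
    (hP : P.Valid) (hQ : ∀ t, 0 < t → (Q t).Valid) (hG : ∀ t, 0 < t → (Q t).gammaInf < G t)
    (hdc : ∀ t, (Q t).c = P.c) (hlam : ∀ t, (Q t).lam = P.lam) (hdel : ∀ t, (Q t).delta = P.delta)
    (habar : ∀ t, (Q t).abar = P.abar) (hS : ∀ t, (1 / (Q t).sigma1) ^ 2 = S t)
    (hB : ∀ t, (Q t).sigma2 ^ 2 = B t)
    (hmono : ∀ s t, 0 < s → s < t → B s ≤ B t ∧ S t ≤ S s ∧ (B s < B t ∨ S t < S s))
    (hder : ∀ t, 0 < t → ∃ s₁ b₁, HasDerivAt S s₁ t ∧ HasDerivAt B b₁ t ∧ s₁ ≤ 0 ∧ 0 ≤ b₁ ∧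
      (0 < b₁ ∨ s₁ < 0))
    (hinf : ∀ t, 0 < t → ContinuousAt (fun t => (Q t).gammaInf) t) :
    IncreasingInVolatility Q G := by
  have hμ : ∀ t, (Q t).dc = P.dc := fun t => by
    funext k
    simp only [dc, hdc]
  have hst : ∀ t, 0 < t → PrecisionSteady P.dc P.lam P.delta (S t) (B t) P.abar
      ((Q t).gammaEq (G t))⁻¹ ((Q t).hEq (G t)) := fun t ht => by
    have := isPrecisionSteady_gammaEq (hQ t ht) (hG t ht)
    rwa [IsPrecisionSteady, hμ, hlam, hdel, habar, hS, hB] at this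
  have hS0 : ∀ t, 0 < t → 0 < S t := fun t ht => hS t ▸ (hQ t ht).sigma1_inv_sq_pos
  have hv : ∀ t, 0 < t → (Q t).vEq (G t)
      = (P.abar * (Q t).gammaEq (G t) + P.c ((Q t).hEq (G t))) / P.delta := fun t ht => by
    rw [vEq_eq (hQ t ht) (hG t ht), habar, hdc, hdel]
  have hγ0 : ∀ t, 0 < t → 0 < (Q t).gammaEq (G t) := fun t ht => inv_pos.1 (hst t ht).pos
  have hl := hP.lam_nonneg
  have hd := hP.delta_pos
  have hA := hP.abar_pos
  have hmon := hP.cost.strictMonoOn_marginal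
  have hcmp : ∀ s t, 0 < s → s < t → (Q s).gammaEq (G s) < (Q t).gammaEq (G t) ∧
      ((Q s).hEq (G s) = 0 ∨ (Q s).hEq (G s) < (Q t).hEq (G t)) := fun s t hs hst' => by
    have ht := hs.trans hst'
    obtain ⟨h1, h2, h3⟩ := hmono s t hs hst'
    obtain ⟨h4, h5⟩ := (hst s hs).mono_volatility (hst t ht) hmon hl hd (hS0 s hs) (hS0 t ht) hA
      h1 h2 h3
    exact ⟨(inv_lt_inv₀ (hγ0 t ht) (hγ0 s hs)).1 h4, h5⟩
  have hkle : ∀ s t, 0 < s → s < t → (Q s).hEq (G s) ≤ (Q t).hEq (G t) := fun s t hs hst' => by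
    rcases (hcmp s t hs hst').2 with h | h
    · rw [h]
      exact (hst t (hs.trans hst')).nonneg
    · exact h.le
  refine ⟨fun s hs t _ hlt => (hcmp s t hs hlt).1, fun s hs t ht hle => ?_,
    fun s t hs hlt hpos => ?_, fun s hs t ht hlt => ?_, fun s hs hact => ?_, fun s hs hin => ?_⟩
  · rcases hle.eq_or_lt with rfl | hlt
    · exact le_rfl
    · exact hkle s t hs hlt
  · rcases (hcmp s t hs hlt).2 with h | h
    · rwa [h]
    · exact h
  · simp only
    rw [hv s hs, hv t ht]
    have h1 := mul_lt_mul_of_pos_left (hcmp s t hs hlt).1 hA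
    have h2 := hP.cost.strictMono.monotoneOn (hst s hs).nonneg (hst t ht).nonneg (hkle s t hs hlt)
    exact div_lt_div_of_pos_right (by linarith) hd
  · obtain ⟨hk, hdd⟩ := hact
    obtain ⟨s₁, b₁, h1, h2, h3, h4, h5⟩ := hder s hs
    have hdd' : 0 < P.ddc ((Q s).hEq (G s)) := by
      rwa [ddc, hμ] at hdd
    obtain ⟨y₁, k₁, hy, hk', hy₁, hk₁⟩ := PrecisionSteady.exists_hasDerivAt_volatility
      (by filter_upwards [eventually_gt_nhds hs] with t ht using hst t ht) hmon
      hP.cost.continuousOn_marginal hl hd h1 h2 h3 h4 h5 (hS0 s hs) hA hk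
      (hasDerivAt_dc hk hdd') hdd'
    have hγ := hy.fun_inv (hst s hs).pos.ne'
    simp only [inv_inv] at hγ
    have hγ₁ : 0 < -y₁ / ((Q s).gammaEq (G s))⁻¹ ^ 2 :=
      div_pos (by linarith) (pow_pos (hst s hs).pos 2)
    have hμ0 := (hst s hs).marginal_pos hl hd (hS0 s hs) hA
    refine ⟨_, k₁, _, hγ, hk', HasDerivAt.congr_of_eventuallyEq
      (((hγ.const_mul P.abar).add ((hasDerivAt_c hP hk).comp s hk')).div_const P.delta)
      (by filter_upwards [eventually_gt_nhds hs] with t ht using hv t ht), hγ₁, hk₁, by positivity⟩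
  · obtain ⟨hk0, hγinf, hlt⟩ := hin.spec (hQ s hs) (hG s hs)
    obtain ⟨s₁, b₁, h1, h2, h3, h4, h5⟩ := hder s hs
    rw [hμ, hlam, hdel, habar, hB] at hlt
    have hdrift : ∀ᶠ t in 𝓝 s, B t * (Q t).gammaInf⁻¹ ^ 2 - 2 * P.lam * (Q t).gammaInf⁻¹ - S t
        = 0 := by
      filter_upwards [eventually_gt_nhds hs] with t ht
      have := drift_gammaInf_inv (hQ t ht)
      rwa [hlam, hS, hB] at this
    have hinfpos := gammaInf_pos (hQ s hs)
    have hYc : ContinuousAt (fun t => (Q t).gammaInf⁻¹) s := (hinf s hs).inv₀ hinfpos.ne'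
    -- The rate 0 remains optimal at the uncontrolled precision for nearby parameters, and
    -- uniqueness identifies this steady state with the equilibrium.
    have hev : ∀ᶠ t in 𝓝 s, (Q t).gammaEq (G t) = (Q t).gammaInf ∧ (Q t).hEq (G t) = 0 := by
      have := PrecisionSteady.eventually_of_lt (μ := P.dc) (A := fun _ => P.abar) hYc
        (by filter_upwards [eventually_gt_nhds hs] with t ht using
          inv_pos.2 (gammaInf_pos (hQ t ht))) h2.continuousAt continuousAt_const hdrift hlt
      filter_upwards [this, eventually_gt_nhds hs] with t h6 ht
      obtain ⟨h7, h8⟩ := h6.unique (hst t ht) hmon hl hd (hS0 t ht) hA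
      exact ⟨(inv_injective h7).symm, h8.symm⟩
    obtain ⟨y₁, hy, hy₁⟩ := PrecisionSteady.exists_hasDerivAt_of_drift_eq_zero hl hYc
      (inv_pos.2 hinfpos) hdrift h1 h2 (hS0 s hs)
    have hY0 : 0 < (Q s).gammaInf⁻¹ := inv_pos.2 hinfpos
    have hW := PrecisionSteady.two_mul_lt (hS0 s hs) hY0 hdrift.self_of_nhds.ge
    have hneg : y₁ < 0 := by
      by_contra! hcon
      have h6 : 0 ≤ (2 * (B s * (Q s).gammaInf⁻¹) - 2 * P.lam) * y₁ :=
        mul_nonneg (by linarith) hcon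
      have h7 : 0 ≤ (Q s).gammaInf⁻¹ ^ 2 * b₁ := by positivity
      rcases h5 with h5 | h5
      · have : 0 < (Q s).gammaInf⁻¹ ^ 2 * b₁ := by positivity
        linarith
      · linarith
    have hγ := hy.fun_inv hY0.ne'
    simp only [inv_inv] at hγ
    have hγ' : HasDerivAt (fun t => (Q t).gammaEq (G t)) (-y₁ / (Q s).gammaInf⁻¹ ^ 2) s :=
      hγ.congr_of_eventuallyEq (hev.mono fun t ht => ht.1)
    have hγ₁ : 0 < -y₁ / (Q s).gammaInf⁻¹ ^ 2 := div_pos (by linarith) (pow_pos hY0 2)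
    refine ⟨_, _, hγ', (hasDerivAt_const s (0 : ℝ)).congr_of_eventuallyEq
      (hev.mono fun t ht => ht.2), HasDerivAt.congr_of_eventuallyEq
      (((hγ'.const_mul P.abar).add_const (P.c 0)).div_const P.delta) ?_, hγ₁, by positivity⟩
    filter_upwards [hev, eventually_gt_nhds hs] with t h6 ht
    rw [hv t ht, h6.2]

end Params
end

/-! ### Dependence on κ and on the scaling of the information cost -/

noncomputable section
namespace Params

variable {P : Params} {Γ K A : ℝ → ℝ}

/-- Stated for an arbitrary positive state cost A, so as to serve both κ, where A is ā, and α, where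
A is ā/α. -/
lemma gamma_h_compare (hP : P.Valid) (hA : ∀ t, 0 < t → 0 < A t)
    (hΓ : ∀ t, 0 < t → PrecisionSteady P.dc P.lam P.delta ((1 / P.sigma1) ^ 2) (P.sigma2 ^ 2) (A t)
      (Γ t)⁻¹ (K t)) {s t : ℝ} (hs : 0 < s) (ht : 0 < t) (hst : A s ≤ A t) :
    Γ t ≤ Γ s ∧ K s ≤ K t ∧ (A s < A t → 0 < K t → Γ t < Γ s ∧ K s < K t) := by
  obtain ⟨h1, h2, h3⟩ := (hΓ s hs).mono_stateCost (hΓ t ht) hP.cost.strictMonoOn_marginal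
    hP.lam_nonneg hP.delta_pos hP.sigma1_inv_sq_pos (hA s hs) hst
  have p1 := inv_pos.1 (hΓ s hs).pos
  have p2 := inv_pos.1 (hΓ t ht).pos
  refine ⟨(inv_le_inv₀ p1 p2).1 h1, h2, fun h4 h5 => ?_⟩
  obtain ⟨h6, h7⟩ := h3 h4 h5
  exact ⟨(inv_lt_inv₀ p1 p2).1 h6, h7⟩

lemma eventually_gammaInf (hP : P.Valid) (hA : ∀ t, 0 < t → 0 < A t)
    (hΓ : ∀ t, 0 < t → PrecisionSteady P.dc P.lam P.delta ((1 / P.sigma1) ^ 2) (P.sigma2 ^ 2) (A t)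
      (Γ t)⁻¹ (K t)) {t : ℝ} (ht : 0 < t) (hAc : ContinuousAt A t)
    (hlt : A t < P.dc 0 * (P.gammaInf⁻¹ ^ 2 *
      (2 * P.sigma2 ^ 2 * P.gammaInf⁻¹ + P.delta - 2 * P.lam))) :
    ∀ᶠ r in 𝓝 t, Γ r = P.gammaInf ∧ K r = 0 := by
  have := PrecisionSteady.eventually_of_lt (μ := P.dc) (A := A) (θ := t)
    (Y := fun _ => P.gammaInf⁻¹) (B := fun _ => P.sigma2 ^ 2) (S := fun _ => (1 / P.sigma1) ^ 2)
    continuousAt_const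
    (Eventually.of_forall fun _ => inv_pos.2 (gammaInf_pos hP)) continuousAt_const hAc
    (Eventually.of_forall fun _ => drift_gammaInf_inv hP) hlt
  filter_upwards [this, eventually_gt_nhds ht] with r h6 hr
  obtain ⟨h7, h8⟩ := h6.unique (hΓ r hr) hP.cost.strictMonoOn_marginal
    hP.lam_nonneg hP.delta_pos hP.sigma1_inv_sq_pos (hA r hr)
  exact ⟨(inv_injective h7).symm, h8.symm⟩

lemma exists_hasDerivAt_gamma_h (hP : P.Valid) (hA : ∀ t, 0 < t → 0 < A t)
    (hΓ : ∀ t, 0 < t → PrecisionSteady P.dc P.lam P.delta ((1 / P.sigma1) ^ 2) (P.sigma2 ^ 2) (A t)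
      (Γ t)⁻¹ (K t)) {t a₁ : ℝ} (ht : 0 < t) (hAd : HasDerivAt A a₁ t) (hK : 0 < K t)
    (hdd : 0 < P.ddc (K t)) :
    ∃ y₁ r, HasDerivAt Γ (-y₁ / (Γ t)⁻¹ ^ 2) t ∧
      HasDerivAt K ((2 * (P.sigma2 ^ 2 * (Γ t)⁻¹) - 2 * P.lam) * y₁) t ∧ 0 < r ∧ r * y₁ = a₁ := by
  obtain ⟨y₁, r, h1, h2, h3, h4⟩ := PrecisionSteady.exists_hasDerivAt_stateCost
    (by filter_upwards [eventually_gt_nhds ht] with s hs using hΓ s hs)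
    hP.cost.strictMonoOn_marginal hP.cost.continuousOn_marginal hP.lam_nonneg hP.delta_pos hAd
    hP.sigma1_inv_sq_pos (hA t ht) hK (hasDerivAt_dc hK hdd) hdd
  have h5 := h1.fun_inv (hΓ t ht).pos.ne'
  simp only [inv_inv] at h5
  exact ⟨y₁, r, h5, h2, h3, h4⟩

lemma Valid.withSigma1 (hP : P.Valid) {s : ℝ} (hs : 0 < s) : (P.withSigma1 s).Valid :=
  ⟨hP.delta_pos, hP.lam_nonneg, hP.kappa_pos, hP.rho_pos, hs, hP.sigma2_pos, hP.cost⟩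

lemma Valid.withSigma2 (hP : P.Valid) {s : ℝ} (hs : 0 < s) : (P.withSigma2 s).Valid :=
  ⟨hP.delta_pos, hP.lam_nonneg, hP.kappa_pos, hP.rho_pos, hP.sigma1_pos, hs, hP.cost⟩

lemma Valid.withKappa (hP : P.Valid) {s : ℝ} (hs : 0 < s) : (P.withKappa s).Valid :=
  ⟨hP.delta_pos, hP.lam_nonneg, hs, hP.rho_pos, hP.sigma1_pos, hP.sigma2_pos, hP.cost⟩

lemma Valid.scaleCost (hP : P.Valid) {α : ℝ} (hα : 0 < α) : (P.scaleCost α).Valid :=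
  ⟨hP.delta_pos, hP.lam_nonneg, hP.kappa_pos, hP.rho_pos, hP.sigma1_pos, hP.sigma2_pos,
    hP.cost.scale hα⟩

theorem increasingInVolatility_withSigma1 (hP : P.Valid) {g : ℝ → ℝ}
    (hg : ∀ s, 0 < s → (P.withSigma1 s).gammaInf < g s) :
    IncreasingInVolatility P.withSigma1 g := by
  refine increasingInVolatility (S := fun s => (1 / s) ^ 2) (B := fun _ => P.sigma2 ^ 2) hP
    (fun t ht => hP.withSigma1 ht) hg (fun _ => rfl) (fun _ => rfl) (fun _ => rfl) (fun _ => rfl)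
    (fun _ => rfl) (fun _ => rfl) (fun s t hs hst => ?_) (fun t ht => ?_) fun t _ => ?_
  · have : (1 / t) ^ 2 < (1 / s) ^ 2 := by
      have := hs.trans hst
      gcongr
    exact ⟨le_rfl, this.le, Or.inr this⟩
  · have h1 : HasDerivAt (fun s : ℝ => (1 / s) ^ 2) (((2 : ℕ) : ℝ) * (t⁻¹) ^ 1 * -(t ^ 2)⁻¹) t := by
      simpa only [one_div] using (hasDerivAt_inv ht.ne').fun_pow 2
    have h2 : ((2 : ℕ) : ℝ) * (t⁻¹) ^ 1 * -(t ^ 2)⁻¹ < 0 := by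
      have : 0 < ((2 : ℕ) : ℝ) * (t⁻¹) ^ 1 * (t ^ 2)⁻¹ := by positivity
      linarith
    exact ⟨_, 0, h1, hasDerivAt_const _ _, h2.le, le_rfl, Or.inr h2⟩
  · have : Continuous fun s => (P.withSigma1 s).gammaInf := by
      unfold gammaInf Params.withSigma1
      fun_prop
    exact this.continuousAt

theorem increasingInVolatility_withSigma2 (hP : P.Valid) {g : ℝ → ℝ}
    (hg : ∀ s, 0 < s → (P.withSigma2 s).gammaInf < g s) :
    IncreasingInVolatility P.withSigma2 g := by
  refine increasingInVolatility (S := fun _ => (1 / P.sigma1) ^ 2) (B := fun s => s ^ 2) hP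
    (fun t ht => hP.withSigma2 ht) hg (fun _ => rfl) (fun _ => rfl) (fun _ => rfl) (fun _ => rfl)
    (fun _ => rfl) (fun _ => rfl) (fun s t hs hst => ?_) (fun t ht => ?_) fun t _ => ?_
  · have : s ^ 2 < t ^ 2 := by gcongr
    exact ⟨this.le, le_rfl, Or.inl this⟩
  · have h1 := hasDerivAt_pow 2 t
    have h2 : 0 < ((2 : ℕ) : ℝ) * t ^ (2 - 1) := by positivity
    exact ⟨0, _, hasDerivAt_const _ _, h1, le_rfl, h2.le, Or.inl h2⟩
  · have : Continuous fun s => (P.withSigma2 s).gammaInf := by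
      unfold gammaInf Params.withSigma2
      fun_prop
    exact this.continuousAt

lemma exists_hasDerivAt_abar (hP : P.Valid) {t : ℝ} (ht : 0 < t) :
    ∃ a, 0 < a ∧ HasDerivAt (fun k => (P.withKappa k).abar) a t := by
  have hδ := hP.delta_pos
  have hρ := hP.rho_pos
  have hl := hP.lam_nonneg
  have hr : 0 < P.delta ^ 2 * P.rho ^ 2 + 4 * t * P.rho := by positivity
  have h1 : ∃ a, 0 < a ∧ HasDerivAt (fun k => (P.withKappa k).a1) a t := by
    have h2 : HasDerivAt (fun k => P.delta ^ 2 * P.rho ^ 2 + 4 * k * P.rho) (4 * 1 * P.rho) t :=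
      ((((hasDerivAt_id' t).const_mul 4).mul_const P.rho)).const_add _
    have h3 := ((h2.sqrt hr.ne').div_const 4).const_add (-(P.delta * P.rho) / 4)
    exact ⟨_, by have := Real.sqrt_pos.2 hr; positivity, h3⟩
  obtain ⟨a, ha, hda⟩ := h1
  have h1pos : 0 < (P.withKappa t).a1 := (hP.withKappa ht).a1_pos
  have hD : 0 < P.delta * P.rho + P.lam * P.rho + 2 * (P.withKappa t).a1 := by positivity
  have h3 : ∃ a, 0 < a ∧ HasDerivAt (fun k => (P.withKappa k).a3) a t := by
    have h4 := ((hda.const_mul 2).mul_const P.rho).fun_div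
      ((hda.const_mul 2).const_add (P.delta * P.rho + P.lam * P.rho)) hD.ne'
    refine ⟨_, ?_, h4⟩
    refine div_pos ?_ (by positivity)
    -- The numerator of the quotient rule: the terms containing a₁ cancel.
    have : 0 < 2 * a * P.rho * (P.delta * P.rho + P.lam * P.rho) := by positivity
    linarith
  obtain ⟨b, hb, hdb⟩ := h3
  have h3pos := (hP.withKappa ht).a3_pos
  have h5 := (hdb.fun_pow 2).div_const (2 * P.rho)
  refine ⟨_, ?_, h5.congr_of_eventuallyEq ?_⟩
  · positivity
  · filter_upwards [eventually_gt_nhds ht] with k hk using (hP.withKappa hk).abar_eq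

lemma strictMonoOn_abar (hP : P.Valid) :
    StrictMonoOn (fun k => (P.withKappa k).abar) (Ioi 0) := by
  refine strictMonoOn_of_deriv_pos (convex_Ioi 0) (fun t ht => ?_) fun t ht => ?_
  · obtain ⟨a, _, h⟩ := exists_hasDerivAt_abar hP ht
    exact h.continuousAt.continuousWithinAt
  · rw [interior_Ioi] at ht
    obtain ⟨a, ha, h⟩ := exists_hasDerivAt_abar hP ht
    rwa [h.deriv]

/-- Dependence of the equilibrium on the cost coefficient `κ`. -/
theorem kappa_comparative_statics (hP : P.Valid) {g : ℝ → ℝ}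
    (hg : ∀ k, 0 < k → (P.withKappa k).gammaInf < g k) :
    AntitoneOn (fun k => (P.withKappa k).gammaEq (g k)) (Ioi 0) ∧
    MonotoneOn (fun k => (P.withKappa k).hEq (g k)) (Ioi 0) ∧
    (∀ k l, 0 < k → k < l → 0 < (P.withKappa l).hEq (g l) →
      (P.withKappa l).gammaEq (g l) < (P.withKappa k).gammaEq (g k) ∧
      (P.withKappa k).hEq (g k) < (P.withKappa l).hEq (g l)) ∧
    (∀ k, 0 < k → (P.withKappa k).IsActive (g k) → ∃ dγ dh : ℝ,
      HasDerivAt (fun k => (P.withKappa k).gammaEq (g k)) dγ k ∧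
      HasDerivAt (fun k => (P.withKappa k).hEq (g k)) dh k ∧ dγ < 0 ∧ 0 < dh) ∧
    (∀ k, 0 < k → (P.withKappa k).IsInactive (g k) →
      HasDerivAt (fun k => (P.withKappa k).gammaEq (g k)) 0 k ∧
      HasDerivAt (fun k => (P.withKappa k).hEq (g k)) 0 k) := by
  have hA : ∀ t, 0 < t → 0 < (P.withKappa t).abar := fun t ht => (hP.withKappa ht).abar_pos
  have hΓ : ∀ t, 0 < t → PrecisionSteady P.dc P.lam P.delta ((1 / P.sigma1) ^ 2) (P.sigma2 ^ 2)
      (P.withKappa t).abar ((P.withKappa t).gammaEq (g t))⁻¹ ((P.withKappa t).hEq (g t)) :=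
    fun t ht => isPrecisionSteady_gammaEq (hP.withKappa ht) (hg t ht)
  have hmono := strictMonoOn_abar hP
  refine ⟨fun s hs t ht hst => ?_, fun s hs t ht hst => ?_, fun s t hs hst => ?_,
    fun t ht hact => ?_, fun t ht hin => ?_⟩
  · exact (gamma_h_compare hP hA hΓ hs ht (hmono.monotoneOn hs ht hst)).1
  · exact (gamma_h_compare hP hA hΓ hs ht (hmono.monotoneOn hs ht hst)).2.1
  · have hlt := hmono hs (hs.trans hst) hst
    exact (gamma_h_compare hP hA hΓ hs (hs.trans hst) hlt.le).2.2 hlt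
  · obtain ⟨a, ha, hda⟩ := exists_hasDerivAt_abar hP ht
    obtain ⟨y₁, r, h1, h2, h3, h4⟩ := exists_hasDerivAt_gamma_h hP hA hΓ ht hda hact.1 hact.2
    have hy : 0 < y₁ := pos_of_mul_pos_right (h4 ▸ ha) h3.le
    have hY := (hΓ t ht).pos
    have hW := PrecisionSteady.two_mul_lt hP.sigma1_inv_sq_pos hY
      ((hΓ t ht).drift ▸ (hΓ t ht).nonneg)
    have hl := hP.lam_nonneg
    exact ⟨_, _, h1, h2, div_neg_of_neg_of_pos (by linarith) (by positivity),
      mul_pos (by linarith) hy⟩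
  · obtain ⟨a, ha, hda⟩ := exists_hasDerivAt_abar hP ht
    have hev := eventually_gammaInf hP hA hΓ ht hda.continuousAt
      (hin.spec (hP.withKappa ht) (hg t ht)).2.2
    exact ⟨(hasDerivAt_const t P.gammaInf).congr_of_eventuallyEq (hev.mono fun _ h => h.1),
      (hasDerivAt_const t (0 : ℝ)).congr_of_eventuallyEq (hev.mono fun _ h => h.2)⟩

lemma dc_scaleCost (hP : P.Valid) (α : ℝ) {k : ℝ} (hk : 0 ≤ k) :
    (P.scaleCost α).dc k = α * P.dc k :=
  derivWithin_const_mul _ (hP.cost.differentiableOn k hk)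

lemma ddc_scaleCost (hP : P.Valid) (α : ℝ) {k : ℝ} (hk : 0 ≤ k) :
    (P.scaleCost α).ddc k = α * P.ddc k := by
  have : (P.scaleCost α).ddc k = derivWithin (fun k => α * P.dc k) (Ici 0) k :=
    derivWithin_congr (fun r hr => dc_scaleCost hP α hr) (dc_scaleCost hP α hk)
  rw [this, derivWithin_const_mul_field, ddc]

/-- Scaling the information cost amounts to scaling the state cost by the inverse factor. -/
lemma isPrecisionSteady_scaleCost (hP : P.Valid) {α g : ℝ} (hα : 0 < α)
    (hg : (P.scaleCost α).gammaInf < g) :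
    PrecisionSteady P.dc P.lam P.delta ((1 / P.sigma1) ^ 2) (P.sigma2 ^ 2) (P.abar * α⁻¹)
      ((P.scaleCost α).gammaEq g)⁻¹ ((P.scaleCost α).hEq g) := by
  obtain ⟨h1, h2, h3, h4, h5⟩ := isPrecisionSteady_gammaEq (hP.scaleCost hα) hg
  rw [dc_scaleCost hP α h2] at h4 h5
  refine ⟨h1, h2, h3, ?_, fun hk => ?_⟩
  · rw [← div_eq_mul_inv, div_le_iff₀' hα, ← mul_assoc]
    exact h4
  · rw [eq_mul_inv_iff_mul_eq₀ hα.ne', mul_comm, ← mul_assoc]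
    exact h5 hk

/-- The value at the equilibrium rises with the scaling of the information cost. -/
lemma cost_lt_cost (hP : P.Valid) {α β y y' k k' : ℝ} (hα : 0 < α) (hαβ : α ≤ β)
    (h : PrecisionSteady P.dc P.lam P.delta ((1 / P.sigma1) ^ 2) (P.sigma2 ^ 2) (P.abar * α⁻¹) y k)
    (h' : PrecisionSteady P.dc P.lam P.delta ((1 / P.sigma1) ^ 2) (P.sigma2 ^ 2) (P.abar * β⁻¹)
      y' k') (hk : 0 < k) (hy : y' < y) :
    P.abar * y⁻¹ + α * P.c k < P.abar * y'⁻¹ + β * P.c k' := by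
  have hl := hP.lam_nonneg
  have hd := hP.delta_pos
  have hA := hP.abar_pos
  have hy0 := h.pos
  have hy0' := h'.pos
  have hW := PrecisionSteady.two_mul_lt hP.sigma1_inv_sq_pos hy0 (h.drift ▸ h.nonneg)
  have hμ0 := h.marginal_pos hl hd hP.sigma1_inv_sq_pos (by positivity)
  have hgrad : P.c k + P.dc k * (k' - k) ≤ P.c k' :=
    hP.cost.add_marginal_mul_le h.nonneg h'.nonneg
  have hβ : α * P.c k' ≤ β * P.c k' := mul_le_mul_of_nonneg_right hαβ (hP.cost.nonneg _ h'.nonneg)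
  have heq : α * P.dc k * (y ^ 2 * (2 * P.sigma2 ^ 2 * y + P.delta - 2 * P.lam)) = P.abar := by
    rw [mul_assoc, h.eq hk]
    field_simp
  -- The required rate is convex in the precision, so its tangent at y bounds the saving in the
  -- rate.
  have hkk : k - k' ≤ (2 * (P.sigma2 ^ 2 * y) - 2 * P.lam) * (y - y') := by
    rw [← h.drift, ← h'.drift]
    nlinarith [mul_nonneg (sq_nonneg P.sigma2) (sq_nonneg (y - y'))]
  have hαμ : 0 < α * P.dc k := mul_pos hα hμ0
  have h1 : α * P.dc k * (k - k')
      < α * P.dc k * ((2 * P.sigma2 ^ 2 * y + P.delta - 2 * P.lam) * (y - y')) := by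
    -- The weight divided by y² exceeds the slope of the drift by exactly δ; discounting is the
    -- source of the strict inequality.
    refine mul_lt_mul_of_pos_left (hkk.trans_lt ?_) hαμ
    have := mul_pos hd (sub_pos.2 hy)
    linarith
  have h2 : α * P.dc k * ((2 * P.sigma2 ^ 2 * y + P.delta - 2 * P.lam) * (y - y'))
      = P.abar * ((y - y') / y ^ 2) := by
    rw [← heq]
    field_simp
  have h3 : (y - y') / y ^ 2 ≤ y'⁻¹ - y⁻¹ := by
    rw [inv_sub_inv hy0'.ne' hy0.ne']
    refine div_le_div_of_nonneg_left (by linarith) (by positivity) ?_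
    nlinarith
  have h4 := mul_le_mul_of_nonneg_left h3 hA.le
  have h5 := mul_le_mul_of_nonneg_left hgrad hα.le
  linarith

/-- Dependence of the equilibrium on the scaling of the information cost. -/
theorem scaleCost_comparative_statics (hP : P.Valid) {g : ℝ → ℝ}
    (hg : ∀ α, 0 < α → (P.scaleCost α).gammaInf < g α) :
    MonotoneOn (fun α => (P.scaleCost α).gammaEq (g α)) (Ioi 0) ∧
    AntitoneOn (fun α => (P.scaleCost α).hEq (g α)) (Ioi 0) ∧
    MonotoneOn (fun α => (P.scaleCost α).vEq (g α)) (Ioi 0) ∧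
    (0 < P.c 0 → StrictMonoOn (fun α => (P.scaleCost α).vEq (g α)) (Ioi 0)) ∧
    (∀ α β, 0 < α → α < β → 0 < (P.scaleCost α).hEq (g α) →
      (P.scaleCost α).gammaEq (g α) < (P.scaleCost β).gammaEq (g β) ∧
      (P.scaleCost β).hEq (g β) < (P.scaleCost α).hEq (g α) ∧
      (P.scaleCost α).vEq (g α) < (P.scaleCost β).vEq (g β)) ∧
    (∀ α, 0 < α → (P.scaleCost α).IsActive (g α) → ∃ dγ dh dw : ℝ,
      HasDerivAt (fun α => (P.scaleCost α).gammaEq (g α)) dγ α ∧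
      HasDerivAt (fun α => (P.scaleCost α).hEq (g α)) dh α ∧
      HasDerivAt (fun α => (P.scaleCost α).vEq (g α)) dw α ∧ 0 < dγ ∧ dh < 0 ∧ 0 < dw) ∧
    (∀ α, 0 < α → (P.scaleCost α).IsInactive (g α) →
      HasDerivAt (fun α => (P.scaleCost α).gammaEq (g α)) 0 α ∧
      HasDerivAt (fun α => (P.scaleCost α).hEq (g α)) 0 α ∧
      HasDerivAt (fun α => (P.scaleCost α).vEq (g α)) (P.c 0 / P.delta) α) := by
  have hl := hP.lam_nonneg
  have hd := hP.delta_pos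
  have hā := hP.abar_pos
  set Γ := fun α => (P.scaleCost α).gammaEq (g α) with hΓdef
  set K := fun α => (P.scaleCost α).hEq (g α) with hKdef
  have hA : ∀ t, 0 < t → 0 < P.abar * t⁻¹ := fun t ht => mul_pos hā (inv_pos.2 ht)
  have hΓ : ∀ t, 0 < t → PrecisionSteady P.dc P.lam P.delta ((1 / P.sigma1) ^ 2) (P.sigma2 ^ 2)
      (P.abar * t⁻¹) (Γ t)⁻¹ (K t) := fun t ht => isPrecisionSteady_scaleCost hP ht (hg t ht)
  have hv : ∀ t, 0 < t → (P.scaleCost t).vEq (g t)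
      = (P.abar * Γ t + t * P.c (K t)) / P.delta := fun t ht => vEq_eq (hP.scaleCost ht) (hg t ht)
  have hanti : ∀ s t, 0 < s → s ≤ t → P.abar * t⁻¹ ≤ P.abar * s⁻¹ := fun s t hs hst => by gcongr
  have hmono := fun {s t : ℝ} (hs : 0 < s) (hst : s ≤ t) =>
    gamma_h_compare hP hA hΓ (hs.trans_le hst) hs (hanti s t hs hst)
  have hstrict : ∀ s t, 0 < s → s < t → 0 < K s → Γ s < Γ t ∧ K t < K s := fun s t hs hst =>
    (hmono hs hst.le).2.2 (mul_lt_mul_of_pos_left (inv_strictAnti₀ hs hst) hā)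
  have hvlt : ∀ s t, 0 < s → s < t → 0 < K s →
      (P.scaleCost s).vEq (g s) < (P.scaleCost t).vEq (g t) := fun s t hs hst hk => by
    have ht := hs.trans hst
    have h1 := cost_lt_cost hP hs hst.le (hΓ s hs) (hΓ t ht) hk
      (inv_strictAnti₀ (inv_pos.1 (hΓ s hs).pos) (hstrict s t hs hst hk).1)
    rw [inv_inv, inv_inv] at h1
    rw [hv s hs, hv t ht]
    exact div_lt_div_of_pos_right h1 hd
  -- Once no information is acquired, a higher cost scale leaves the rate at 0, and the drift
  -- equation alone fixes γ.
  have hzero : ∀ s t, 0 < s → s < t → K s = 0 → Γ t = Γ s ∧ K t = 0 := fun s t hs hst hk => by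
    have ht := hs.trans hst
    obtain ⟨h1, h2, -⟩ := hmono hs hst.le
    have hkt : K t = 0 := le_antisymm (h2.trans hk.le) (hΓ t ht).nonneg
    refine ⟨le_antisymm ?_ h1, hkt⟩
    by_contra! hlt
    have h3 := PrecisionSteady.drift_strictMono hl hP.sigma1_inv_sq_pos (hΓ t ht).pos
      ((hΓ t ht).drift ▸ (hΓ t ht).nonneg) (inv_strictAnti₀ (inv_pos.1 (hΓ s hs).pos) hlt)
    rw [(hΓ t ht).drift, (hΓ s hs).drift, hk, hkt] at h3
    exact lt_irrefl _ h3
  have hveq : ∀ s t, 0 < s → s < t → K s = 0 → (P.scaleCost t).vEq (g t)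
      = (P.scaleCost s).vEq (g s) + (t - s) * P.c 0 / P.delta := fun s t hs hst hk => by
    obtain ⟨h1, h2⟩ := hzero s t hs hst hk
    rw [hv s hs, hv t (hs.trans hst), h1, h2, hk]
    ring
  refine ⟨fun s hs t _ hst => (hmono hs hst).1, fun s hs t _ hst => (hmono hs hst).2.1,
    fun s hs t _ hst => ?_, fun hc0 s hs t _ hst => ?_, fun s t hs hst hk => ?_,
    fun t ht hact => ?_, fun t ht hin => ?_⟩
  · rcases hst.eq_or_lt with rfl | hlt
    · exact le_rfl
    rcases (hΓ s hs).nonneg.eq_or_lt with hk | hk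
    · have h1 := hveq s t hs hlt hk.symm
      have h2 : 0 ≤ (t - s) * P.c 0 / P.delta :=
        div_nonneg (mul_nonneg (by linarith) (hP.cost.nonneg 0 le_rfl)) hd.le
      change (P.scaleCost s).vEq (g s) ≤ (P.scaleCost t).vEq (g t)
      linarith
    · exact (hvlt s t hs hlt hk).le
  · rcases (hΓ s hs).nonneg.eq_or_lt with hk | hk
    · have h1 := hveq s t hs hst hk.symm
      have h2 : 0 < (t - s) * P.c 0 / P.delta :=
        div_pos (mul_pos (by linarith) hc0) hd
      change (P.scaleCost s).vEq (g s) < (P.scaleCost t).vEq (g t)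
      linarith
    · exact hvlt s t hs hst hk
  · obtain ⟨h1, h2⟩ := hstrict s t hs hst hk
    exact ⟨h1, h2, hvlt s t hs hst hk⟩
  · obtain ⟨hk, hdd⟩ := hact
    rw [ddc_scaleCost hP t (hΓ t ht).nonneg] at hdd
    have hdd' : 0 < P.ddc (K t) := pos_of_mul_pos_right hdd ht.le
    obtain ⟨y₁, r, h1, h2, h3, h4⟩ := exists_hasDerivAt_gamma_h hP hA hΓ ht
      ((hasDerivAt_inv ht.ne').const_mul P.abar) hk hdd'
    have hy : y₁ < 0 := by
      by_contra! hcon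
      have h5 := mul_nonneg h3.le hcon
      have h6 : 0 < P.abar * (t ^ 2)⁻¹ := by positivity
      linarith
    have hY := (hΓ t ht).pos
    have hW := PrecisionSteady.two_mul_lt hP.sigma1_inv_sq_pos hY
      ((hΓ t ht).drift ▸ (hΓ t ht).nonneg)
    have hμ0 := (hΓ t ht).marginal_pos hl hd hP.sigma1_inv_sq_pos (hA t ht)
    have heq := (hΓ t ht).eq hk
    refine ⟨_, _, _, h1, h2, HasDerivAt.congr_of_eventuallyEq
      (((h1.const_mul P.abar).add ((hasDerivAt_id' t).mul
        ((hasDerivAt_c hP hk).comp t h2))).div_const P.delta)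
      (by filter_upwards [eventually_gt_nhds ht] with s hs using hv s hs),
      div_pos (by linarith) (by positivity), mul_neg_of_pos_of_neg (by linarith) hy, ?_⟩
    -- After ā is eliminated by the first-order condition, the terms with y₁ combine to α c'(h) δ
    -- (−y₁) > 0; the remaining term is c(h) ≥ 0.
    refine div_pos ?_ hd
    have hc := hP.cost.nonneg _ (hΓ t ht).nonneg
    have heq' : P.abar = t * P.dc (K t) *
        ((Γ t)⁻¹ ^ 2 * (2 * P.sigma2 ^ 2 * (Γ t)⁻¹ + P.delta - 2 * P.lam)) := by
      rw [mul_assoc, heq]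
      field_simp
    have h5 : P.abar * (-y₁ / (Γ t)⁻¹ ^ 2)
        = t * P.dc (K t) * (2 * P.sigma2 ^ 2 * (Γ t)⁻¹ + P.delta - 2 * P.lam) * -y₁ := by
      have h6 : ∀ a b Y : ℝ, Y ≠ 0 → a * (Y ^ 2 * b) * (-y₁ / Y ^ 2) = a * b * -y₁ := by
        intro a b Y hY
        field_simp
      rw [heq', h6 _ _ _ hY.ne']
    have h6 : 0 < t * P.dc (K t) * P.delta * -y₁ := by
      have : 0 < -y₁ := by linarith
      positivity
    rw [h5]
    simp only [Function.comp]
    linarith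
  · obtain ⟨-, -, hlt⟩ := hin.spec (hP.scaleCost ht) (hg t ht)
    have hlt' : P.abar * t⁻¹ < P.dc 0 * (P.gammaInf⁻¹ ^ 2 *
        (2 * P.sigma2 ^ 2 * P.gammaInf⁻¹ + P.delta - 2 * P.lam)) := by
      rw [dc_scaleCost hP t le_rfl, mul_assoc] at hlt
      rw [← div_eq_mul_inv, div_lt_iff₀' ht]
      exact hlt
    have hev := eventually_gammaInf hP hA hΓ ht
      ((hasDerivAt_inv ht.ne').const_mul P.abar).continuousAt hlt'
    refine ⟨(hasDerivAt_const t P.gammaInf).congr_of_eventuallyEq (hev.mono fun _ h => h.1),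
      (hasDerivAt_const t (0 : ℝ)).congr_of_eventuallyEq (hev.mono fun _ h => h.2), ?_⟩
    have h1 := (((hasDerivAt_id' t).mul_const (P.c 0)).const_add (P.abar * P.gammaInf)).div_const
      P.delta
    rw [one_mul] at h1
    refine h1.congr_of_eventuallyEq ?_
    filter_upwards [hev, eventually_gt_nhds ht] with s h2 hs
    rw [hv s hs, h2.1, h2.2]

end Params
end

theorem mainTheorem10 (P : Params) (hP : P.Valid) :
    -- the equilibrium is well defined and is the solution of the state-adjoint equilibrium system
    (∀ g : ℝ, P.gammaInf < g →
      P.gammaEq g ∈ Ioc 0 P.gammaInf ∧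
      (∀ γ ∈ Icc 0 g, P.f γ (P.feedback g γ) = 0 ↔ γ = P.gammaEq g) ∧
      DifferentiableAt ℝ (P.v g) (P.gammaEq g) ∧
      (∀ γ p : ℝ, 0 ≤ γ → (P.Phi g γ p = 0 ↔ γ = P.gammaEq g ∧ p = P.pEq g))) ∧
    -- dependence on the volatility `σ₁`
    (∀ g : ℝ → ℝ, (∀ s, 0 < s → (P.withSigma1 s).gammaInf < g s) →
      Params.IncreasingInVolatility P.withSigma1 g) ∧
    -- dependence on the volatility `σ₂`
    (∀ g : ℝ → ℝ, (∀ s, 0 < s → (P.withSigma2 s).gammaInf < g s) →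
      Params.IncreasingInVolatility P.withSigma2 g) ∧
    -- dependence on the cost coefficient `κ`
    (∀ g : ℝ → ℝ, (∀ k, 0 < k → (P.withKappa k).gammaInf < g k) →
      AntitoneOn (fun k => (P.withKappa k).gammaEq (g k)) (Ioi 0) ∧
      MonotoneOn (fun k => (P.withKappa k).hEq (g k)) (Ioi 0) ∧
      (∀ k l, 0 < k → k < l → 0 < (P.withKappa l).hEq (g l) →
        (P.withKappa l).gammaEq (g l) < (P.withKappa k).gammaEq (g k) ∧
        (P.withKappa k).hEq (g k) < (P.withKappa l).hEq (g l)) ∧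
      (∀ k, 0 < k → (P.withKappa k).IsActive (g k) → ∃ dγ dh : ℝ,
        HasDerivAt (fun k => (P.withKappa k).gammaEq (g k)) dγ k ∧
        HasDerivAt (fun k => (P.withKappa k).hEq (g k)) dh k ∧ dγ < 0 ∧ 0 < dh) ∧
      (∀ k, 0 < k → (P.withKappa k).IsInactive (g k) →
        HasDerivAt (fun k => (P.withKappa k).gammaEq (g k)) 0 k ∧
        HasDerivAt (fun k => (P.withKappa k).hEq (g k)) 0 k)) ∧
    -- dependence on the scaling `α` of the information cost
    (∀ g : ℝ → ℝ, (∀ α, 0 < α → (P.scaleCost α).gammaInf < g α) →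
      MonotoneOn (fun α => (P.scaleCost α).gammaEq (g α)) (Ioi 0) ∧
      AntitoneOn (fun α => (P.scaleCost α).hEq (g α)) (Ioi 0) ∧
      MonotoneOn (fun α => (P.scaleCost α).vEq (g α)) (Ioi 0) ∧
      (0 < P.c 0 → StrictMonoOn (fun α => (P.scaleCost α).vEq (g α)) (Ioi 0)) ∧
      (∀ α β, 0 < α → α < β → 0 < (P.scaleCost α).hEq (g α) →
        (P.scaleCost α).gammaEq (g α) < (P.scaleCost β).gammaEq (g β) ∧
        (P.scaleCost β).hEq (g β) < (P.scaleCost α).hEq (g α) ∧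
        (P.scaleCost α).vEq (g α) < (P.scaleCost β).vEq (g β)) ∧
      (∀ α, 0 < α → (P.scaleCost α).IsActive (g α) → ∃ dγ dh dw : ℝ,
        HasDerivAt (fun α => (P.scaleCost α).gammaEq (g α)) dγ α ∧
        HasDerivAt (fun α => (P.scaleCost α).hEq (g α)) dh α ∧
        HasDerivAt (fun α => (P.scaleCost α).vEq (g α)) dw α ∧ 0 < dγ ∧ dh < 0 ∧ 0 < dw) ∧
      (∀ α, 0 < α → (P.scaleCost α).IsInactive (g α) →
        HasDerivAt (fun α => (P.scaleCost α).gammaEq (g α)) 0 α ∧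
        HasDerivAt (fun α => (P.scaleCost α).hEq (g α)) 0 α ∧
        HasDerivAt (fun α => (P.scaleCost α).vEq (g α)) (P.c 0 / P.delta) α)) := by
  exact ⟨fun _ hg => Params.equilibrium hP hg,
    fun _ hg => Params.increasingInVolatility_withSigma1 hP hg,
    fun _ hg => Params.increasingInVolatility_withSigma2 hP hg,
    fun _ hg => Params.kappa_comparative_statics hP hg,
    fun _ hg => Params.scaleCost_comparative_statics hP hg⟩
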